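/- Let $p>2$ be a prime, $\mathbb F$ a field of characteristic $p$, $E=(\mathbb Z/p)^4$ with generators $e_1,\dots,e_4$, and $M=(c_{ij})\in\mathbb F^{2\times 4}$. Let $E$ act on $\mathbb F[V_M]=\mathbb F[x,y,z]$ by algebra automorphisms with $x\cdot e_j=x$, $y\cdot e_j=y+c_{1j}x$, $z\cdot e_j=z+2c_{1j}y+(c_{1j}^2+c_{2j})x$, let $\mathbb F[V_M]^E$ be the ring of invariants, and let $N_M(z)$ be the product of the elements of the $E$-orbit of $z$. Use the graded reverse lexicographic order with $x<y<z$, with lead terms $\mathrm{LT}$ and lead monomials $\mathrm{LM}$. Let $\Gamma(M)$ be the $10\times 4$ matrix whose rows $2i+1$ and $2i+2$ ($0\le i\le 4$) are $(c_{11}^{p^i},\dots,c_{14}^{p^i})$ and $(c_{21}^{p^i},\dots,c_{24}^{p^i})$, and let $\gamma_{ijk\ell}=\gamma_{ijk\ell}(M)$ be its $4\times4$ minor on the rows $i,j,k,\ell$. Put $\delta=y^2-xz$. Augment $\Gamma(M)$ by the column with entries $(y/x)^{p^i}$ in row $2i+1$ and $(-\delta/x^2)^{p^i}$ in row $2i+2$,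 and let $\bar f_J$ be the $5\times5$ minor on the rows $J$, multiplied by the largest power of $x$ that occurs in the denominators of the new entries in these rows. Define $\bar f_1=\bar f_{12345}$ and $$\bar f_2=\frac{\bar f_1^2+\gamma_{1234}\bar f_{12346}}{2x^{p^2-2p}},\qquad \bar f_3=-\frac{\gamma_{1235}}{\gamma_{1234}^{2p+2}x^{2p^2-2}}\,\tilde f_3,$$ $$\tilde f_3=\gamma_{1235}^p\bar f_1^{p+2}-\gamma_{1234}^2\bar f_2^p-2\gamma_{1235}^p x^{p^2-2p}\bar f_1^p\bar f_2+\alpha_2x^{p^2}\bar f_1^{p+1}+\alpha_3x^{2p^2-2p}\bar f_1^{p-1}\bar f_2+\alpha_4x^{2p^2-p}\bar f_1^{\frac{p-3}2}\bar f_2^{\frac{p+1}2},$$ where for $p\ge5$ $$\alpha_2=\gamma_{1234}\gamma_{1245}^p,\quad \alpha_3=\frac{\gamma_{1234}^{p+1}\gamma_{1237}}{\gamma_{1235}},\quad \alpha_4=\frac{\gamma_{1234}^{p+3}\gamma_{1257}}{\gamma_{1235}^{(p+3)/2}},$$ and for $p=3$ one has to add $\gamma_{1235}^6/\gamma_{1234}^2$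 to this $\alpha_2$, to subtract $\gamma_{1235}^6/\gamma_{1234}^2$ from this $\alpha_3$, and to subtract the new $\alpha_3$ from this $\alpha_4$. For a finite family $h=(h_j)$ of polynomials, a subduction step replaces a nonzero $f$ by $f-c\,h^I$, where $\mathrm{LT}(f)=\mathrm{LT}(c\,h^I)$; a tête-à-tête $(h^I,h^J)$, $\mathrm{LM}(h^I)=\mathrm{LM}(h^J)$, subducts to $g$ if finitely many such steps lead from $h^I-c\,h^J$ to $g$, where $\mathrm{LT}(h^I)=\mathrm{LT}(c\,h^J)$. If $g=0$, the subduction expresses $h^I-c\,h^J$ as a linear combination of products $h^K$, and so gives a relation among the $h_j$. A subset of a subalgebra $A$ of $\mathbb F[x,y,z]$ is a SAGBI basis of $A$ if the lead monomials of its elements generate the lead term algebra of $A$. An algebra is a complete intersection if it has a presentation whose ideal of relations is generated by a regular sequence. **Theorem.** Suppose that $\gamma_{1234}(M)$, $\gamma_{1235}(M)$ and $\gamma_{1357}(M)$ are all nonzero. Then the divisions in the definitions of $\bar f_2$ and $\bar f_3$ are exact; the tête-à-tête $(\bar f_1^{p+2},\bar f_2^p)$ subducts, using $\{x,\bar f_1,\bar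 f_2\}$, to a nonzero scalar multiple of $x^{2p^2-2}\bar f_3$; and $\mathrm{LT}(\bar f_3)=\gamma_{1357}(M)\,y^{p^3+2}$. The set $\mathcal B=\{x,\bar f_1,\bar f_2,\bar f_3,N_M(z)\}$ is a SAGBI basis, and hence a generating set, of $\mathbb F[V_M]^E$. Furthermore, $\mathbb F[V_M]^E$ is a complete intersection: the têtes-à-têtes $(\bar f_2^p,\bar f_1^{p+2})$ and $(\bar f_3^p,\bar f_2\bar f_1^{p^2-1})$ subduct to zero using $\mathcal B$, and any two relations that come from such subductions (one for each of the two pairs) generate the ideal of relations among the elements of $\mathcal B$ and form a regular sequence in the polynomial ring in five variables. -/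

import Mathlib

open MvPolynomial

namespace RankFour

noncomputable section

/-! ### The graded reverse lexicographic order on three variables

Variables: `z = X 0`, `y = X 1`, `x = X 2`, ordered by `x < y < z`. -/

/-- Exponent vectors in three variables, to be ordered by graded reverse lexicographic order. -/
def GRevLex : Type := Fin 3 →₀ ℕ

instance : AddCommMonoid GRevLex := inferInstanceAs (AddCommMonoid (Fin 3 →₀ ℕ))

/-- Grevlex in three variables is the lexicographic order of
`(total degree, degree in the two largest variables, degree in the largest variable)`;
see `grevlex_lt_iff` for the usual description. -/
def GRevLex.key (a : GRevLex) : ℕ ×ₗ (ℕ ×ₗ ℕ) :=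
  let a' : Fin 3 →₀ ℕ := a
  toLex (a' 0 + a' 1 + a' 2, toLex (a' 0 + a' 1, a' 0))

theorem GRevLex.key_injective : Function.Injective GRevLex.key := by
  intro a b h
  have h' := h
  simp only [GRevLex.key, EmbeddingLike.apply_eq_iff_eq, Prod.mk.injEq] at h'
  obtain ⟨h1, h2, h3⟩ := h'
  refine Finsupp.ext (α := Fin 3) (M := ℕ) fun i => ?_
  fin_cases i
  · exact h3
  · exact Nat.add_left_cancel (h3 ▸ h2)
  · exact Nat.add_left_cancel (h2 ▸ h1)

theorem GRevLex.key_add (a b : GRevLex) : (a + b).key = a.key + b.key := by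
  have h (a b : Fin 3 →₀ ℕ) : toLex ((a + b) 0 + (a + b) 1 + (a + b) 2,
        toLex ((a + b) 0 + (a + b) 1, (a + b) 0)) =
      toLex (a 0 + a 1 + a 2, toLex (a 0 + a 1, a 0)) +
        toLex (b 0 + b 1 + b 2, toLex (b 0 + b 1, b 0)) := by
    simp only [← toLex_add, Prod.mk_add_mk, Finsupp.add_apply]
    congr 2
    · ring
    · congr 2; ring
  exact h a b

instance : LinearOrder GRevLex := LinearOrder.lift' GRevLex.key GRevLex.key_injective

theorem GRevLex.le_iff (a b : GRevLex) : a ≤ b ↔ a.key ≤ b.key := Iff.rfl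

theorem GRevLex.lt_iff (a b : GRevLex) : a < b ↔ a.key < b.key := Iff.rfl

instance : IsOrderedAddMonoid GRevLex where
  add_le_add_left a b h c := by
    rw [GRevLex.le_iff] at h ⊢
    rw [GRevLex.key_add, GRevLex.key_add]
    exact add_le_add_left h _

instance : WellFoundedLT GRevLex :=
  ⟨InvImage.wf GRevLex.key (wellFounded_lt (α := ℕ ×ₗ (ℕ ×ₗ ℕ)))⟩

/-- The graded reverse lexicographic order with `X 2 < X 1 < X 0`, i.e. `x < y < z`. -/
def grevlex : MonomialOrder (Fin 3) where
  syn := GRevLex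
  toSyn := { toFun := fun a => a, invFun := fun a => a, map_add' := fun _ _ => rfl }
  toSyn_monotone := by
    intro a b h
    change GRevLex.key a ≤ GRevLex.key b
    have h0 := h 0
    have h1 := h 1
    have h2 := h 2
    simp only [GRevLex.key, Prod.Lex.toLex_le_toLex]
    omega

open scoped MonomialOrder in
/-- The usual description: compare total degrees; if they agree, look at the smallest variable
(the one of largest index) where the exponents differ; the larger exponent is the smaller
monomial. -/
theorem grevlex_lt_iff (a b : Fin 3 →₀ ℕ) :
    a ≺[grevlex] b ↔ a 0 + a 1 + a 2 < b 0 + b 1 + b 2 ∨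
      (a 0 + a 1 + a 2 = b 0 + b 1 + b 2 ∧ ∃ i, b i < a i ∧ ∀ j, i < j → a j = b j) := by
  change GRevLex.key a < GRevLex.key b ↔ _
  simp only [GRevLex.key, Prod.Lex.toLex_lt_toLex, Fin.exists_fin_succ, Fin.forall_fin_succ]
  simp
  omega

/-! ### SAGBI bases and subduction -/

/-- The lead term `LT(f)`. -/
abbrev leadTerm {F : Type*} [Field F] (f : MvPolynomial (Fin 3) F) : MvPolynomial (Fin 3) F :=
  grevlex.leadingTerm f

/-- The lead monomial `LM(f)`, as a polynomial with coefficient one. -/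
abbrev leadMonomial {F : Type*} [Field F] (f : MvPolynomial (Fin 3) F) : MvPolynomial (Fin 3) F :=
  monomial (grevlex.degree f) 1

/-- `B` is a SAGBI basis of the subalgebra `A`: it lies in `A`, and the lead monomials of its
elements generate the lead term algebra of `A`. -/
def IsSagbiBasis {F : Type*} [Field F] (A : Subalgebra F (MvPolynomial (Fin 3) F))
    (B : Set (MvPolynomial (Fin 3) F)) : Prop :=
  B ⊆ A ∧ Algebra.adjoin F (leadMonomial '' B) =
    Algebra.adjoin F (leadTerm '' (A : Set (MvPolynomial (Fin 3) F)))

/-- The product `h^I = ∏ j, h j ^ I j`. -/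
def powProd {F : Type*} [Field F] {σ : Type*} (h : σ → MvPolynomial (Fin 3) F) (I : σ →₀ ℕ) :
    MvPolynomial (Fin 3) F :=
  I.prod fun j n => h j ^ n

/-- `Subducts h f P g`: subduction using `h` leads from `f` to `g` in finitely many steps, each
of which replaces the current nonzero polynomial `f` by `f - c h^I` with `LT(f) = LT(c h^I)`.
The polynomial `P` in new variables records the sum of the `c T^I` that were used. -/
inductive Subducts {F : Type*} [Field F] {σ : Type*} (h : σ → MvPolynomial (Fin 3) F) :
    MvPolynomial (Fin 3) F → MvPolynomial σ F → MvPolynomial (Fin 3) F → Prop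
  | refl (f : MvPolynomial (Fin 3) F) : Subducts h f 0 f
  | step (f g : MvPolynomial (Fin 3) F) (P : MvPolynomial σ F) (I : σ →₀ ℕ) (c : F)
      (hf : f ≠ 0) (hLT : leadTerm f = leadTerm (C c * powProd h I))
      (rest : Subducts h (f - C c * powProd h I) P g) :
      Subducts h f (monomial I c + P) g

/-- The tête-à-tête `(h^I, h^J)` subducts to `g` using `h`, with `Q` recording the subduction:
for the scalar `c` with `LT(h^I) = LT(c h^J)`, the difference `h^I - c h^J` subducts to `g`, and
`Q` is `T^I - c T^J` minus the sum of the terms `c' T^K` used in the subduction. If `g = 0`, then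
`Q` is the relation among the `h j` that comes from this subduction. -/
def TatSubducts {F : Type*} [Field F] {σ : Type*} (h : σ → MvPolynomial (Fin 3) F)
    (I J : σ →₀ ℕ) (Q : MvPolynomial σ F) (g : MvPolynomial (Fin 3) F) : Prop :=
  ∃ (c : F) (P : MvPolynomial σ F),
    leadTerm (powProd h I) = leadTerm (C c * powProd h J) ∧
    Subducts h (powProd h I - C c * powProd h J) P g ∧
    Q = monomial I 1 - monomial J c - P

/-- An algebra is a complete intersection if it has a presentation for which the ideal of
relations is generated by a regular sequence. -/
def IsCompleteIntersection (F : Type*) [Field F] (A : Type*) [CommRing A] [Algebra F A] : Prop :=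
  ∃ (n : ℕ) (φ : MvPolynomial (Fin n) F →ₐ[F] A) (rs : List (MvPolynomial (Fin n) F)),
    Function.Surjective φ ∧
    RingTheory.Sequence.IsRegular (MvPolynomial (Fin n) F) rs ∧
    RingHom.ker φ = Ideal.ofList rs

/-! ### The representation `V_M` and its invariants -/

/-- The matrix `σ(c₁, c₂)`. -/
def sigma {F : Type*} [Field F] (c₁ c₂ : F) : Matrix (Fin 3) (Fin 3) F :=
  !![1, 2 * c₁, c₁ ^ 2 + c₂; 0, 1, c₁; 0, 0, 1]

theorem sigma_zero {F : Type*} [Field F] : sigma (0 : F) 0 = 1 := by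
  ext i j; fin_cases i <;> fin_cases j <;> simp [sigma]

theorem sigma_add {F : Type*} [Field F] (a b c d : F) :
    sigma (a + c) (b + d) = sigma a b * sigma c d := by
  ext i j
  fin_cases i <;> fin_cases j <;> simp [sigma, Matrix.mul_apply, Fin.sum_univ_three] <;> ring

/-- The representation of `E = (ℤ/p)⁴` on `V_M`: the `j`-th generator acts by
`σ(M 0 j, M 1 j)`, see `rep_single`. -/
def rep {F : Type*} [Field F] (p : ℕ) [CharP F p] (M : Matrix (Fin 2) (Fin 4) F) :
    Multiplicative (Fin 4 → ZMod p) →* Matrix (Fin 3) (Fin 3) F where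
  toFun g := sigma (∑ j, ZMod.castHom (dvd_refl p) F (g.toAdd j) * M 0 j)
    (∑ j, ZMod.castHom (dvd_refl p) F (g.toAdd j) * M 1 j)
  map_one' := by simp [sigma_zero]
  map_mul' g g' := by
    simp only [toAdd_mul, Pi.add_apply, map_add, add_mul, Finset.sum_add_distrib, sigma_add]

theorem rep_single {F : Type*} [Field F] (p : ℕ) [CharP F p] (M : Matrix (Fin 2) (Fin 4) F)
    (j : Fin 4) :
    rep p M (Multiplicative.ofAdd (Pi.single j 1)) = sigma (M 0 j) (M 1 j) := by
  have key (k : Fin 2) : ∑ i, ZMod.castHom (dvd_refl p) F ((Pi.single j 1 : Fin 4 → ZMod p) i)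
      * M k i = M k j := by
    rw [Finset.sum_eq_single j]
    · rw [Pi.single_eq_same, map_one, one_mul]
    · intro i _ hi
      rw [Pi.single_eq_of_ne hi, map_zero, zero_mul]
    · simp
  change sigma (∑ i, ZMod.castHom (dvd_refl p) F ((Pi.single j 1 : Fin 4 → ZMod p) i) * M 0 i)
    (∑ i, ZMod.castHom (dvd_refl p) F ((Pi.single j 1 : Fin 4 → ZMod p) i) * M 1 i) = _
  rw [key, key]

/-- The action `f ↦ f · g` on `F[V_M] = F[x, y, z]`: right multiplication on the row vectors
`z = [1 0 0]`, `y = [0 1 0]`, `x = [0 0 1]`, extended to algebra automorphisms. -/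
def act {F : Type*} [Field F] (p : ℕ) [CharP F p] (M : Matrix (Fin 2) (Fin 4) F)
    (g : Multiplicative (Fin 4 → ZMod p)) :
    MvPolynomial (Fin 3) F →ₐ[F] MvPolynomial (Fin 3) F :=
  aeval fun i => ∑ j, C (rep p M g i j) * X j

/-- The ring of invariants `F[V_M]^E`. -/
def invariants {F : Type*} [Field F] (p : ℕ) [CharP F p] (M : Matrix (Fin 2) (Fin 4) F) :
    Subalgebra F (MvPolynomial (Fin 3) F) :=
  ⨅ g : Multiplicative (Fin 4 → ZMod p), AlgHom.equalizer (act p M g) (AlgHom.id F _)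

open Classical in
/-- The norm `N_M(f)`: the product over the orbit `{f · g | g ∈ E}`. -/
def normM {F : Type*} [Field F] (p : ℕ) [Fact p.Prime] [CharP F p]
    (M : Matrix (Fin 2) (Fin 4) F) (f : MvPolynomial (Fin 3) F) : MvPolynomial (Fin 3) F :=
  ∏ h ∈ Finset.univ.image (fun g => act p M g f), h

/-! ### The minors and the invariants `f_J` -/

/-- Row `r = 1, 2, 3, …` of the matrix `Γ`, evaluated at `M`: row `2 i + 1` holds the `p^i`-th
powers of the first row of `M`, and row `2 i + 2` those of the second row. -/
def gammaRow {F : Type*} [Field F] (p : ℕ) (M : Matrix (Fin 2) (Fin 4) F) (r : ℕ) (j : Fin 4) :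
    F :=
  M (if Odd r then 0 else 1) j ^ p ^ ((r - 1) / 2)

/-- The minor `γ_{ijkl}(M)` for `J = ![i, j, k, l]`. -/
def gam {F : Type*} [Field F] (p : ℕ) (M : Matrix (Fin 2) (Fin 4) F) (J : Fin 4 → ℕ) : F :=
  (Matrix.of fun a b => gammaRow p M (J a) b).det

/-- `δ = y² - x z`. -/
def delta (F : Type*) [Field F] : MvPolynomial (Fin 3) F := X 1 ^ 2 - X 2 * X 0

/-- The exponent of `x` in the denominator of the entry in row `r` of the column
`[y/x, -δ/x², (y/x)^p, (-δ/x²)^p, …]` that is added to `Γ`. -/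
def denExp (p r : ℕ) : ℕ := if Odd r then p ^ ((r - 1) / 2) else 2 * p ^ ((r - 1) / 2)

/-- The numerator (a power of `y` or of `-δ`) of that entry. -/
def numEntry (F : Type*) [Field F] (p r : ℕ) : MvPolynomial (Fin 3) F :=
  (if Odd r then X 1 else -delta F) ^ p ^ ((r - 1) / 2)

/-- The polynomial `f̄_J` for `J = ![j₁, …, j₅]`: the `5 × 5` minor, with rows `J`, of `Γ` (at `M`)
augmented by the column `[y/x, -δ/x², (y/x)^p, (-δ/x²)^p, …]`, times `x^D`, where `D`
is the largest of the exponents in the denominators of the five new entries. The factor `x^D`,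
which minimally clears the denominator of the minor of the generic matrix, is multiplied into
the last column. -/
def fMinor {F : Type*} [Field F] (p : ℕ) (M : Matrix (Fin 2) (Fin 4) F) (J : Fin 5 → ℕ) :
    MvPolynomial (Fin 3) F :=
  (Matrix.of fun a b =>
    Fin.snoc (α := fun _ => MvPolynomial (Fin 3) F)
      (fun j : Fin 4 => C (gammaRow p M (J a) j))
      (numEntry F p (J a) *
        X 2 ^ ((Finset.univ.sup fun a' => denExp p (J a')) - denExp p (J a))) b).det

/-- `f̄₁ = f̄_{12345}`. -/
def f₁ {F : Type*} [Field F] (p : ℕ) (M : Matrix (Fin 2) (Fin 4) F) : MvPolynomial (Fin 3) F :=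
  fMinor p M ![1, 2, 3, 4, 5]

/-- `f̄₂ = (f̄₁² + γ₁₂₃₄ f̄_{12346}) / (2 x^(p²-2p))`. -/
def f₂ {F : Type*} [Field F] (p : ℕ) (M : Matrix (Fin 2) (Fin 4) F) : MvPolynomial (Fin 3) F :=
  C (2⁻¹ : F) * (f₁ p M ^ 2 + C (gam p M ![1, 2, 3, 4]) *
    fMinor p M ![1, 2, 3, 4, 6]).divMonomial (Finsupp.single 2 (p ^ 2 - 2 * p))

/-- The coefficient `α₂`. -/
def alpha₂ {F : Type*} [Field F] (p : ℕ) (M : Matrix (Fin 2) (Fin 4) F) : F :=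
  gam p M ![1, 2, 3, 4] * gam p M ![1, 2, 4, 5] ^ p +
    if p = 3 then gam p M ![1, 2, 3, 5] ^ 6 / gam p M ![1, 2, 3, 4] ^ 2 else 0

/-- The coefficient `α₃`. -/
def alpha₃ {F : Type*} [Field F] (p : ℕ) (M : Matrix (Fin 2) (Fin 4) F) : F :=
  gam p M ![1, 2, 3, 4] ^ (p + 1) * gam p M ![1, 2, 3, 7] / gam p M ![1, 2, 3, 5] -
    if p = 3 then gam p M ![1, 2, 3, 5] ^ 6 / gam p M ![1, 2, 3, 4] ^ 2 else 0

/-- The coefficient `α₄`. -/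
def alpha₄ {F : Type*} [Field F] (p : ℕ) (M : Matrix (Fin 2) (Fin 4) F) : F :=
  gam p M ![1, 2, 3, 4] ^ (p + 3) * gam p M ![1, 2, 5, 7] /
      gam p M ![1, 2, 3, 5] ^ ((p + 3) / 2) -
    if p = 3 then alpha₃ p M else 0

/-- The outcome `f̃₃` of subducting the tête-à-tête `(f̄₁^(p+2), f̄₂^p)` using `{x, f̄₁, f̄₂}`,
up to a nonzero scalar. For `p = 3` the coefficients `α₂, α₃, α₄` of the subduction have an
additional term, because some monomials that are negligible for `p ≥ 5` then are not. -/
def f₃Tilde {F : Type*} [Field F] (p : ℕ) (M : Matrix (Fin 2) (Fin 4) F) :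
    MvPolynomial (Fin 3) F :=
  C (gam p M ![1, 2, 3, 5] ^ p) * f₁ p M ^ (p + 2)
  - C (gam p M ![1, 2, 3, 4] ^ 2) * f₂ p M ^ p
  + C (-2 * gam p M ![1, 2, 3, 5] ^ p) * X 2 ^ (p ^ 2 - 2 * p) * f₁ p M ^ p * f₂ p M
  + C (alpha₂ p M) * X 2 ^ (p ^ 2) * f₁ p M ^ (p + 1)
  + C (alpha₃ p M) * X 2 ^ (2 * p ^ 2 - 2 * p) * f₁ p M ^ (p - 1) * f₂ p M
  + C (alpha₄ p M) * X 2 ^ (2 * p ^ 2 - p) * f₁ p M ^ ((p - 3) / 2) * f₂ p M ^ ((p + 1) / 2)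

/-- `f̄₃ = - f̃₃ γ₁₂₃₅ / (γ₁₂₃₄^(2p+2) x^(2p²-2))`. -/
def f₃ {F : Type*} [Field F] (p : ℕ) (M : Matrix (Fin 2) (Fin 4) F) : MvPolynomial (Fin 3) F :=
  C (-(gam p M ![1, 2, 3, 5] / gam p M ![1, 2, 3, 4] ^ (2 * p + 2))) *
    (f₃Tilde p M).divMonomial (Finsupp.single 2 (2 * p ^ 2 - 2))

/-- The family `x, f̄₁, f̄₂`. -/
def gens₂ {F : Type*} [Field F] (p : ℕ) (M : Matrix (Fin 2) (Fin 4) F) :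
    Fin 3 → MvPolynomial (Fin 3) F :=
  ![X 2, f₁ p M, f₂ p M]

/-- The family `x, f̄₁, f̄₂, f̄₃, N_M(z)`. -/
def gens {F : Type*} [Field F] (p : ℕ) [Fact p.Prime] [CharP F p]
    (M : Matrix (Fin 2) (Fin 4) F) : Fin 5 → MvPolynomial (Fin 3) F :=
  ![X 2, f₁ p M, f₂ p M, f₃ p M, normM p M (X 0)]

end

end RankFour

open MvPolynomial RankFour

open MvPolynomial RankFour

namespace RankFour

open scoped MonomialOrder

/-! ### The graded reverse lexicographic order -/

section Order

/-! Let α(g) and β(g) be the two shift parameters of g ∈ E. On x = 1 the coordinates Y = y/x and D =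
-δ/x² are translated by α and β. The minors `fMinor` are invariant because g changes their last
column by a combination of the others; on x = 1 they are additive polynomials in Y and D.

Generators after inverting x. The minor γ₁₃₅₇ is the Moore determinant of the first row of M, so α
is injective and β = ∑ b_i α^(p^i) with i < 4. Hence D' = D - ∑ b_i Y^(p^i) is invariant and E acts
on F[D'][Y] by translations of Y, with invariants F[D', n] for an additive n of degree p⁴ in Y.
Frobenius powers of U = f̄₁ and V = f̄₁₂₃₄₆ reduce D' and n, modulo F[U, V], to combinations of Y,
D, Y^p, D^p; these vanish because γ₁₂₃₄ ≠ 0. So invariants dehomogenize into F[U, V]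
(`theta_mem_adjoin`).

Lead terms. Modulo x and with y = 1, E translates z by p⁴ distinct amounts, so a homogeneous
invariant of degree below p⁴ is c y^d modulo x. If c = 0, it is divisible by x. Thus it equals x^k g
with LM(g) a power of y, and that power is the degree of its restriction to x = 1, z = 0
(`exists_eq_X_pow_mul`). Exactness of the divisions and the lead terms of f̄₂ and f̄₃ become degree
computations in one variable, where Plücker relations produce the cancellations (`evY_f₃Tilde`).

SAGBI basis. As polynomials in V over F[U], the elements f̄₂, f̄₃ and N_M(z) have degrees 1, p, p²
and constant nonzero leading coefficients. Writing exponents of V in base p, the products f̄₁^i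
f̄₂^j f̄₃^k N_M(z)^l with j, k < p span F[U, V] (`theta_mem_span`). Multiplied by powers of x, they
have pairwise distinct lead monomials (`degree_standard_injective`). So after multiplication by a
power of x every homogeneous invariant is a combination of standard products, and its lead monomial
is that of a product.

Relations. The two têtes-à-têtes rewrite T₂^p and T₃^p, so every polynomial is congruent to a
standard one modulo R₁, R₂; distinct lead monomials then give the kernel. Modulo T₀ and T₁ the
relations become T₂^p and T₃^p, which yields coprimality and hence regularity. -/

theorem grevlex_lt_iff_key (a b : Fin 3 →₀ ℕ) :
    a ≺[grevlex] b ↔ a 0 + a 1 + a 2 < b 0 + b 1 + b 2 ∨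
      (a 0 + a 1 + a 2 = b 0 + b 1 + b 2 ∧
        (a 0 + a 1 < b 0 + b 1 ∨ (a 0 + a 1 = b 0 + b 1 ∧ a 0 < b 0))) := by
  change GRevLex.key a < GRevLex.key b ↔ _
  simp only [GRevLex.key, Prod.Lex.toLex_lt_toLex]

theorem grevlex_le_iff_key (a b : Fin 3 →₀ ℕ) :
    a ≼[grevlex] b ↔ a 0 + a 1 + a 2 < b 0 + b 1 + b 2 ∨
      (a 0 + a 1 + a 2 = b 0 + b 1 + b 2 ∧
        (a 0 + a 1 < b 0 + b 1 ∨ (a 0 + a 1 = b 0 + b 1 ∧ a 0 ≤ b 0))) := by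
  change GRevLex.key a ≤ GRevLex.key b ↔ _
  simp only [GRevLex.key, Prod.Lex.toLex_le_toLex]

variable {σ F ι : Type*} [Field F] (m : MonomialOrder σ)

/-- A nontrivial linear combination of polynomials with distinct degrees has the largest of
these degrees. -/
theorem degree_linearCombination (g : ι → MvPolynomial σ F) (hg : ∀ i, g i ≠ 0)
    (hinj : Function.Injective fun i => m.degree (g i)) (c : ι →₀ F) (hc : c ≠ 0) :
    (∃ i ∈ c.support, m.degree (c.sum fun i a => a • g i) = m.degree (g i)) ∧
      (c.sum fun i a => a • g i) ≠ 0 ∧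
      ∀ i ∈ c.support, m.degree (g i) ≼[m] m.degree (c.sum fun i a => a • g i) := by
  classical
  obtain ⟨i, hi, hmax⟩ := c.support.exists_max_image (fun i => m.toSyn (m.degree (g i)))
    (Finsupp.support_nonempty_iff.mpr hc)
  have hco : coeff (m.degree (g i)) (c.sum fun i a => a • g i) = c i * m.leadingCoeff (g i) := by
    rw [Finsupp.sum, coeff_sum, Finset.sum_eq_single i]
    · simp [MonomialOrder.leadingCoeff]
    · intro j hj hji
      rw [coeff_smul, m.coeff_eq_zero_of_lt, smul_zero]
      refine lt_of_le_of_ne (hmax j hj) fun h => hji (hinj (m.toSyn.injective h))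
    · intro h; exact absurd hi h
  have hne : coeff (m.degree (g i)) (c.sum fun i a => a • g i) ≠ 0 := by
    rw [hco]
    exact mul_ne_zero (Finsupp.mem_support_iff.mp hi) (m.leadingCoeff_ne_zero_iff.mpr (hg i))
  have hle : m.degree (g i) ≼[m] m.degree (c.sum fun i a => a • g i) :=
    m.le_degree (mem_support_iff.mpr hne)
  have hge : m.degree (c.sum fun i a => a • g i) ≼[m] m.degree (g i) := by
    refine m.degree_sum_le.trans (Finset.sup_le fun j hj => ?_)
    exact m.degree_smul_le.trans (hmax j hj)
  refine ⟨⟨i, hi, m.toSyn.injective (le_antisymm hge hle)⟩, ?_, fun j hj => (hmax j hj).trans hle⟩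
  intro h; rw [h] at hne; simp at hne

end Order

/-! ### Products and lead terms -/

section PowProd

variable {F : Type*} [Field F] {σ : Type*} (h : σ → MvPolynomial (Fin 3) F)

theorem powProd_add (I J : σ →₀ ℕ) : powProd h (I + J) = powProd h I * powProd h J :=
  Finsupp.prod_add_index' (fun _ => pow_zero _) fun _ _ _ => pow_add _ _ _

theorem powProd_single (j : σ) (n : ℕ) : powProd h (Finsupp.single j n) = h j ^ n :=
  Finsupp.prod_single_index (pow_zero _)

theorem aeval_monomial_eq_powProd (I : σ →₀ ℕ) (c : F) :
    aeval h (monomial I c) = C c * powProd h I := by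
  rw [aeval_monomial]; rfl

variable {h}

theorem powProd_ne_zero (hh : ∀ j, h j ≠ 0) (I : σ →₀ ℕ) : powProd h I ≠ 0 :=
  Finset.prod_ne_zero_iff.mpr fun j _ => pow_ne_zero _ (hh j)

theorem powProd_mem {A : Subalgebra F (MvPolynomial (Fin 3) F)} (hh : ∀ j, h j ∈ A)
    (I : σ →₀ ℕ) : powProd h I ∈ A :=
  A.prod_mem fun j _ => A.pow_mem (hh j) _

theorem powProd_isHomogeneous {w : σ → ℕ} (hh : ∀ j, (h j).IsHomogeneous (w j)) (I : σ →₀ ℕ) :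
    (powProd h I).IsHomogeneous (I.sum fun j n => w j * n) :=
  IsHomogeneous.prod _ _ _ fun j _ => (hh j).pow _

theorem leadTerm_eq_iff {f g : MvPolynomial (Fin 3) F} : leadTerm f = leadTerm g ↔
    grevlex.degree f = grevlex.degree g ∧ grevlex.leadingCoeff f = grevlex.leadingCoeff g := by
  constructor
  · intro e
    have h1 := congrArg grevlex.degree e
    have h2 := congrArg grevlex.leadingCoeff e
    simp only [leadTerm, MonomialOrder.degree_leadingTerm,
      MonomialOrder.leadingCoeff_leadingTerm] at h1 h2
    exact ⟨h1, h2⟩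
  · rintro ⟨h1, h2⟩
    simp only [leadTerm, MonomialOrder.leadingTerm, h1, h2]

theorem degree_C_mul {c : F} (hc : c ≠ 0) (f : MvPolynomial (Fin 3) F) :
    grevlex.degree (C c * f) = grevlex.degree f := by
  rw [← smul_eq_C_mul]
  exact grevlex.degree_smul_of_mem_nonZeroDivisors (mem_nonZeroDivisors_of_ne_zero hc)

theorem leadingCoeff_C_mul (c : F) (f : MvPolynomial (Fin 3) F) :
    grevlex.leadingCoeff (C c * f) = c * grevlex.leadingCoeff f := by
  rw [grevlex.leadingCoeff_mul, grevlex.leadingCoeff_C]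

theorem degree_sub_lt_of_leadTerm_eq {f g : MvPolynomial (Fin 3) F}
    (e : leadTerm f = leadTerm g) (hfg : f - g ≠ 0) :
    grevlex.degree (f - g) ≺[grevlex] grevlex.degree f := by
  obtain ⟨h1, h2⟩ := leadTerm_eq_iff.mp e
  refine lt_of_le_of_ne ?_ ?_
  · refine grevlex.degree_sub_le.trans ?_
    rw [h1, sup_idem]
  · intro h3
    have h4 := grevlex.toSyn.injective h3
    have h5 : grevlex.leadingCoeff (f - g) = 0 := by
      rw [MonomialOrder.leadingCoeff, h4, coeff_sub]
      conv_lhs => rw [h1, ← MonomialOrder.leadingCoeff, ← h2, ← h1]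
      rw [MonomialOrder.leadingCoeff, sub_self]
    exact hfg (grevlex.leadingCoeff_eq_zero_iff.mp h5)

end PowProd

/-! ### Subduction -/

section Subduction

variable {F : Type*} [Field F] {σ : Type*} {h : σ → MvPolynomial (Fin 3) F}

theorem Subducts.aeval_eq {f g : MvPolynomial (Fin 3) F} {P : MvPolynomial σ F}
    (hs : Subducts h f P g) : aeval h P = f - g := by
  induction hs with
  | refl f => simp
  | step f g P I c hf hLT rest ih =>
    rw [map_add, aeval_monomial_eq_powProd, ih]; ring

theorem TatSubducts.aeval_eq {I J : σ →₀ ℕ} {Q : MvPolynomial σ F} {g : MvPolynomial (Fin 3) F}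
    (ht : TatSubducts h I J Q g) : aeval h Q = g := by
  obtain ⟨c, P, -, hP, rfl⟩ := ht
  rw [map_sub, map_sub, hP.aeval_eq, aeval_monomial_eq_powProd, aeval_monomial_eq_powProd]
  simp

theorem exists_subducts_zero {A : Subalgebra F (MvPolynomial (Fin 3) F)} (hA : ∀ j, h j ∈ A)
    (h0 : ∀ j, h j ≠ 0)
    (hLM : ∀ f ∈ A, f ≠ 0 → ∃ K, grevlex.degree f = grevlex.degree (powProd h K))
    (f : MvPolynomial (Fin 3) F) (hf : f ∈ A) : ∃ P, Subducts h f P 0 := by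
  induction hd : grevlex.toSyn (grevlex.degree f) using WellFoundedLT.induction generalizing f with
  | ind d ih =>
    subst hd
    by_cases hf0 : f = 0
    · subst hf0; exact ⟨0, .refl 0⟩
    obtain ⟨K, hK⟩ := hLM f hf hf0
    have hK0 := powProd_ne_zero h0 K
    have hKl := grevlex.leadingCoeff_ne_zero_iff.mpr hK0
    have hfl := grevlex.leadingCoeff_ne_zero_iff.mpr hf0
    set c := grevlex.leadingCoeff f / grevlex.leadingCoeff (powProd h K) with hc
    have hc0 : c ≠ 0 := div_ne_zero hfl hKl
    have hLT : leadTerm f = leadTerm (C c * powProd h K) := by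
      rw [leadTerm_eq_iff, degree_C_mul hc0, leadingCoeff_C_mul, hc, div_mul_cancel₀ _ hKl]
      exact ⟨hK, rfl⟩
    by_cases hz : f - C c * powProd h K = 0
    · exact ⟨_, .step f 0 0 K c hf0 hLT (hz ▸ .refl _)⟩
    · obtain ⟨P, hP⟩ := ih _ (degree_sub_lt_of_leadTerm_eq hLT hz) _
        (A.sub_mem hf (A.mul_mem (A.algebraMap_mem c) (powProd_mem hA K))) rfl
      exact ⟨_, .step f 0 P K c hf0 hLT hP⟩

theorem exists_tatSubducts_zero {A : Subalgebra F (MvPolynomial (Fin 3) F)} (hA : ∀ j, h j ∈ A)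
    (h0 : ∀ j, h j ≠ 0)
    (hLM : ∀ f ∈ A, f ≠ 0 → ∃ K, grevlex.degree f = grevlex.degree (powProd h K))
    (I J : σ →₀ ℕ) (hIJ : grevlex.degree (powProd h I) = grevlex.degree (powProd h J)) :
    ∃ Q, TatSubducts h I J Q 0 := by
  have hI := grevlex.leadingCoeff_ne_zero_iff.mpr (powProd_ne_zero h0 I)
  have hJ := grevlex.leadingCoeff_ne_zero_iff.mpr (powProd_ne_zero h0 J)
  set c := grevlex.leadingCoeff (powProd h I) / grevlex.leadingCoeff (powProd h J) with hc
  obtain ⟨P, hP⟩ := exists_subducts_zero hA h0 hLM (powProd h I - C c * powProd h J)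
    (A.sub_mem (powProd_mem hA I) (A.mul_mem (A.algebraMap_mem c) (powProd_mem hA J)))
  refine ⟨_, c, P, ?_, hP, rfl⟩
  rw [leadTerm_eq_iff, degree_C_mul (div_ne_zero hI hJ), leadingCoeff_C_mul, hc,
    div_mul_cancel₀ _ hJ]
  exact ⟨hIJ, rfl⟩

/-- The monomials used in a subduction of a homogeneous `f` have images of the same total degree
as `f` and of grevlex degree at most that of `f`. -/
theorem Subducts.mem_support {w : σ → ℕ} (hw : ∀ j, (h j).IsHomogeneous (w j))
    (h0 : ∀ j, h j ≠ 0)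
    {f g : MvPolynomial (Fin 3) F} {P : MvPolynomial σ F} (hs : Subducts h f P g) {d : ℕ}
    (hf : f.IsHomogeneous d) {K : σ →₀ ℕ} (hK : K ∈ P.support) :
    (K.sum fun j n => w j * n) = d ∧ f ≠ 0 ∧
      grevlex.degree (powProd h K) ≼[grevlex] grevlex.degree f := by
  classical
  induction hs with
  | refl f => simp at hK
  | step f g P I c hf0 hLT rest ih =>
    obtain ⟨h1, h2⟩ := leadTerm_eq_iff.mp hLT
    have hc : c ≠ 0 := by
      rintro rfl
      rw [C_0, zero_mul, MonomialOrder.leadingCoeff_zero,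
        grevlex.leadingCoeff_eq_zero_iff] at h2
      exact hf0 h2
    rw [degree_C_mul hc] at h1
    have hI0 := powProd_ne_zero h0 I
    have hId : (I.sum fun j n => w j * n) = d := by
      have e1 := hf.degree_eq_sum_deg_support (grevlex.degree_mem_support hf0)
      have e2 := (powProd_isHomogeneous hw I).degree_eq_sum_deg_support
        (grevlex.degree_mem_support hI0)
      rw [e1, e2, h1]
    have hhom : (f - C c * powProd h I).IsHomogeneous d :=
      hf.sub ((hId ▸ powProd_isHomogeneous hw I).C_mul c)
    rcases Finset.mem_union.mp (support_add hK) with hK | hK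
    · have : K = I := by simpa using support_monomial_subset hK
      subst this
      exact ⟨hId, hf0, h1 ▸ le_rfl⟩
    · obtain ⟨e1, e2, e3⟩ := ih hhom hK
      exact ⟨e1, hf0, e3.trans (degree_sub_lt_of_leadTerm_eq hLT e2).le⟩

/-- Builds a subduction backwards from its last step. The case c = 0 adds no step, so coefficients
that may vanish need no separate treatment. -/
theorem Subducts.cons (h0 : ∀ j, h j ≠ 0) {g r : MvPolynomial (Fin 3) F} {P : MvPolynomial σ F}
    (hs : Subducts h g P r) (K : σ →₀ ℕ) (c : F)
    (hg : grevlex.degree g ≺[grevlex] grevlex.degree (powProd h K)) :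
    (∃ P', Subducts h (C c * powProd h K + g) P' r) ∧
      grevlex.degree (C c * powProd h K + g) ≼[grevlex] grevlex.degree (powProd h K) := by
  by_cases hc : c = 0
  · subst hc
    rw [C_0, zero_mul, zero_add]
    exact ⟨⟨P, hs⟩, hg.le⟩
  have hd := degree_C_mul hc (powProd h K)
  have hlt : grevlex.degree g ≺[grevlex] grevlex.degree (C c * powProd h K) := by rwa [hd]
  have e1 := grevlex.degree_add_of_lt hlt
  have e2 := grevlex.leadingCoeff_add_of_lt hlt
  refine ⟨⟨monomial K c + P, .step _ _ _ _ _ ?_ (leadTerm_eq_iff.mpr ⟨e1, e2⟩) ?_⟩, ?_⟩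
  · rw [← grevlex.leadingCoeff_ne_zero_iff, e2, leadingCoeff_C_mul]
    exact mul_ne_zero hc (grevlex.leadingCoeff_ne_zero_iff.mpr (powProd_ne_zero h0 K))
  · rwa [add_sub_cancel_left]
  · rw [e1, hd]

end Subduction

/-! ### Relations among the generators -/

section Relations

variable {F : Type*} [Field F] {p : ℕ}

/-- The lead monomials, degrees and homogeneity of the five generators. -/
structure HasGensDegrees (p : ℕ) (h : Fin 5 → MvPolynomial (Fin 3) F) : Prop where
  hom : ∀ j, (h j).IsHomogeneous (![1, p ^ 2, p ^ 2 + 2 * p, p ^ 3 + 2, p ^ 4] j)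
  deg : ∀ j, grevlex.degree (h j) =
    Finsupp.single (![2, 1, 1, 1, 0] j) (![1, p ^ 2, p ^ 2 + 2 * p, p ^ 3 + 2, p ^ 4] j)
  ne_zero : ∀ j, h j ≠ 0

namespace HasGensDegrees

variable {h : Fin 5 → MvPolynomial (Fin 3) F} (H : HasGensDegrees p h)
include H

theorem degree_powProd (K : Fin 5 →₀ ℕ) : grevlex.degree (powProd h K) =
    Finsupp.single 2 (K 0) + Finsupp.single 0 (p ^ 4 * K 4) +
      Finsupp.single 1 (p ^ 2 * K 1 + (p ^ 2 + 2 * p) * K 2 + (p ^ 3 + 2) * K 3) := by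
  rw [powProd, Finsupp.prod_fintype _ _ (fun _ => pow_zero _),
    grevlex.degree_prod fun j _ => pow_ne_zero _ (H.ne_zero j)]
  simp only [grevlex.degree_pow, H.deg, Fin.sum_univ_five]
  ext i
  fin_cases i <;> simp <;> ring

omit [Field F] H in
theorem sum_eq (K : Fin 5 →₀ ℕ) :
    (K.sum fun j n => ![1, p ^ 2, p ^ 2 + 2 * p, p ^ 3 + 2, p ^ 4] j * n) =
      K 0 + (p ^ 2 * K 1 + (p ^ 2 + 2 * p) * K 2 + (p ^ 3 + 2) * K 3) + p ^ 4 * K 4 := by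
  rw [Finsupp.sum_fintype _ _ (fun _ => mul_zero _), Fin.sum_univ_five]
  simp; ring

omit H in
-- The exponent is 2k modulo p, which determines k < p because p is odd. After cancelling the k-term
-- and dividing by p it is 2j modulo p, which determines j, and then i.
theorem standard_inj (hp : p.Prime) (hp2 : p ≠ 2) {i j k i' j' k' : ℕ}
    (hj : j < p) (hk : k < p) (hj' : j' < p) (hk' : k' < p)
    (e : p ^ 2 * i + (p ^ 2 + 2 * p) * j + (p ^ 3 + 2) * k =
      p ^ 2 * i' + (p ^ 2 + 2 * p) * j' + (p ^ 3 + 2) * k') : i = i' ∧ j = j' ∧ k = k' := by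
  have hcop : Nat.Coprime p 2 := (Nat.coprime_primes hp Nat.prime_two).mpr hp2
  have red {a b u v : ℕ} (ha : a < p) (hb : b < p) (e : p * u + 2 * a = p * v + 2 * b) :
      a = b := by
    have h1 : 2 * a ≡ 2 * b [MOD p] := by
      have := congrArg (· % p) e
      simpa [Nat.ModEq, Nat.add_mod, Nat.mul_mod_right] using this
    have h2 : a ≡ b [MOD p] := Nat.ModEq.cancel_left_of_coprime hcop h1
    rwa [Nat.ModEq, Nat.mod_eq_of_lt ha, Nat.mod_eq_of_lt hb] at h2
  have hk0 : k = k' := red hk hk' (u := p * i + (p + 2) * j + p ^ 2 * k)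
    (v := p * i' + (p + 2) * j' + p ^ 2 * k') (by linarith)
  subst hk0
  have e2 : p * (p * i + (p + 2) * j) = p * (p * i' + (p + 2) * j') := by linarith
  have e3 := Nat.eq_of_mul_eq_mul_left hp.pos e2
  have hj0 : j = j' := red hj hj' (u := i + j) (v := i' + j') (by linarith)
  subst hj0
  exact ⟨Nat.eq_of_mul_eq_mul_left hp.pos (by linarith : p * i = p * i'), rfl, rfl⟩

theorem degree_standard_injective (hp : p.Prime) (hp2 : p ≠ 2) :
    Function.Injective fun K : {K : Fin 5 →₀ ℕ // K 2 < p ∧ K 3 < p} =>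
      grevlex.degree (powProd h K) := by
  rintro ⟨K, hK⟩ ⟨L, hL⟩ e
  simp only [H.degree_powProd] at e
  have e0 := DFunLike.congr_fun e 0
  have e1 := DFunLike.congr_fun e 1
  have e2 := DFunLike.congr_fun e 2
  simp [hp.ne_zero] at e0 e1 e2
  obtain ⟨f1, f2, f3⟩ := standard_inj hp hp2 hK.1 hK.2 hL.1 hL.2 e1
  refine Subtype.ext (Finsupp.ext fun i => ?_)
  fin_cases i
  exacts [e2, f1, f2, f3, e0]

/-- The terms of a relation coming from a subduction of a tête-à-tête of two products without `x`
whose lead monomials are powers of `y`. -/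
theorem tatSubducts_terms {I J : Fin 5 →₀ ℕ} {R : MvPolynomial (Fin 5) F}
    (hI0 : I 0 = 0) (hI4 : I 4 = 0)
    (hIJ : grevlex.degree (powProd h I) = grevlex.degree (powProd h J))
    (ht : TatSubducts h I J R 0) :
    ∃ (c : F) (P : MvPolynomial (Fin 5) F), R = monomial I 1 - monomial J c - P ∧
      ∀ K ∈ P.support, grevlex.degree (powProd h K) ≺[grevlex] grevlex.degree (powProd h I) ∧
        0 < K 0 := by
  obtain ⟨c, P, hLT, hP, rfl⟩ := ht
  refine ⟨c, P, rfl, fun K hK => ?_⟩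
  have hJd : (J.sum fun j n => ![1, p ^ 2, p ^ 2 + 2 * p, p ^ 3 + 2, p ^ 4] j * n) =
      I.sum fun j n => ![1, p ^ 2, p ^ 2 + 2 * p, p ^ 3 + 2, p ^ 4] j * n := by
    rw [H.degree_powProd, H.degree_powProd] at hIJ
    have e0 := DFunLike.congr_fun hIJ 0
    have e1 := DFunLike.congr_fun hIJ 1
    have e2 := DFunLike.congr_fun hIJ 2
    simp at e0 e1 e2
    rw [sum_eq, sum_eq, e1, e2]
    rcases e0 with e0 | e0 <;> simp [e0]
  have hhom : (powProd h I - C c * powProd h J).IsHomogeneous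
      (I.sum fun j n => ![1, p ^ 2, p ^ 2 + 2 * p, p ^ 3 + 2, p ^ 4] j * n) :=
    (powProd_isHomogeneous H.hom I).sub ((hJd ▸ powProd_isHomogeneous H.hom J).C_mul c)
  obtain ⟨e1, e2, e3⟩ := hP.mem_support H.hom H.ne_zero hhom hK
  have hlt := e3.trans_lt (degree_sub_lt_of_leadTerm_eq hLT e2)
  refine ⟨hlt, ?_⟩
  -- The lead monomial of h^I is y^d, the smallest monomial of degree d without x. A smaller
  -- monomial of the same degree must therefore contain x.
  rw [grevlex_lt_iff_key, H.degree_powProd, H.degree_powProd] at hlt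
  rw [sum_eq, sum_eq] at e1
  simp [hI0, hI4] at hlt e1
  omega

/-- A nonstandard monomial is rewritten by a relation with leading part T^I - c T^J. The terms of P
have a smaller image in the monomial order; T^J has the same image, but a smaller sum of exponents
at 2 and 3. Hence the nested induction on the lead monomial of the image and then on that sum. -/
theorem monomial_mem_standard {N : Ideal (MvPolynomial (Fin 5) F)}
    (hN : ∀ K : Fin 5 →₀ ℕ, ¬ (K 2 < p ∧ K 3 < p) → ∃ (I J : Fin 5 →₀ ℕ) (c : F)
      (P : MvPolynomial (Fin 5) F), I ≤ K ∧ monomial I 1 - monomial J c - P ∈ N ∧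
        grevlex.degree (powProd h I) = grevlex.degree (powProd h J) ∧ J 2 + J 3 < I 2 + I 3 ∧
        ∀ K ∈ P.support, grevlex.degree (powProd h K) ≺[grevlex] grevlex.degree (powProd h I))
    (K : Fin 5 →₀ ℕ) (a : F) : monomial K a ∈
      Submodule.span F (Set.range fun K : {K : Fin 5 →₀ ℕ // K 2 < p ∧ K 3 < p} =>
        (monomial K.1 1 : MvPolynomial (Fin 5) F)) ⊔ N.restrictScalars F := by
  set V := Submodule.span F (Set.range fun K : {K : Fin 5 →₀ ℕ // K 2 < p ∧ K 3 < p} =>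
        (monomial K.1 1 : MvPolynomial (Fin 5) F)) ⊔ N.restrictScalars F with hV
  have hmul (A B : Fin 5 →₀ ℕ) : grevlex.degree (powProd h (A + B)) =
      grevlex.degree (powProd h A) + grevlex.degree (powProd h B) := by
    rw [powProd_add, grevlex.degree_mul (powProd_ne_zero H.ne_zero _)
      (powProd_ne_zero H.ne_zero _)]
  induction hd : grevlex.toSyn (grevlex.degree (powProd h K)) using WellFoundedLT.induction
    generalizing K a with
  | ind d ihd =>
  subst hd
  induction hn : K 2 + K 3 using Nat.strong_induction_on generalizing K a with
  | _ n ihn =>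
  subst hn
  by_cases hK : K 2 < p ∧ K 3 < p
  · have : (monomial K a : MvPolynomial (Fin 5) F) = a • monomial K 1 := by
      rw [smul_monomial, smul_eq_mul, mul_one]
    rw [this]
    exact V.smul_mem _ (Submodule.mem_sup_left (Submodule.subset_span ⟨⟨K, hK⟩, rfl⟩))
  obtain ⟨I, J, c, P, hIK, hR, hIJ, hlt, hP⟩ := hN K hK
  obtain ⟨L, rfl⟩ := exists_add_of_le hIK
  have e : (monomial (I + L) a : MvPolynomial (Fin 5) F) =
      monomial L a * (monomial I 1 - monomial J c - P) + monomial (J + L) (c * a) +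
        monomial L a * P := by
    have e1 : (monomial (I + L) a : MvPolynomial (Fin 5) F) = monomial L a * monomial I 1 := by
      rw [monomial_mul, mul_one, add_comm]
    have e2 : (monomial (J + L) (c * a) : MvPolynomial (Fin 5) F) =
        monomial L a * monomial J c := by
      rw [monomial_mul, mul_comm c, add_comm]
    rw [e1, e2]; ring
  rw [e]
  refine V.add_mem (V.add_mem ?_ ?_) ?_
  · exact Submodule.mem_sup_right (N.mul_mem_left _ hR)
  · have hdeg : grevlex.degree (powProd h (J + L)) = grevlex.degree (powProd h (I + L)) := by
      rw [hmul, hmul, hIJ]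
    refine ihn _ ?_ (J + L) (c * a) ?_ rfl
    · simp only [Finsupp.add_apply]; omega
    · intro y hy K' b hK'
      exact ihd y (hdeg ▸ hy) K' b hK'
  · rw [P.as_sum, Finset.mul_sum]
    refine V.sum_mem fun K hK => ?_
    rw [monomial_mul]
    refine ihd _ ?_ _ _ rfl
    rw [hmul, hmul, map_add, map_add, add_comm (grevlex.toSyn (grevlex.degree (powProd h I)))]
    exact add_lt_add_right (hP K hK) _

variable {R₁ R₂ : MvPolynomial (Fin 5) F}

theorem degree_powProd_congr {K L : Fin 5 →₀ ℕ} (h0 : K 0 = L 0) (h4 : K 4 = L 4)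
    (h1 : p ^ 2 * K 1 + (p ^ 2 + 2 * p) * K 2 + (p ^ 3 + 2) * K 3 =
      p ^ 2 * L 1 + (p ^ 2 + 2 * p) * L 2 + (p ^ 3 + 2) * L 3) :
    grevlex.degree (powProd h K) = grevlex.degree (powProd h L) := by
  rw [H.degree_powProd, H.degree_powProd, h0, h1, h4]

theorem degree_tat₁ : grevlex.degree (powProd h (Finsupp.single 2 p)) =
    grevlex.degree (powProd h (Finsupp.single 1 (p + 2))) := by
  apply H.degree_powProd_congr <;> simp
  ring

theorem degree_tat₂ (hp : 0 < p) : grevlex.degree (powProd h (Finsupp.single 3 p)) =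
    grevlex.degree (powProd h (Finsupp.single 2 1 + Finsupp.single 1 (p ^ 2 - 1))) := by
  obtain ⟨m, hm⟩ := Nat.exists_eq_add_of_le (Nat.one_le_pow 2 _ hp)
  have hm' : p ^ 2 - 1 = m := by omega
  apply H.degree_powProd_congr <;> simp [hm']
  rw [show (p ^ 3 + 2) * p = p ^ 2 * p ^ 2 + 2 * p by ring]
  nth_rewrite 2 [hm]
  ring

/-- Modulo R₁ and R₂ an element of the kernel is a combination of standard monomials. Their images
have distinct lead monomials, so this combination is zero. -/
theorem ker_aeval (hp : p.Prime) (hp2 : p ≠ 2)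
    (t₁ : TatSubducts h (Finsupp.single 2 p) (Finsupp.single 1 (p + 2)) R₁ 0)
    (t₂ : TatSubducts h (Finsupp.single 3 p)
      (Finsupp.single 2 1 + Finsupp.single 1 (p ^ 2 - 1)) R₂ 0) :
    RingHom.ker (aeval (R := F) h) = Ideal.span {R₁, R₂} := by
  have hle : Ideal.span {R₁, R₂} ≤ RingHom.ker (aeval (R := F) h) := by
    rw [Ideal.span_le]
    rintro r (rfl | rfl)
    exacts [t₁.aeval_eq, t₂.aeval_eq]
  refine le_antisymm (fun f hf => ?_) hle
  have hf' : f ∈ Submodule.span F (Set.range fun K : {K : Fin 5 →₀ ℕ // K 2 < p ∧ K 3 < p} =>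
        (monomial K.1 1 : MvPolynomial (Fin 5) F)) ⊔
          (Ideal.span {R₁, R₂}).restrictScalars F := by
    rw [f.as_sum]
    refine Submodule.sum_mem _ fun K _ => H.monomial_mem_standard (fun K hK => ?_) K _
    rw [not_and_or, not_lt, not_lt] at hK
    rcases hK with hK | hK
    · obtain ⟨c, P, e, hP⟩ := H.tatSubducts_terms (by simp) (by simp) H.degree_tat₁ t₁
      refine ⟨_, _, c, P, ?_, e ▸ Ideal.subset_span (by simp), H.degree_tat₁, ?_,
        fun K hK => (hP K hK).1⟩
      · rwa [Finsupp.single_le_iff]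
      · simpa using hp.pos
    · obtain ⟨c, P, e, hP⟩ := H.tatSubducts_terms (by simp) (by simp) (H.degree_tat₂ hp.pos) t₂
      refine ⟨_, _, c, P, ?_, e ▸ Ideal.subset_span (by simp), H.degree_tat₂ hp.pos, ?_,
        fun K hK => (hP K hK).1⟩
      · rwa [Finsupp.single_le_iff]
      · simpa using hp.one_lt
  obtain ⟨s, hs, i, hi, rfl⟩ := Submodule.mem_sup.mp hf'
  obtain ⟨c, rfl⟩ := Finsupp.mem_span_range_iff_exists_finsupp.mp hs
  have hi' : aeval h i = 0 := hle hi
  have hc : c = 0 := by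
    by_contra hc
    refine (degree_linearCombination grevlex (fun K : {K : Fin 5 →₀ ℕ // K 2 < p ∧ K 3 < p} =>
      powProd h K) (fun K => powProd_ne_zero H.ne_zero _)
      (H.degree_standard_injective hp hp2) c hc).2.1 ?_
    have := RingHom.mem_ker.mp hf
    rw [map_add, hi', add_zero, Finsupp.sum, map_sum] at this
    rw [Finsupp.sum, ← this]
    refine Finset.sum_congr rfl fun K _ => ?_
    rw [map_smul, aeval_monomial_eq_powProd, C_1, one_mul]
  subst hc
  simpa using hi

/-- Modulo the first two variables the relations become pure powers. -/
theorem aeval_relation {I J : Fin 5 →₀ ℕ} (hI0 : I 0 = 0) (hI4 : I 4 = 0) (hJ : J 1 ≠ 0)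
    (hIJ : grevlex.degree (powProd h I) = grevlex.degree (powProd h J))
    (ht : TatSubducts h I J R₁ 0) :
    aeval (R := F) (![0, 0, X 2, X 3, X 4] : Fin 5 → MvPolynomial (Fin 5) F) R₁ =
      aeval (R := F) (![0, 0, X 2, X 3, X 4] : Fin 5 → MvPolynomial (Fin 5) F)
        (monomial I 1) := by
  have key (K : Fin 5 →₀ ℕ) (hK : K 0 ≠ 0 ∨ K 1 ≠ 0) (c : F) :
      aeval (R := F) (![0, 0, X 2, X 3, X 4] : Fin 5 → MvPolynomial (Fin 5) F)
        (monomial K c) = 0 := by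
    rw [aeval_monomial, Finsupp.prod_fintype _ _ (fun _ => pow_zero _), Fin.prod_univ_five]
    rcases hK with hK | hK <;> simp [hK]
  obtain ⟨c, P, rfl, hP⟩ := H.tatSubducts_terms hI0 hI4 hIJ ht
  rw [map_sub, map_sub, key J (.inr hJ), sub_zero, P.as_sum, map_sum, Finset.sum_eq_zero, sub_zero]
  exact fun K hK => key K (.inl (hP K hK).2.ne') _

/-- In a factorial ring it suffices that R₁ and R₂ are coprime. The image under ρ of a common
irreducible factor q divides powers of two different variables, hence is a unit, so q has a nonzero
constant term and does not vanish on the generators. Since the kernel is generated by R₁ and R₂,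
each of its elements is q times an element that again lies in the kernel; thus all powers of q
divide R₁, which is absurd. -/
theorem isRegular (hp : p.Prime) (hp2 : p ≠ 2)
    (t₁ : TatSubducts h (Finsupp.single 2 p) (Finsupp.single 1 (p + 2)) R₁ 0)
    (t₂ : TatSubducts h (Finsupp.single 3 p)
      (Finsupp.single 2 1 + Finsupp.single 1 (p ^ 2 - 1)) R₂ 0) :
    RingTheory.Sequence.IsRegular (MvPolynomial (Fin 5) F) [R₁, R₂] := by
  have hker := H.ker_aeval hp hp2 t₁ t₂
  set ρ := aeval (R := F) (![0, 0, X 2, X 3, X 4] : Fin 5 → MvPolynomial (Fin 5) F) with hρ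
  have hpp : 1 < p ^ 2 := Nat.one_lt_pow two_ne_zero hp.one_lt
  have e₁ : ρ R₁ = X 2 ^ p := by
    rw [hρ, H.aeval_relation (by simp) (by simp) (by simp) H.degree_tat₁ t₁, aeval_monomial]
    simp
  have e₂ : ρ R₂ = X 3 ^ p := by
    rw [hρ, H.aeval_relation (by simp) (by simp) (by simp; omega)
      (H.degree_tat₂ hp.pos) t₂,
      aeval_monomial]
    simp
  have hR₁ : R₁ ≠ 0 := by
    rintro rfl
    rw [map_zero] at e₁
    exact pow_ne_zero _ (X_ne_zero _) e₁.symm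
  -- Neither ρ nor evaluation at the generators changes the constant coefficient, because the images
  -- of the variables have no constant term.
  have hcc : (constantCoeff : MvPolynomial (Fin 5) F →+* F).comp ρ.toRingHom =
      constantCoeff := by
    refine MvPolynomial.ringHom_ext (fun r => by simp [hρ]) fun i => ?_
    fin_cases i <;> simp [hρ]
  have hch : (constantCoeff : MvPolynomial (Fin 3) F →+* F).comp (aeval (R := F) h).toRingHom =
      constantCoeff := by
    refine MvPolynomial.ringHom_ext (fun r => by simp) fun i => ?_
    simp only [RingHom.comp_apply, AlgHom.toRingHom_eq_coe, RingHom.coe_coe, aeval_X,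
      constantCoeff_X]
    rw [constantCoeff_eq]
    refine (H.hom i).coeff_eq_zero (ne_of_lt ?_)
    have := hp.pos
    rw [map_zero]
    fin_cases i <;> simp [this]
  have hrel : IsRelPrime R₁ R₂ := by
    refine WfDvdMonoid.isRelPrime_of_no_irreducible_factors (fun hz => hR₁ hz.1) ?_
    intro q hq hq1 hq2
    have hu : IsUnit (ρ q) := by
      have d1 : ρ q ∣ X 2 ^ p := e₁ ▸ map_dvd ρ hq1
      have d2 : ρ q ∣ X 3 ^ p := e₂ ▸ map_dvd ρ hq2
      obtain ⟨i, -, hi⟩ := (dvd_prime_pow (X_prime (R := F) (i := (2 : Fin 5))) _).mp d1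
      rcases Nat.eq_zero_or_pos i with rfl | hi0
      · rw [pow_zero] at hi
        exact associated_one_iff_isUnit.mp hi
      · exfalso
        have d3 : (X 2 : MvPolynomial (Fin 5) F) ∣ X 3 ^ p :=
          ((dvd_pow_self _ hi0.ne').trans hi.symm.dvd).trans d2
        have := (X_prime (R := F) (i := (2 : Fin 5))).dvd_of_dvd_pow d3
        rw [X_dvd_X] at this
        exact absurd this (by decide)
    have hqc : constantCoeff q ≠ 0 := by
      rw [← hcc]
      exact (hu.map (constantCoeff : MvPolynomial (Fin 5) F →+* F)).ne_zero
    have hqk : aeval h q ≠ 0 := by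
      intro h0
      apply hqc
      rw [← hch]
      change constantCoeff (aeval h q) = 0
      rw [h0, map_zero]
    have hall (n : ℕ) : ∀ r, aeval h r = 0 → q ^ n ∣ r := by
      induction n with
      | zero => simp
      | succ n ih =>
        intro r hr
        have hr' : r ∈ Ideal.span {R₁, R₂} := hker ▸ (RingHom.mem_ker.mpr hr)
        obtain ⟨a, b, rfl⟩ := Ideal.mem_span_pair.mp hr'
        obtain ⟨u, hu⟩ := dvd_add (hq1.mul_left a) (hq2.mul_left b)
        rw [hu, map_mul] at hr
        rw [hu, pow_succ']
        exact mul_dvd_mul_left q (ih u ((mul_eq_zero.mp hr).resolve_left hqk))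
    obtain ⟨n, hn⟩ := FiniteMultiplicity.of_not_isUnit hq.not_isUnit hR₁
    exact hn (hall _ _ t₁.aeval_eq)
  refine ⟨?_, ?_⟩
  · rw [RingTheory.Sequence.isWeaklyRegular_cons_iff]
    refine ⟨?_, ?_⟩
    · intro a b hab
      exact mul_left_cancel₀ hR₁ hab
    · rw [RingTheory.Sequence.isWeaklyRegular_singleton_iff]
      rw [isSMulRegular_quotient_iff_mem_of_smul_mem]
      intro g hg
      rw [Submodule.mem_smul_pointwise_iff_exists] at hg ⊢
      obtain ⟨b, -, hb⟩ := hg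
      obtain ⟨u, hu⟩ := hrel.dvd_of_dvd_mul_left (z := g) ⟨b, hb.symm⟩
      exact ⟨u, trivial, hu.symm⟩
  · intro htop
    have h1 : (1 : MvPolynomial (Fin 5) F) ∈ Ideal.span {R₁, R₂} := by
      have : (1 : MvPolynomial (Fin 5) F) ∈ Ideal.ofList [R₁, R₂] • (⊤ : Ideal _) :=
        htop ▸ Submodule.mem_top
      simpa [Ideal.ofList, Set.insert_def] using this
    rw [← hker, RingHom.mem_ker, map_one] at h1
    exact one_ne_zero h1

end HasGensDegrees

end Relations

/-! ### The group action and its translation parameters -/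

section Invariants

variable {F : Type*} [Field F] (p : ℕ) [CharP F p] (M : Matrix (Fin 2) (Fin 4) F)

/-- The translation parameters of a group element: `g` acts by `σ (shift 0 g) (shift 1 g)`. -/
noncomputable def shift (k : Fin 2) (g : Multiplicative (Fin 4 → ZMod p)) : F :=
  ∑ j, ZMod.castHom (dvd_refl p) F (g.toAdd j) * M k j

theorem act_X_zero (g : Multiplicative (Fin 4 → ZMod p)) : act p M g (X 0) =
    X 0 + C (2 * shift p M 0 g) * X 1 + C (shift p M 0 g ^ 2 + shift p M 1 g) * X 2 := by
  rw [act, aeval_X, Fin.sum_univ_three]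
  simp [rep, sigma, shift]

theorem act_X_one (g : Multiplicative (Fin 4 → ZMod p)) : act p M g (X 1) =
    X 1 + C (shift p M 0 g) * X 2 := by
  rw [act, aeval_X, Fin.sum_univ_three]
  simp [rep, sigma, shift]

theorem act_X_two (g : Multiplicative (Fin 4 → ZMod p)) : act p M g (X 2) = X 2 := by
  rw [act, aeval_X, Fin.sum_univ_three]
  simp [rep, sigma]

variable {p M}

theorem mem_invariants {f : MvPolynomial (Fin 3) F} :
    f ∈ invariants p M ↔ ∀ g, act p M g f = f := by
  simp [invariants, Algebra.mem_iInf, AlgHom.mem_equalizer]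

theorem X_two_mem_invariants : (X 2 : MvPolynomial (Fin 3) F) ∈ invariants p M :=
  mem_invariants.mpr fun g => act_X_two p M g

theorem mem_invariants_of_X_mul {f : MvPolynomial (Fin 3) F}
    (hf : X 2 * f ∈ invariants p M) : f ∈ invariants p M := by
  rw [mem_invariants] at hf ⊢
  intro g
  have := hf g
  rw [map_mul, act_X_two] at this
  exact mul_left_cancel₀ (X_ne_zero _) this

theorem act_isHomogeneous (g : Multiplicative (Fin 4 → ZMod p)) {f : MvPolynomial (Fin 3) F}
    {n : ℕ} (hf : f.IsHomogeneous n) : (act p M g f).IsHomogeneous n := by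
  have := hf.aeval (fun i => ∑ j, C (rep p M g i j) * X j) (n := 1) fun i =>
    IsHomogeneous.sum _ _ _ fun j _ => isHomogeneous_C_mul_X _ _
  rwa [one_mul] at this

theorem homogeneousComponent_mem_invariants {f : MvPolynomial (Fin 3) F}
    (hf : f ∈ invariants p M) (n : ℕ) : homogeneousComponent n f ∈ invariants p M := by
  rw [mem_invariants] at hf ⊢
  intro g
  have h1 : homogeneousComponent n (act p M g f) = act p M g (homogeneousComponent n f) := by
    conv_lhs => rw [← sum_homogeneousComponent f]
    rw [map_sum, map_sum]
    have h2 (i : ℕ) : homogeneousComponent n (act p M g (homogeneousComponent i f)) =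
        if n = i then act p M g (homogeneousComponent i f) else 0 := by
      exact homogeneousComponent_of_mem
        (act_isHomogeneous g (homogeneousComponent_isHomogeneous i f))
    simp only [h2]
    rw [Finset.sum_ite_eq]
    split_ifs with h
    · rfl
    · rw [homogeneousComponent_eq_zero, map_zero]
      simpa using h
  rw [← h1, hf g]

variable [Fact p.Prime]

/-- Frobenius is additive and fixes the coefficients, which lie in the prime field. -/
theorem shift_pow (k : Fin 2) (g : Multiplicative (Fin 4 → ZMod p)) (i : ℕ) :
    shift p M k g ^ p ^ i = ∑ j, ZMod.castHom (dvd_refl p) F (g.toAdd j) * M k j ^ p ^ i := by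
  rw [shift, sum_pow_char_pow]
  refine Finset.sum_congr rfl fun j _ => ?_
  rw [mul_pow, ← map_pow, ZMod.pow_card_pow]

theorem shift_mul_inv (k : Fin 2) (g h : Multiplicative (Fin 4 → ZMod p)) :
    shift p M k (g * h⁻¹) = shift p M k g - shift p M k h := by
  simp only [shift, toAdd_mul, toAdd_inv, Pi.add_apply, Pi.neg_apply, map_add, map_neg,
    add_mul, neg_mul, Finset.sum_add_distrib, Finset.sum_neg_distrib, sub_eq_add_neg]

/-- Rows 1, 3, 5, 7 of Γ form the Moore matrix of the first row of M. A group element with α = 0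
gives a kernel vector of it with entries in the prime field. -/
theorem shift_zero_injective (h1357 : gam p M ![1, 3, 5, 7] ≠ 0) :
    Function.Injective (shift p M 0) := by
  intro g h e
  have h0 : shift p M 0 (g * h⁻¹) = 0 := by rw [shift_mul_inv, e, sub_self]
  have h1 := Matrix.eq_zero_of_mulVec_eq_zero h1357
    (v := fun j => ZMod.castHom (dvd_refl p) F ((g * h⁻¹).toAdd j)) (by
      funext a
      have h2 := shift_pow (M := M) 0 (g * h⁻¹) (a : ℕ)
      rw [h0, zero_pow (pow_ne_zero _ (Fact.out : p.Prime).ne_zero)] at h2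
      rw [Matrix.mulVec, dotProduct, Pi.zero_apply, h2]
      refine Finset.sum_congr rfl fun j _ => ?_
      rw [mul_comm]
      congr 1
      fin_cases a <;> simp [gammaRow, Nat.odd_iff])
  rw [← mul_inv_eq_one]
  apply Multiplicative.toAdd.injective
  funext j
  have := congrFun h1 j
  simpa using (map_eq_zero_iff _ (ZMod.castHom (dvd_refl p) F).injective).mp this

end Invariants

/-! ### Lead terms of invariants -/

section LeadTerms

variable {F : Type*} [Field F]

/-- Restriction to the line `x = 0`, `y = 1`. -/
noncomputable def modX (F : Type*) [Field F] : MvPolynomial (Fin 3) F →ₐ[F] Polynomial F :=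
  aeval ![Polynomial.X, 1, 0]

/-- Restriction to the line `x = 1`, `z = 0`. -/
noncomputable def evY (F : Type*) [Field F] : MvPolynomial (Fin 3) F →ₐ[F] Polynomial F :=
  aeval ![0, Polynomial.X, 1]

theorem modX_monomial (m : Fin 3 →₀ ℕ) (c : F) :
    modX F (monomial m c) = Polynomial.monomial (m 0) (if m 2 = 0 then c else 0) := by
  rw [modX, aeval_monomial, Finsupp.prod_fintype _ _ (fun _ => pow_zero _), Fin.prod_univ_three,
    ← Polynomial.C_mul_X_pow_eq_monomial, Polynomial.algebraMap_eq]
  split_ifs with h <;> simp [h]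

theorem evY_monomial (m : Fin 3 →₀ ℕ) (c : F) :
    evY F (monomial m c) = Polynomial.monomial (m 1) (if m 0 = 0 then c else 0) := by
  rw [evY, aeval_monomial, Finsupp.prod_fintype _ _ (fun _ => pow_zero _), Fin.prod_univ_three,
    ← Polynomial.C_mul_X_pow_eq_monomial, Polynomial.algebraMap_eq]
  split_ifs with h <;> simp [h]

theorem _root_.MvPolynomial.IsHomogeneous.sum_eq_of_mem_support {f : MvPolynomial (Fin 3) F}
    {d : ℕ} (hf : f.IsHomogeneous d) {m : Fin 3 →₀ ℕ} (hm : m ∈ f.support) :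
    m 0 + m 1 + m 2 = d := by
  have := hf.degree_eq_sum_deg_support hm
  rw [this, ← Fin.sum_univ_three (fun i => m i)]
  exact (Finset.sum_subset (Finset.subset_univ _)
    fun i _ hi => Finsupp.notMem_support_iff.mp hi).symm

/-- Among the monomials of a fixed degree without x, the exponent of z determines the monomial, so
setting y = 1 merges no coefficients. -/
theorem modX_coeff {f : MvPolynomial (Fin 3) F} {d : ℕ} (hf : f.IsHomogeneous d)
    {m : Fin 3 →₀ ℕ} (hm : m 0 + m 1 = d) (hm2 : m 2 = 0) :
    (modX F f).coeff (m 0) = coeff m f := by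
  classical
  conv_lhs => rw [f.as_sum]
  simp only [map_sum, modX_monomial, Polynomial.finsetSum_coeff, Polynomial.coeff_monomial]
  rw [Finset.sum_eq_single m]
  · simp [hm2]
  · intro n hn hnm
    have h1 := hf.sum_eq_of_mem_support hn
    split_ifs with h2 h3 <;> try rfl
    exfalso
    apply hnm
    ext i
    fin_cases i
    · exact h2
    · change n 1 = m 1; omega
    · change n 2 = m 2; omega
  · intro h
    simp [hm2, notMem_support_iff.mp h]

theorem evY_coeff {f : MvPolynomial (Fin 3) F} {d : ℕ} (hf : f.IsHomogeneous d)
    {m : Fin 3 →₀ ℕ} (hm : m 1 + m 2 = d) (hm2 : m 0 = 0) :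
    (evY F f).coeff (m 1) = coeff m f := by
  classical
  conv_lhs => rw [f.as_sum]
  simp only [map_sum, evY_monomial, Polynomial.finsetSum_coeff, Polynomial.coeff_monomial]
  rw [Finset.sum_eq_single m]
  · simp [hm2]
  · intro n hn hnm
    have h1 := hf.sum_eq_of_mem_support hn
    split_ifs with h2 h3 <;> try rfl
    exfalso
    apply hnm
    ext i
    fin_cases i
    · change n 0 = m 0; omega
    · exact h2
    · change n 2 = m 2; omega
  · intro h
    simp [hm2, notMem_support_iff.mp h]

theorem modX_natDegree_le {f : MvPolynomial (Fin 3) F} {d : ℕ} (hf : f.IsHomogeneous d) :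
    (modX F f).natDegree ≤ d := by
  conv_lhs => rw [f.as_sum]
  rw [map_sum]
  refine Polynomial.natDegree_sum_le_of_forall_le _ _ fun m hm => ?_
  rw [modX_monomial]
  refine (Polynomial.natDegree_monomial_le _).trans ?_
  have := hf.sum_eq_of_mem_support hm
  omega

theorem evY_natDegree_le {f : MvPolynomial (Fin 3) F} {d : ℕ} (hf : f.IsHomogeneous d) :
    (evY F f).natDegree ≤ d := by
  conv_lhs => rw [f.as_sum]
  rw [map_sum]
  refine Polynomial.natDegree_sum_le_of_forall_le _ _ fun m hm => ?_
  rw [evY_monomial]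
  refine (Polynomial.natDegree_monomial_le _).trans ?_
  have := hf.sum_eq_of_mem_support hm
  omega

theorem evY_X_two : evY F (X 2) = 1 := by simp [evY]

theorem isHomogeneous_of_X_mul {f : MvPolynomial (Fin 3) F} {d : ℕ} (i : Fin 3)
    (hf : (X i * f).IsHomogeneous (d + 1)) : f.IsHomogeneous d := by
  intro m hm
  rw [← coeff_X_mul m i] at hm
  have := hf hm
  rw [map_add, Finsupp.weight_single] at this
  simp at this
  omega

variable {p : ℕ} [CharP F p] [Fact p.Prime] {M : Matrix (Fin 2) (Fin 4) F}

omit [Fact p.Prime] in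
-- On the line x = 0, y = 1 the element g only translates z, by 2α(g).
theorem modX_act (g : Multiplicative (Fin 4 → ZMod p)) (f : MvPolynomial (Fin 3) F) :
    modX F (act p M g f) =
      (modX F f).comp (Polynomial.X + Polynomial.C (2 * shift p M 0 g)) := by
  rw [Polynomial.comp_eq_aeval]
  have : (modX F).comp (act p M g) = (Polynomial.aeval
      (Polynomial.X + Polynomial.C (2 * shift p M 0 g))).comp (modX F) := by
    refine MvPolynomial.algHom_ext fun i => ?_
    fin_cases i
    · simp [act_X_zero, modX, Polynomial.algebraMap_eq]
    · simp [act_X_one, modX]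
    · simp [act_X_two, modX]
  exact DFunLike.congr_fun this f

/-- Modulo `x`, an invariant of degree less than `p⁴` is a multiple of a power of `y`. -/
theorem modX_eq_C (hp : p ≠ 2) (h1357 : gam p M ![1, 3, 5, 7] ≠ 0)
    {f : MvPolynomial (Fin 3) F} (hf : f ∈ invariants p M) {d : ℕ} (hd : f.IsHomogeneous d)
    (hdp : d < p ^ 4) : modX F f = Polynomial.C ((modX F f).coeff 0) := by
  have h2 : (2 : F) ≠ 0 := by
    intro h
    have : (p : ℕ) ∣ 2 := (CharP.cast_eq_zero_iff F p 2).mp (by exact_mod_cast h)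
    exact hp ((Nat.prime_dvd_prime_iff_eq Fact.out Nat.prime_two).mp this)
  rw [← sub_eq_zero]
  -- By invariance the restriction minus its constant term vanishes at the p⁴ distinct points 2α(g),
  -- which are more than its degree.
  refine Polynomial.eq_zero_of_natDegree_lt_card_of_eval_eq_zero _
    (f := fun g : Multiplicative (Fin 4 → ZMod p) => 2 * shift p M 0 g) ?_ ?_ ?_
  · intro g h e
    exact shift_zero_injective h1357 (mul_left_cancel₀ h2 e)
  · intro g
    have h3 := congrArg (Polynomial.eval 0) (modX_act (M := M) g f)
    rw [mem_invariants.mp hf g, Polynomial.eval_comp] at h3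
    simp at h3
    simp [← h3, Polynomial.coeff_zero_eq_eval_zero]
  · refine Polynomial.natDegree_sub_C.trans_lt ((modX_natDegree_le hd).trans_lt ?_)
    simpa [ZMod.card] using hdp

/-- The case k = 0: modulo x the invariant is a nonzero multiple of y^d, which is therefore its lead
term. The same coefficient is that of Y^d on the line x = 1, z = 0. -/
theorem exists_eq_of_modX_ne_zero (hp : p ≠ 2) (h1357 : gam p M ![1, 3, 5, 7] ≠ 0)
    {f : MvPolynomial (Fin 3) F} (hf : f ∈ invariants p M) {d : ℕ} (hd : f.IsHomogeneous d)
    (hdp : d < p ^ 4) (hc : modX F f ≠ 0) :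
    ∃ k g, d = k + (evY F f).natDegree ∧ f = X 2 ^ k * g ∧ g ∈ invariants p M ∧
      g.IsHomogeneous (evY F f).natDegree ∧ evY F f ≠ 0 ∧
      grevlex.degree g = Finsupp.single 1 (evY F f).natDegree ∧
      grevlex.leadingCoeff g = (evY F f).leadingCoeff := by
  have hC := modX_eq_C hp h1357 hf hd hdp
  have hc0 : (modX F f).coeff 0 ≠ 0 := fun h => hc (by rw [hC, h, Polynomial.C_0])
  have h1 : coeff (Finsupp.single 1 d) f = (modX F f).coeff 0 := by
    rw [← modX_coeff hd (m := Finsupp.single 1 d) (by simp) (by simp)]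
    simp
  have h2 : (evY F f).coeff d = (modX F f).coeff 0 := by
    rw [← h1, ← evY_coeff hd (m := Finsupp.single 1 d) (by simp) (by simp)]
    simp
  have h3 : (evY F f).natDegree = d :=
    Polynomial.natDegree_eq_of_le_of_coeff_ne_zero (evY_natDegree_le hd) (h2 ▸ hc0)
  have h4 : grevlex.degree f = Finsupp.single 1 d := by
    apply grevlex.toSyn.injective
    refine le_antisymm (grevlex.degree_le_iff.mpr fun m hm => ?_)
      (grevlex.le_degree (mem_support_iff.mpr (h1 ▸ hc0)))
    have hs := hd.sum_eq_of_mem_support hm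
    have hz (h : m 2 = 0) : m 0 = 0 := by
      by_contra h0
      apply mem_support_iff.mp hm
      rw [← modX_coeff hd (by omega) h, hC, Polynomial.coeff_C_of_ne_zero h0]
    rw [grevlex_le_iff_key]
    simp
    omega
  rw [h3]
  refine ⟨0, f, by simp, by simp, hf, hd, fun h => hc0 (by rw [← h2, h, Polynomial.coeff_zero]),
    h4, ?_⟩
  rw [MonomialOrder.leadingCoeff, h4, h1, Polynomial.leadingCoeff, h3, h2]

theorem X_two_dvd_of_modX_eq_zero {f : MvPolynomial (Fin 3) F} {d : ℕ} (hd : f.IsHomogeneous d)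
    (hc : modX F f = 0) :
    X 2 ∣ f := by
  rw [X_dvd_iff_modMonomial_eq_zero]
  ext m
  rw [coeff_zero]
  by_cases h : Finsupp.single 2 1 ≤ m
  · exact coeff_modMonomial_of_le _ h
  · rw [coeff_modMonomial_of_not_le _ h]
    by_contra hm
    have hs := hd.sum_eq_of_mem_support (mem_support_iff.mpr hm)
    rw [Finsupp.single_le_iff] at h
    rw [← modX_coeff hd (by omega) (by omega), hc, Polynomial.coeff_zero] at hm
    exact hm rfl

/-- The lead term of an invariant of degree less than `p⁴` can be read off on the line `z = 0`,
`x = 1`. -/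
theorem exists_eq_X_pow_mul (hp : p ≠ 2) (h1357 : gam p M ![1, 3, 5, 7] ≠ 0) (d : ℕ) :
    ∀ f ∈ invariants p M, f.IsHomogeneous d → d < p ^ 4 → f ≠ 0 →
    ∃ k g, d = k + (evY F f).natDegree ∧ f = X 2 ^ k * g ∧ g ∈ invariants p M ∧
      g.IsHomogeneous (evY F f).natDegree ∧ evY F f ≠ 0 ∧
      grevlex.degree g = Finsupp.single 1 (evY F f).natDegree ∧
      grevlex.leadingCoeff g = (evY F f).leadingCoeff := by
  induction d with
  | zero =>
    intro f hf hd hdp hf0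
    refine exists_eq_of_modX_ne_zero hp h1357 hf hd hdp fun h => hf0 ?_
    obtain ⟨g, rfl⟩ := X_two_dvd_of_modX_eq_zero hd h
    by_contra h0
    have h1 := hd.totalDegree h0
    rw [totalDegree_mul_of_isDomain (X_ne_zero _) (right_ne_zero_of_mul h0), totalDegree_X] at h1
    omega
  | succ n ih =>
    intro f hf hd hdp hf0
    -- Removing a factor x lowers the degree and does not affect the restriction to x = 1.
    by_cases hc : modX F f = 0
    · obtain ⟨f, rfl⟩ := X_two_dvd_of_modX_eq_zero hd hc
      obtain ⟨k, g, h1, h2, h3⟩ := ih f (mem_invariants_of_X_mul hf) (isHomogeneous_of_X_mul 2 hd)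
        (by omega) (right_ne_zero_of_mul hf0)
      rw [map_mul, evY_X_two, one_mul]
      refine ⟨k + 1, g, by omega, ?_, h3⟩
      rw [pow_succ', mul_assoc, ← h2]
    · exact exists_eq_of_modX_ne_zero hp h1357 hf hd hdp hc

end LeadTerms

/-! ### The minors `f_J` -/

section Minors

theorem det_snoc {S : Type*} [CommRing S] (G : Matrix (Fin 5) (Fin 4) S) (u : Fin 5 → S) :
    (Matrix.of fun a b => Fin.snoc (α := fun _ => S) (G a) (u a) b).det =
      ∑ a : Fin 5, (-1) ^ ((a : ℕ) + 4) * u a * (G.submatrix a.succAbove id).det := by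
  rw [Matrix.det_succ_column _ (Fin.last 4)]
  refine Finset.sum_congr rfl fun a _ => ?_
  simp only [Matrix.of_apply, Fin.snoc_last, Fin.val_last]
  congr 2
  ext i j
  simp [-Fin.reduceLast, Fin.succAbove_last]

variable {F : Type*} [Field F] {p : ℕ}

theorem gam_eq {M : Matrix (Fin 2) (Fin 4) F} (J : Fin 4 → ℕ) :
    gam p M J = (Matrix.of fun a b => gammaRow p M (J a) b).det := rfl

theorem fMinor_eq (M : Matrix (Fin 2) (Fin 4) F) (J : Fin 5 → ℕ) : fMinor p M J =
    ∑ a : Fin 5, (-1) ^ ((a : ℕ) + 4) * (numEntry F p (J a) *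
        X 2 ^ ((Finset.univ.sup fun a' => denExp p (J a')) - denExp p (J a))) *
      C (gam p M (J ∘ a.succAbove)) := by
  rw [fMinor]
  refine (det_snoc (Matrix.of fun a j => C (gammaRow p M (J a) j)) _).trans ?_
  refine Finset.sum_congr rfl fun a _ => ?_
  rw [gam_eq, RingHom.map_det]
  rfl

theorem delta_isHomogeneous : (delta F).IsHomogeneous 2 :=
  ((isHomogeneous_X F 1).pow 2).sub ((isHomogeneous_X F 2).mul (isHomogeneous_X F 0))

theorem numEntry_isHomogeneous (r : ℕ) : (numEntry F p r).IsHomogeneous (denExp p r) := by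
  rw [numEntry, denExp]
  split_ifs
  · simpa using (isHomogeneous_X F (1 : Fin 3)).pow (p ^ ((r - 1) / 2))
  · exact (delta_isHomogeneous.neg).pow _

theorem denExp_le (J : Fin 5 → ℕ) (a : Fin 5) :
    denExp p (J a) ≤ Finset.univ.sup fun a' => denExp p (J a') :=
  Finset.le_sup (f := fun a' => denExp p (J a')) (Finset.mem_univ a)

theorem fMinor_isHomogeneous (M : Matrix (Fin 2) (Fin 4) F) (J : Fin 5 → ℕ) :
    (fMinor p M J).IsHomogeneous (Finset.univ.sup fun a' => denExp p (J a')) := by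
  rw [fMinor_eq]
  refine IsHomogeneous.sum _ _ _ fun a _ => ?_
  have h1 := (numEntry_isHomogeneous (F := F) (p := p) (J a)).mul
    (isHomogeneous_X_pow (R := F) (2 : Fin 3)
      ((Finset.univ.sup fun a' => denExp p (J a')) - denExp p (J a)))
  rw [Nat.add_sub_cancel' (denExp_le J a)] at h1
  have h2 : (((-1) ^ ((a : ℕ) + 4) : MvPolynomial (Fin 3) F)).IsHomogeneous 0 := by
    have := isHomogeneous_C (Fin 3) ((-1 : F) ^ ((a : ℕ) + 4))
    simpa using this
  simpa using (h2.mul h1).mul (isHomogeneous_C (Fin 3) (gam p M (J ∘ a.succAbove)))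

theorem act_delta [CharP F p] (M : Matrix (Fin 2) (Fin 4) F)
    (g : Multiplicative (Fin 4 → ZMod p)) :
    act p M g (-delta F) = -delta F + C (shift p M 1 g) * X 2 ^ 2 := by
  simp only [delta, map_neg, map_sub, map_pow, map_mul, act_X_zero, act_X_one, act_X_two, map_add,
    map_ofNat]
  ring

variable [CharP F p] [Fact p.Prime] (M : Matrix (Fin 2) (Fin 4) F)

/-- Frobenius carries the translations of y/x and -δ/x² over to their p^i-th powers. In every row
the new entry is thus translated by the same combination of the entries of Γ, with the coordinates
of g as coefficients. -/
theorem act_numEntry (g : Multiplicative (Fin 4 → ZMod p)) (r : ℕ) :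
    act p M g (numEntry F p r) = numEntry F p r +
      C (∑ j, ZMod.castHom (dvd_refl p) F (g.toAdd j) * gammaRow p M r j) *
        X 2 ^ denExp p r := by
  rw [numEntry, denExp, map_pow]
  simp only [gammaRow]
  split_ifs with h
  · rw [act_X_one, add_pow_char_pow, mul_pow, ← map_pow, shift_pow]
  · rw [act_delta, add_pow_char_pow, mul_pow, ← map_pow, shift_pow, ← pow_mul]

/-- The last column changes by x^D times a fixed combination of the four columns of Γ, which does
not affect the determinant. -/
theorem fMinor_mem_invariants (J : Fin 5 → ℕ) : fMinor p M J ∈ invariants p M := by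
  rw [mem_invariants]
  intro g
  set D := Finset.univ.sup fun a' => denExp p (J a') with hD
  set n : Fin 4 → F := fun j => ZMod.castHom (dvd_refl p) F (g.toAdd j) with hn
  -- This is the expansion of the determinant whose fifth column is the combination of the others
  -- with coefficients n; the vector (n, -1) lies in its kernel.
  have h0 : ∑ a : Fin 5, (-1) ^ ((a : ℕ) + 4) * (∑ j, n j * gammaRow p M (J a) j) *
      gam p M (J ∘ a.succAbove) = 0 := by
    refine (det_snoc (Matrix.of fun a j => gammaRow p M (J a) j)
      fun a => ∑ j, n j * gammaRow p M (J a) j).symm.trans ?_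
    rw [← Matrix.exists_mulVec_eq_zero_iff]
    refine ⟨Fin.snoc (α := fun _ => F) n (-1), fun h => ?_, ?_⟩
    · have := congrFun h (Fin.last 4)
      rw [Fin.snoc_last] at this
      simp at this
    · funext a
      rw [Matrix.mulVec, dotProduct, Fin.sum_univ_castSucc]
      simp [mul_comm, -Fin.reduceLast]
  rw [fMinor_eq, map_sum, ← sub_eq_zero, ← Finset.sum_sub_distrib]
  have h1 (a : Fin 5) : act p M g ((-1) ^ ((a : ℕ) + 4) * (numEntry F p (J a) *
        X 2 ^ (D - denExp p (J a))) * C (gam p M (J ∘ a.succAbove))) -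
      (-1) ^ ((a : ℕ) + 4) * (numEntry F p (J a) *
        X 2 ^ (D - denExp p (J a))) * C (gam p M (J ∘ a.succAbove)) =
      X 2 ^ D * C ((-1) ^ ((a : ℕ) + 4) * (∑ j, n j * gammaRow p M (J a) j) *
      gam p M (J ∘ a.succAbove)) := by
    have h2 : X 2 ^ D = X 2 ^ denExp p (J a) * (X 2 : MvPolynomial (Fin 3) F) ^
        (D - denExp p (J a)) := by
      rw [← pow_add, Nat.add_sub_cancel' (denExp_le J a)]
    simp only [map_mul, map_pow, map_neg, map_one, act_numEntry, act_X_two, h2]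
    rw [show act p M g (C (gam p M (J ∘ a.succAbove))) = C (gam p M (J ∘ a.succAbove)) from
      (act p M g).commutes _]
    ring
  rw [Finset.sum_congr rfl fun a _ => h1 a, ← Finset.mul_sum, ← map_sum, h0, map_zero, mul_zero]

omit [CharP F p] in
theorem sup_denExp_five (hp : p ≠ 2) :
    (Finset.univ.sup fun a' => denExp p ((![1, 2, 3, 4, 5] : Fin 5 → ℕ) a')) = p ^ 2 := by
  have h2 := (Fact.out : p.Prime).two_le
  have h3 : 3 ≤ p := by omega
  have : p ^ 2 = p * p := sq p
  have h4 : 3 * p ≤ p * p := Nat.mul_le_mul_right p h3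
  refine le_antisymm (Finset.sup_le fun a _ => ?_)
    (by simpa [denExp, Nat.odd_iff] using
      denExp_le (p := p) (![1, 2, 3, 4, 5] : Fin 5 → ℕ) 4)
  fin_cases a <;> simp [denExp, Nat.odd_iff] <;> omega

omit [CharP F p] in
theorem sup_denExp_six (hp : p ≠ 2) :
    (Finset.univ.sup fun a' => denExp p ((![1, 2, 3, 4, 6] : Fin 5 → ℕ) a')) = 2 * p ^ 2 := by
  have h2 := (Fact.out : p.Prime).two_le
  have h3 : 3 ≤ p := by omega
  have : p ^ 2 = p * p := sq p
  have h4 : 3 * p ≤ p * p := Nat.mul_le_mul_right p h3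
  refine le_antisymm (Finset.sup_le fun a _ => ?_)
    (by simpa [denExp, Nat.odd_iff] using
      denExp_le (p := p) (![1, 2, 3, 4, 6] : Fin 5 → ℕ) 4)
  fin_cases a <;> simp [denExp, Nat.odd_iff] <;> omega

omit [CharP F p] in
theorem f₁_eq (hp : p ≠ 2) : f₁ p M = C (gam p M ![1, 2, 3, 4]) * X 1 ^ p ^ 2
    - C (gam p M ![1, 2, 3, 5]) * ((-delta F) ^ p * X 2 ^ (p ^ 2 - 2 * p))
    + C (gam p M ![1, 2, 4, 5]) * (X 1 ^ p * X 2 ^ (p ^ 2 - p))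
    - C (gam p M ![1, 3, 4, 5]) * (-delta F * X 2 ^ (p ^ 2 - 2))
    + C (gam p M ![2, 3, 4, 5]) * (X 1 * X 2 ^ (p ^ 2 - 1)) := by
  rw [f₁, fMinor_eq, sup_denExp_five hp, Fin.sum_univ_five]
  have e0 : (![1, 2, 3, 4, 5] : Fin 5 → ℕ) ∘ Fin.succAbove 0 = ![2, 3, 4, 5] := by decide
  have e1 : (![1, 2, 3, 4, 5] : Fin 5 → ℕ) ∘ Fin.succAbove 1 = ![1, 3, 4, 5] := by decide
  have e2 : (![1, 2, 3, 4, 5] : Fin 5 → ℕ) ∘ Fin.succAbove 2 = ![1, 2, 4, 5] := by decide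
  have e3 : (![1, 2, 3, 4, 5] : Fin 5 → ℕ) ∘ Fin.succAbove 3 = ![1, 2, 3, 5] := by decide
  have e4 : (![1, 2, 3, 4, 5] : Fin 5 → ℕ) ∘ Fin.succAbove 4 = ![1, 2, 3, 4] := by decide
  rw [e0, e1, e2, e3, e4]
  simp [numEntry, denExp, Nat.odd_iff]
  ring

omit [CharP F p] in
theorem f₆_eq (hp : p ≠ 2) : fMinor p M ![1, 2, 3, 4, 6] =
    C (gam p M ![1, 2, 3, 4]) * (-delta F) ^ p ^ 2
    - C (gam p M ![1, 2, 3, 6]) * ((-delta F) ^ p * X 2 ^ (2 * p ^ 2 - 2 * p))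
    + C (gam p M ![1, 2, 4, 6]) * (X 1 ^ p * X 2 ^ (2 * p ^ 2 - p))
    - C (gam p M ![1, 3, 4, 6]) * (-delta F * X 2 ^ (2 * p ^ 2 - 2))
    + C (gam p M ![2, 3, 4, 6]) * (X 1 * X 2 ^ (2 * p ^ 2 - 1)) := by
  rw [fMinor_eq, sup_denExp_six hp, Fin.sum_univ_five]
  have e0 : (![1, 2, 3, 4, 6] : Fin 5 → ℕ) ∘ Fin.succAbove 0 = ![2, 3, 4, 6] := by decide
  have e1 : (![1, 2, 3, 4, 6] : Fin 5 → ℕ) ∘ Fin.succAbove 1 = ![1, 3, 4, 6] := by decide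
  have e2 : (![1, 2, 3, 4, 6] : Fin 5 → ℕ) ∘ Fin.succAbove 2 = ![1, 2, 4, 6] := by decide
  have e3 : (![1, 2, 3, 4, 6] : Fin 5 → ℕ) ∘ Fin.succAbove 3 = ![1, 2, 3, 6] := by decide
  have e4 : (![1, 2, 3, 4, 6] : Fin 5 → ℕ) ∘ Fin.succAbove 4 = ![1, 2, 3, 4] := by decide
  rw [e0, e1, e2, e3, e4]
  simp [numEntry, denExp, Nat.odd_iff]
  ring

omit [CharP F p] in
theorem f₁_isHomogeneous (hp : p ≠ 2) : (f₁ p M).IsHomogeneous (p ^ 2) :=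
  sup_denExp_five hp ▸ fMinor_isHomogeneous M _

omit [CharP F p] in
theorem f₆_isHomogeneous (hp : p ≠ 2) :
    (fMinor p M ![1, 2, 3, 4, 6]).IsHomogeneous (2 * p ^ 2) :=
  sup_denExp_six hp ▸ fMinor_isHomogeneous M _

end Minors

/-! ### Plücker relations and the action of Frobenius on the minors -/

section Pluecker

open Matrix

variable {F : Type*} [Field F] {p : ℕ} (M : Matrix (Fin 2) (Fin 4) F)

theorem gam_expand (i j k l : ℕ) : gam p M ![i, j, k, l] =
    (of ![gammaRow p M i, gammaRow p M j, gammaRow p M k, gammaRow p M l]).det := by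
  rw [gam_eq]
  congr 1
  ext a b
  fin_cases a <;> rfl

theorem det_four {S : Type*} [CommRing S] (u v w z : Fin 4 → S) : (of ![u, v, w, z]).det =
    u 0 * (v 1 * (w 2 * z 3 - w 3 * z 2) - v 2 * (w 1 * z 3 - w 3 * z 1)
      + v 3 * (w 1 * z 2 - w 2 * z 1))
    - u 1 * (v 0 * (w 2 * z 3 - w 3 * z 2) - v 2 * (w 0 * z 3 - w 3 * z 0)
      + v 3 * (w 0 * z 2 - w 2 * z 0))
    + u 2 * (v 0 * (w 1 * z 3 - w 3 * z 1) - v 1 * (w 0 * z 3 - w 3 * z 0)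
      + v 3 * (w 0 * z 1 - w 1 * z 0))
    - u 3 * (v 0 * (w 1 * z 2 - w 2 * z 1) - v 1 * (w 0 * z 2 - w 2 * z 0)
      + v 2 * (w 0 * z 1 - w 1 * z 0)) := by
  simp [det_succ_row_zero, Fin.sum_univ_succ, Fin.succAbove]
  ring

/-- A Plücker relation: any five vectors in a four-dimensional space are dependent. -/
theorem pluecker {S : Type*} [CommRing S] (a b c v₀ v₁ v₂ v₃ v₄ : Fin 4 → S) :
    (of ![a, b, c, v₀]).det * (of ![v₁, v₂, v₃, v₄]).det
    - (of ![a, b, c, v₁]).det * (of ![v₀, v₂, v₃, v₄]).det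
    + (of ![a, b, c, v₂]).det * (of ![v₀, v₁, v₃, v₄]).det
    - (of ![a, b, c, v₃]).det * (of ![v₀, v₁, v₂, v₄]).det
    + (of ![a, b, c, v₄]).det * (of ![v₀, v₁, v₂, v₃]).det = 0 := by
  simp only [det_four]
  ring

/-- Frobenius is a ring homomorphism that maps row r of Γ to row r + 2. The row indices are written
as successors because `gammaRow` contains the truncated subtraction r - 1. -/
theorem gam_pow [CharP F p] [Fact p.Prime] (i j k l : ℕ) :
    gam p M ![i + 1, j + 1, k + 1, l + 1] ^ p =
      gam p M ![i + 3, j + 3, k + 3, l + 3] := by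
  have h (r : ℕ) : gammaRow p M (r + 3) = fun b => gammaRow p M (r + 1) b ^ p := by
    funext b
    have h2 : (r + 3 - 1) / 2 = (r + 1 - 1) / 2 + 1 := by omega
    have h1 : Odd (r + 3) ↔ Odd (r + 1) := by rw [Nat.odd_iff, Nat.odd_iff]; omega
    simp only [gammaRow, h1, h2, pow_succ, pow_mul]
  rw [gam_expand, gam_expand, h, h, h, h, det_four, det_four]
  have := (frobenius F p).map_add
  have e (x : F) : x ^ p = frobenius F p x := rfl
  simp only [e]
  simp only [map_add, map_sub, map_mul]

end Pluecker

/-! ### Leading terms of polynomials in one variable -/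

section OneVariable

open Polynomial (natDegree)

variable {F : Type*} [Field F]

/-- `f` is `u Y ^ n` up to terms of degree at most `n - k`. -/
def LeadsWith (f : Polynomial F) (u : F) (n k : ℕ) : Prop :=
  ∃ w : Polynomial F, f = Polynomial.C u * Polynomial.X ^ n + w ∧ (w = 0 ∨ natDegree w + k ≤ n)

theorem LeadsWith.natDegree_le {f : Polynomial F} {u : F} {n k : ℕ} (hf : LeadsWith f u n k) :
    natDegree f ≤ n := by
  obtain ⟨w, rfl, hw⟩ := hf
  refine Polynomial.natDegree_add_le_of_degree_le (Polynomial.natDegree_C_mul_X_pow_le _ _) ?_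
  rcases hw with rfl | hw
  · simp
  · omega

theorem LeadsWith.natDegree_eq {f : Polynomial F} {u : F} {n k : ℕ} (hf : LeadsWith f u n k)
    (hk : 0 < k) (hu : u ≠ 0) : natDegree f = n ∧ f.leadingCoeff = u := by
  have h1 : f.coeff n = u := by
    obtain ⟨w, rfl, hw⟩ := hf
    rw [Polynomial.coeff_add, Polynomial.coeff_C_mul_X_pow, if_pos rfl]
    rcases hw with rfl | hw
    · simp
    · rw [Polynomial.coeff_eq_zero_of_natDegree_lt (by omega), add_zero]
  have h2 := Polynomial.natDegree_eq_of_le_of_coeff_ne_zero hf.natDegree_le (h1.symm ▸ hu)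
  exact ⟨h2, by rw [Polynomial.leadingCoeff, h2, h1]⟩

theorem LeadsWith.mul {f g : Polynomial F} {u v : F} {n m k : ℕ} (hf : LeadsWith f u n k)
    (hg : LeadsWith g v m k) : LeadsWith (f * g) (u * v) (n + m) k := by
  have hf' := hf.natDegree_le
  obtain ⟨w, rfl, hw⟩ := hf
  obtain ⟨z, rfl, hz⟩ := hg
  refine ⟨Polynomial.C u * Polynomial.X ^ n * z + w * (Polynomial.C v * Polynomial.X ^ m + z),
    by rw [Polynomial.C_mul]; ring, ?_⟩
  have hg' : natDegree (Polynomial.C v * Polynomial.X ^ m + z) ≤ m := by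
    refine Polynomial.natDegree_add_le_of_degree_le (Polynomial.natDegree_C_mul_X_pow_le _ _) ?_
    rcases hz with rfl | hz
    · simp
    · omega
  have hX := Polynomial.natDegree_C_mul_X_pow_le u n
  rcases hw with rfl | hw <;> rcases hz with rfl | hz
  · left; ring
  · right
    rw [zero_mul, add_zero]
    have := Polynomial.natDegree_mul_le (p := Polynomial.C u * Polynomial.X ^ n) (q := z)
    omega
  · right
    rw [mul_zero, zero_add]
    have := Polynomial.natDegree_mul_le (p := w) (q := Polynomial.C v * Polynomial.X ^ m + 0)
    omega
  · right
    have h1 := Polynomial.natDegree_mul_le (p := Polynomial.C u * Polynomial.X ^ n) (q := z)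
    have h2 := Polynomial.natDegree_mul_le (p := w) (q := Polynomial.C v * Polynomial.X ^ m + z)
    have h3 := Polynomial.natDegree_add_le (Polynomial.C u * Polynomial.X ^ n * z)
      (w * (Polynomial.C v * Polynomial.X ^ m + z))
    omega

theorem LeadsWith.pow {f : Polynomial F} {u : F} {n k : ℕ} (hf : LeadsWith f u n k) (j : ℕ) :
    LeadsWith (f ^ j) (u ^ j) (n * j) k := by
  induction j with
  | zero => exact ⟨0, by simp, .inl rfl⟩
  | succ j ih =>
    rw [pow_succ, pow_succ, Nat.mul_succ]
    exact ih.mul hf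

variable {p : ℕ}

theorem quadrinomial_natDegree_le (hp : 2 ≤ p) (b c d e : F) :
    natDegree (Polynomial.C b * Polynomial.X ^ (2 * p) + Polynomial.C c * Polynomial.X ^ p +
      Polynomial.C d * Polynomial.X ^ 2 + Polynomial.C e * Polynomial.X) ≤ 2 * p := by
  have h1 := Polynomial.natDegree_C_mul_X_pow_le b (2 * p)
  have h2 := Polynomial.natDegree_C_mul_X_pow_le c p
  have h3 := Polynomial.natDegree_C_mul_X_pow_le d 2
  have h4 := Polynomial.natDegree_C_mul_X_pow_le e 1
  rw [pow_one] at h4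
  refine Polynomial.natDegree_add_le_of_degree_le (Polynomial.natDegree_add_le_of_degree_le
    (Polynomial.natDegree_add_le_of_degree_le h1 ?_) ?_) ?_ <;> omega

theorem trinomial_natDegree_le (hp : 2 ≤ p) (c d e : F) :
    natDegree (Polynomial.C c * Polynomial.X ^ p +
      Polynomial.C d * Polynomial.X ^ 2 + Polynomial.C e * Polynomial.X) ≤ p := by
  have h2 := Polynomial.natDegree_C_mul_X_pow_le c p
  have h3 := Polynomial.natDegree_C_mul_X_pow_le d 2
  have h4 := Polynomial.natDegree_C_mul_X_pow_le e 1
  rw [pow_one] at h4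
  refine Polynomial.natDegree_add_le_of_degree_le
    (Polynomial.natDegree_add_le_of_degree_le h2 ?_) ?_ <;> omega

theorem leadsWith_first (hp : 3 ≤ p) (a b c d e : F) :
    LeadsWith (Polynomial.C a * Polynomial.X ^ p ^ 2 +
      (Polynomial.C b * Polynomial.X ^ (2 * p) + Polynomial.C c * Polynomial.X ^ p +
      Polynomial.C d * Polynomial.X ^ 2 + Polynomial.C e * Polynomial.X)) a (p ^ 2)
      (p ^ 2 - 2 * p) := by
  refine ⟨_, rfl, .inr ?_⟩
  have h1 := quadrinomial_natDegree_le (by omega : 2 ≤ p) b c d e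
  have h2 : 3 * p ≤ p ^ 2 := by rw [sq]; exact Nat.mul_le_mul_right p hp
  omega

theorem LeadsWith.mono {f : Polynomial F} {u : F} {n k l : ℕ} (hf : LeadsWith f u n k)
    (h : l ≤ k) : LeadsWith f u n l := by
  obtain ⟨w, hf, hw⟩ := hf
  exact ⟨w, hf, hw.imp_right fun h => by omega⟩

/-- The polynomial `A Y^(p²) r + q`, for `r` of degree `2 p` and `q` of degree at most `4 p`. -/
theorem leadsWith_second (hp : 3 ≤ p) (a b c d e : F) (q : Polynomial F)
    (hq : natDegree q ≤ 4 * p) :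
    LeadsWith (Polynomial.C a * Polynomial.X ^ p ^ 2 *
      (Polynomial.C b * Polynomial.X ^ (2 * p) + Polynomial.C c * Polynomial.X ^ p +
      Polynomial.C d * Polynomial.X ^ 2 + Polynomial.C e * Polynomial.X) + q) (a * b)
      (p ^ 2 + 2 * p) p := by
  refine ⟨Polynomial.C a * Polynomial.X ^ p ^ 2 * (Polynomial.C c * Polynomial.X ^ p +
      Polynomial.C d * Polynomial.X ^ 2 + Polynomial.C e * Polynomial.X) + q,
    by rw [Polynomial.C_mul, pow_add]; ring, .inr ?_⟩
  have h1 := trinomial_natDegree_le (by omega : 2 ≤ p) c d e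
  have h2 : 3 * p ≤ p ^ 2 := by rw [sq]; exact Nat.mul_le_mul_right p hp
  have h3 := Polynomial.natDegree_C_mul_X_pow_le a (p ^ 2)
  have h4 := Polynomial.natDegree_mul_le (p := Polynomial.C a * Polynomial.X ^ p ^ 2)
    (q := Polynomial.C c * Polynomial.X ^ p +
      Polynomial.C d * Polynomial.X ^ 2 + Polynomial.C e * Polynomial.X)
  have h5 := Polynomial.natDegree_add_le (Polynomial.C a * Polynomial.X ^ p ^ 2 *
    (Polynomial.C c * Polynomial.X ^ p +
      Polynomial.C d * Polynomial.X ^ 2 + Polynomial.C e * Polynomial.X)) q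
  omega

/-- The product `g₁^((p-3)/2) g₂^((p+1)/2)`. -/
theorem leadsWith_fourth {m : ℕ} {g₁ g₂ : Polynomial F} {a b : F}
    (h₁ : LeadsWith g₁ a ((2 * m + 3) ^ 2) (2 * m + 3))
    (h₂ : LeadsWith g₂ (a * b) ((2 * m + 3) ^ 2 + 2 * (2 * m + 3)) (2 * m + 3)) :
    LeadsWith (g₁ ^ m * g₂ ^ (m + 2)) (a ^ (2 * m + 2) * b ^ (m + 2))
      ((2 * m + 3) ^ 3 + (2 * m + 3)) (2 * m + 3) := by
  have h := (h₁.pow m).mul (h₂.pow (m + 2))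
  have e1 : a ^ m * (a * b) ^ (m + 2) = a ^ (2 * m + 2) * b ^ (m + 2) := by
    rw [mul_pow, ← mul_assoc, ← pow_add]; congr 2; ring
  have e2 : (2 * m + 3) ^ 2 * m + ((2 * m + 3) ^ 2 + 2 * (2 * m + 3)) * (m + 2) =
    (2 * m + 3) ^ 3 + (2 * m + 3) := by ring
  rwa [e1, e2] at h

/-- The coefficients that make the leading terms of `f̃₃` cancel. -/
theorem coefficient_identities {a b c d h1 h2 h3 ap bp cp dp ep x1237 x1256 x1257 x1356 x1357 : F}
    (ha : a ≠ 0) (hb : b ≠ 0) (m : ℕ)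
    (pl1 : ap * x1237 = bp * h1 + dp * a - cp * b)
    (pl2 : b * h2 - c * h1 = a * x1256)
    (pl3 : ap * x1257 = bp * x1256 + b * ep - c * dp)
    (pl4 : b * h3 - d * h1 = a * x1356)
    (pl5 : ap * x1357 = bp * x1356 - d * dp) {α₂ α₃ α₄ : F} (h₂ : α₂ = a * cp)
    (h₃ : α₃ = ap * a * x1237 / b) (h₄ : α₄ = ap * a ^ 3 * x1257 / b ^ (m + 3)) :
    -(a ^ 2 * ap * cp) + α₂ * ap * a = 0 ∧
    -(a * bp * ap * h1) - a ^ 2 * ap * dp + (α₂ + α₃) * ap * b = 0 ∧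
    -(a * bp * ap * h2) - a ^ 2 * ap * ep + (α₂ + α₃) * ap * c +
      α₄ * (ap / a * b ^ (m + 2)) = 0 ∧
    -(a * bp * ap * h3) + (α₂ + α₃) * ap * d = -(x1357 * (ap * a) ^ 2 / b) := by
  have h23 : (α₂ + α₃) * b = a * bp * h1 + a ^ 2 * dp := by
    rw [h₂, h₃]; field_simp; linear_combination pl1
  refine ⟨by rw [h₂]; ring, by linear_combination ap * h23, ?_, ?_⟩
  · have h4 : α₄ * (ap / a * b ^ (m + 2)) = ap * a ^ 2 * (ap * x1257) / b := by
      rw [h₄]; field_simp; ring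
    rw [h4, eq_div_of_mul_eq hb h23]
    field_simp
    linear_combination ap * a ^ 2 * pl3 - a * bp * ap * pl2
  · rw [eq_div_of_mul_eq hb h23]
    field_simp
    linear_combination ap * a * pl5 - ap * bp * pl4

end OneVariable

/-! ### The cancellation in f̃₃ on the line x = 1, z = 0 -/

section OneVariable

open Polynomial (natDegree)

/-- With Pᵢ = Y^(p^i), the restrictions are f̄₁ = A P₂ + r and f̄₂ = A P₂ r + q, with p-th powers Ap
P₃ + rp and Ap P₃ rp + qp; G₃ and G₄ stand for f̄₁^(p-1) f̄₂ and f̄₁^((p-3)/2) f̄₂^((p+1)/2). The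
multiples of P₃ P₂² and P₃ P₂ r cancel by themselves, and i1, i2, i3 remove P₃ P₂, P₃ P₁², P₃ P₁.
The term P₃ Y² survives with coefficient κ. The parameters t and o accommodate the corrections for p
= 3. -/
theorem tilde_identity {S : Type*} [CommRing S]
    {P₁ P₂ P₃ Y A B C' D E Ap Bp Cp Dp Ep H₁ H₂ H₃ H₄ q qp α₂ α₃ α₄ t o k κ ε₃ ε₄ G₃ G₄ r s rp : S}
    (hr : r = B * P₁ ^ 2 + C' * P₁ + D * Y ^ 2 + E * Y)
    (hs : s = H₁ * P₁ ^ 2 + H₂ * P₁ + H₃ * Y ^ 2 + H₄ * Y)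
    (hrp : rp = Bp * P₂ ^ 2 + Cp * P₂ + Dp * P₁ ^ 2 + Ep * P₁)
    (hq : 2 * q = r ^ 2 + A * s)
    (i1 : -(A ^ 2 * Ap * Cp) + (α₂ - t) * Ap * A = 0)
    (i2 : -(A * Bp * Ap * H₁) - A ^ 2 * Ap * Dp + (α₂ + α₃) * Ap * B = 0)
    (i3 : -(A * Bp * Ap * H₂) - A ^ 2 * Ap * Ep + (α₂ + α₃) * Ap * C' + (α₄ + o * α₃) * k = 0)
    (i4 : -(A * Bp * Ap * H₃) + (α₂ + α₃) * Ap * D = κ)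
    (h3 : G₃ = Ap * P₃ * r + o * k * (P₃ * P₁) + ε₃) (h4 : G₄ = k * (P₃ * P₁) + ε₄) :
    Bp * ((Ap * P₃ + rp) * (A * P₂ + r) ^ 2) - A ^ 2 * (Ap * P₃ * rp + qp) +
      (-2 * Bp) * (Ap * P₃ + rp) * (A * P₂ * r + q) + α₂ * ((Ap * P₃ + rp) * (A * P₂ + r)) +
      α₃ * G₃ + α₄ * G₄ =
    κ * (P₃ * Y ^ 2) + ((-(A * Bp * Ap * H₄) + (α₂ + α₃) * Ap * E) * (P₃ * Y) +
      (A ^ 2 * Bp * P₂ ^ 2 * rp - A ^ 2 * qp + t * A * Ap * (P₃ * P₂)) +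
      (α₂ * rp * (A * P₂ + r) - A * Bp * rp * s) + (α₃ * ε₃ + α₄ * ε₄)) := by
  subst h3 h4
  linear_combination -Bp * (Ap * P₃ + rp) * hq + P₃ * P₂ * i1 + P₃ * P₁ ^ 2 * i2 +
    P₃ * P₁ * i3 + P₃ * Y ^ 2 * i4 + (α₂ + α₃) * Ap * P₃ * hr - A * Bp * Ap * P₃ * hs
    - A ^ 2 * Ap * P₃ * hrp

variable {F : Type*} [Field F] {p : ℕ} [Fact p.Prime] [CharP F p]

theorem quadrinomial_pow (b c d e : F) :
    (Polynomial.C b * Polynomial.X ^ (2 * p) + Polynomial.C c * Polynomial.X ^ p +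
      Polynomial.C d * Polynomial.X ^ 2 + Polynomial.C e * Polynomial.X) ^ p =
    Polynomial.C (b ^ p) * (Polynomial.X ^ p ^ 2) ^ 2 +
      Polynomial.C (c ^ p) * Polynomial.X ^ p ^ 2 +
      Polynomial.C (d ^ p) * (Polynomial.X ^ p) ^ 2 + Polynomial.C (e ^ p) * Polynomial.X ^ p := by
  simp only [add_pow_char, mul_pow, ← Polynomial.C_pow, ← pow_mul]
  ring_nf

theorem natDegree_pow_le' {f : Polynomial F} {n : ℕ} (hf : natDegree f ≤ n) (j : ℕ) :
    natDegree (f ^ j) ≤ j * n :=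
  Polynomial.natDegree_pow_le.trans (Nat.mul_le_mul_left j hf)

theorem natDegree_C_mul_le' {f : Polynomial F} {n : ℕ} (u : F) (hf : natDegree f ≤ n) :
    natDegree (Polynomial.C u * f) ≤ n :=
  (Polynomial.natDegree_C_mul_le u f).trans hf

/-- The image of `f̃₃` on the line `z = 0`, `x = 1`. -/
theorem leadsWith_tilde {m : ℕ} (hpm : p = 2 * m + 3)
    {a b c d e h1 h2 h3 h4 α₂ α₃ α₄ t o κ : F} (ha : a ≠ 0)
    {r s q ε₃ : Polynomial F}
    (hr : r = Polynomial.C b * Polynomial.X ^ (2 * p) + Polynomial.C c * Polynomial.X ^ p +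
      Polynomial.C d * Polynomial.X ^ 2 + Polynomial.C e * Polynomial.X)
    (hs : s = Polynomial.C h1 * Polynomial.X ^ (2 * p) + Polynomial.C h2 * Polynomial.X ^ p +
      Polynomial.C h3 * Polynomial.X ^ 2 + Polynomial.C h4 * Polynomial.X)
    (hq : 2 * q = r ^ 2 + Polynomial.C a * s) (hqd : natDegree q ≤ 4 * p)
    (i1 : -(a ^ 2 * a ^ p * c ^ p) + (α₂ - t) * a ^ p * a = 0)
    (i2 : -(a * b ^ p * a ^ p * h1) - a ^ 2 * a ^ p * d ^ p + (α₂ + α₃) * a ^ p * b = 0)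
    (i3 : -(a * b ^ p * a ^ p * h2) - a ^ 2 * a ^ p * e ^ p + (α₂ + α₃) * a ^ p * c +
      (α₄ + o * α₃) * (a ^ p / a * b ^ (m + 2)) = 0)
    (i4 : -(a * b ^ p * a ^ p * h3) + (α₂ + α₃) * a ^ p * d = κ)
    (h₃ : (Polynomial.C a * Polynomial.X ^ p ^ 2 + r) ^ (p - 1) *
        (Polynomial.C a * Polynomial.X ^ p ^ 2 * r + q) = Polynomial.C (a ^ p) *
        Polynomial.X ^ p ^ 3 * r + Polynomial.C o * Polynomial.C (a ^ p / a * b ^ (m + 2)) *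
          (Polynomial.X ^ p ^ 3 * Polynomial.X ^ p) + ε₃)
    (hε₃ : natDegree ε₃ ≤ p ^ 3 + 1)
    (hε : natDegree (Polynomial.C a ^ 2 * Polynomial.C (b ^ p) * (Polynomial.X ^ p ^ 2) ^ 2 * r ^ p
      - Polynomial.C a ^ 2 * q ^ p + Polynomial.C t * Polynomial.C a * Polynomial.C (a ^ p) *
        (Polynomial.X ^ p ^ 3 * Polynomial.X ^ p ^ 2)) ≤ p ^ 3 + 1) :
    LeadsWith (Polynomial.C (b ^ p) * (Polynomial.C a * Polynomial.X ^ p ^ 2 + r) ^ (p + 2)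
      - Polynomial.C (a ^ 2) * (Polynomial.C a * Polynomial.X ^ p ^ 2 * r + q) ^ p
      + Polynomial.C (-2 * b ^ p) * (Polynomial.C a * Polynomial.X ^ p ^ 2 + r) ^ p *
        (Polynomial.C a * Polynomial.X ^ p ^ 2 * r + q)
      + Polynomial.C α₂ * (Polynomial.C a * Polynomial.X ^ p ^ 2 + r) ^ (p + 1)
      + Polynomial.C α₃ * ((Polynomial.C a * Polynomial.X ^ p ^ 2 + r) ^ (p - 1) *
        (Polynomial.C a * Polynomial.X ^ p ^ 2 * r + q))
      + Polynomial.C α₄ * ((Polynomial.C a * Polynomial.X ^ p ^ 2 + r) ^ m *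
        (Polynomial.C a * Polynomial.X ^ p ^ 2 * r + q) ^ (m + 2))) κ (p ^ 3 + 2) 1 := by
  have hp3 : 3 ≤ p := by omega
  have hpp : 3 * p ≤ p ^ 2 := by rw [sq]; exact Nat.mul_le_mul_right p hp3
  have hppp : 3 * p ^ 2 ≤ p ^ 3 := by rw [pow_succ p 2, mul_comm 3]; exact Nat.mul_le_mul_left _ hp3
  have hrd : natDegree r ≤ 2 * p := hr ▸ quadrinomial_natDegree_le (by omega) b c d e
  have hsd : natDegree s ≤ 2 * p := hs ▸ quadrinomial_natDegree_le (by omega) h1 h2 h3 h4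
  have hrp := quadrinomial_pow (p := p) b c d e
  rw [← hr] at hrp
  have hX : natDegree (Polynomial.X ^ p ^ 2 : Polynomial F) ≤ p ^ 2 :=
    Polynomial.natDegree_X_pow_le _
  obtain ⟨ε₄, h₄, hε₄⟩ : LeadsWith ((Polynomial.C a * Polynomial.X ^ p ^ 2 + r) ^ m *
        (Polynomial.C a * Polynomial.X ^ p ^ 2 * r + q) ^ (m + 2)) (a ^ p / a * b ^ (m + 2))
        (p ^ 3 + p) p := by
    have e1 : a ^ p / a = a ^ (2 * m + 2) := by
      rw [div_eq_iff ha, ← pow_succ, hpm]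
    have l1 := (leadsWith_first hp3 a b c d e).mono (l := p) (by omega)
    have l2 := leadsWith_second hp3 a b c d e q hqd
    rw [← hr] at l1 l2
    rw [e1]
    have := leadsWith_fourth (m := m) (by rw [← hpm]; exact l1) (by rw [← hpm]; exact l2)
    rwa [← hpm] at this
  have hε₄' : natDegree ε₄ ≤ p ^ 3 := by
    rcases hε₄ with rfl | h
    · simp
    · omega
  have cpow : (Polynomial.C a * Polynomial.X ^ p ^ 2 + r) ^ p =
      Polynomial.C (a ^ p) * Polynomial.X ^ p ^ 3 + r ^ p := by
    rw [add_pow_char, mul_pow, ← Polynomial.C_pow, ← pow_mul, ← pow_succ]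
  have cpow2 : (Polynomial.C a * Polynomial.X ^ p ^ 2 * r + q) ^ p =
      Polynomial.C (a ^ p) * Polynomial.X ^ p ^ 3 * r ^ p + q ^ p := by
    rw [add_pow_char, mul_pow, mul_pow, ← Polynomial.C_pow, ← pow_mul, ← pow_succ]
  have hC {x y : F} (h : x = y) : (Polynomial.C x : Polynomial F) = Polynomial.C y := by rw [h]
  have ca2 : Polynomial.C (a ^ 2) = Polynomial.C a ^ 2 := Polynomial.C_pow
  have j1 := hC i1
  have j2 := hC i2
  have j3 := hC i3
  have j4 := hC i4
  simp only [Polynomial.C_add, Polynomial.C_sub, Polynomial.C_neg, Polynomial.C_mul,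
    Polynomial.C_0, ca2] at j1 j2 j3 j4
  rw [Polynomial.C_mul (a := a ^ p / a)] at h₃ h₄
  rw [pow_add _ (p ^ 3) p] at h₄
  have key := tilde_identity (P₁ := Polynomial.X ^ p) (P₂ := Polynomial.X ^ p ^ 2)
    (P₃ := Polynomial.X ^ p ^ 3) (Y := Polynomial.X) (A := Polynomial.C a)
    (B := Polynomial.C b) (C' := Polynomial.C c) (D := Polynomial.C d) (E := Polynomial.C e)
    (H₁ := Polynomial.C h1) (H₂ := Polynomial.C h2) (H₃ := Polynomial.C h3)
    (H₄ := Polynomial.C h4) (qp := q ^ p) (α₂ := Polynomial.C α₂) (α₃ := Polynomial.C α₃)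
    (α₄ := Polynomial.C α₄) (by rw [hr]; ring) (s := s) (by rw [hs]; ring) hrp hq
    j1 j2 j3 j4 h₃ h₄
  have hC2 : Polynomial.C (-2 * b ^ p) = -2 * Polynomial.C (b ^ p) := by
    rw [Polynomial.C_mul, Polynomial.C_neg, map_ofNat]
  rw [pow_add _ p 2, pow_add _ p 1, pow_one, cpow, cpow2, hC2, ca2, key]
  -- All that remains besides κ P₃ Y² has degree at most p³ + 1, the degree of P₃ Y.
  refine ⟨_, by rw [pow_add], .inr ?_⟩
  · have hb1 : natDegree (r ^ p) ≤ 2 * p ^ 2 := by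
      refine (natDegree_pow_le' hrd p).trans (le_of_eq ?_); ring
    have hX3 : natDegree (Polynomial.X ^ p ^ 3 * Polynomial.X : Polynomial F) ≤ p ^ 3 + 1 := by
      rw [← pow_succ]; exact Polynomial.natDegree_X_pow_le _
    have t1 : natDegree ((-(Polynomial.C a * Polynomial.C (b ^ p) * Polynomial.C (a ^ p) *
        Polynomial.C h4) + (Polynomial.C α₂ + Polynomial.C α₃) * Polynomial.C (a ^ p) *
        Polynomial.C e) * (Polynomial.X ^ p ^ 3 * Polynomial.X)) ≤ p ^ 3 + 1 := by
      simp only [← Polynomial.C_mul, ← Polynomial.C_add, ← Polynomial.C_neg]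
      exact natDegree_C_mul_le' _ hX3
    have t2 : natDegree (Polynomial.C α₂ * r ^ p * (Polynomial.C a * Polynomial.X ^ p ^ 2 + r)) ≤
        p ^ 3 + 1 := by
      refine (Polynomial.natDegree_mul_le_of_le (natDegree_C_mul_le' _ hb1)
        (Polynomial.natDegree_add_le_of_degree_le (natDegree_C_mul_le' _ hX)
          (hrd.trans (by omega)))).trans (by omega)
    have t3 : natDegree (Polynomial.C a * Polynomial.C (b ^ p) * r ^ p * s) ≤ p ^ 3 + 1 := by
      rw [← Polynomial.C_mul]
      exact (Polynomial.natDegree_mul_le_of_le (natDegree_C_mul_le' _ hb1) hsd).trans (by omega)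
    have t4 := natDegree_C_mul_le' α₃ hε₃
    have t5 := natDegree_C_mul_le' α₄ (hε₄'.trans (Nat.le_succ _))
    have := Polynomial.natDegree_add_le_of_degree_le (Polynomial.natDegree_add_le_of_degree_le
      (Polynomial.natDegree_add_le_of_degree_le t1 hε)
      ((Polynomial.natDegree_sub_le_of_le t2 t3).trans (max_self _).le))
      (Polynomial.natDegree_add_le_of_degree_le t4 t5)
    omega

end OneVariable

/-! ### Error terms for p ≥ 5 and for p = 3 -/

section OneVariable

open Polynomial (natDegree)

variable {F : Type*} [Field F] {p : ℕ} [Fact p.Prime] [CharP F p]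

omit [Fact p.Prime] [CharP F p] in
/-- For `p ≥ 5` the error terms in `leadsWith_tilde` are negligible. -/
theorem errors_of_five_le (hp : 5 ≤ p) {a : F} {b c d e : F} {r q : Polynomial F}
    (hr : r = Polynomial.C b * Polynomial.X ^ (2 * p) + Polynomial.C c * Polynomial.X ^ p +
      Polynomial.C d * Polynomial.X ^ 2 + Polynomial.C e * Polynomial.X)
    (hqd : natDegree q ≤ 4 * p) :
    (∃ ε : Polynomial F, (Polynomial.C a * Polynomial.X ^ p ^ 2 + r) ^ (p - 1) *
        (Polynomial.C a * Polynomial.X ^ p ^ 2 * r + q) = Polynomial.C (a ^ p) *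
        Polynomial.X ^ p ^ 3 * r + ε ∧ natDegree ε ≤ p ^ 3 + 1) ∧
    natDegree (Polynomial.C a ^ 2 * Polynomial.C (b ^ p) * (Polynomial.X ^ p ^ 2) ^ 2 * r ^ p
      - Polynomial.C a ^ 2 * q ^ p) ≤ p ^ 3 + 1 := by
  -- The errors have degrees at most p³ - p² + 4p and 4p², both below p³ as soon as p ≥ 5.
  have hpp : 5 * p ≤ p ^ 2 := by rw [sq]; exact Nat.mul_le_mul_right p hp
  have hppp : 5 * p ^ 2 ≤ p ^ 3 := by
    rw [pow_succ p 2, mul_comm 5]; exact Nat.mul_le_mul_left _ hp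
  have hrd : natDegree r ≤ 2 * p := hr ▸ quadrinomial_natDegree_le (by omega) b c d e
  have e1 : p ^ 2 * (p - 1) + p ^ 2 = p ^ 3 := by
    rw [← Nat.mul_succ, Nat.succ_eq_add_one, Nat.sub_add_cancel (by omega : 1 ≤ p), ← pow_succ]
  constructor
  · obtain ⟨w, hw, hwd⟩ := (leadsWith_first (p := p) (by omega) a b c d e).pow (p - 1)
    rw [← hr] at hw
    have l2 := (leadsWith_second (by omega : 3 ≤ p) a b c d e q hqd).natDegree_le
    rw [← hr] at l2
    refine ⟨Polynomial.C (a ^ (p - 1)) * (Polynomial.X ^ (p ^ 2 * (p - 1)) * q) +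
      w * (Polynomial.C a * Polynomial.X ^ p ^ 2 * r + q), ?_, ?_⟩
    · have e2 : Polynomial.C (a ^ p) * Polynomial.X ^ p ^ 3 = Polynomial.C (a ^ (p - 1)) *
          Polynomial.X ^ (p ^ 2 * (p - 1)) * (Polynomial.C a * Polynomial.X ^ p ^ 2) := by
        rw [← e1, pow_add]
        have : a ^ p = a ^ (p - 1) * a := by rw [← pow_succ, Nat.sub_add_cancel (by omega : 1 ≤ p)]
        rw [this, Polynomial.C_mul]; ring
      rw [hw, e2]; ring
    · refine Polynomial.natDegree_add_le_of_degree_le (natDegree_C_mul_le' _ ?_) ?_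
      · refine (Polynomial.natDegree_mul_le_of_le (Polynomial.natDegree_X_pow_le _) hqd).trans ?_
        omega
      · rcases hwd with rfl | hwd
        · simp
        · refine (Polynomial.natDegree_mul_le_of_le le_rfl l2).trans ?_
          omega
  · have h1 : natDegree (r ^ p) ≤ 2 * p ^ 2 :=
      (natDegree_pow_le' hrd p).trans (le_of_eq (by ring))
    have h2 : natDegree (q ^ p) ≤ 4 * p ^ 2 :=
      (natDegree_pow_le' hqd p).trans (le_of_eq (by ring))
    have h3 : natDegree ((Polynomial.X ^ p ^ 2) ^ 2 : Polynomial F) ≤ 2 * p ^ 2 :=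
      natDegree_pow_le' (Polynomial.natDegree_X_pow_le _) 2
    rw [← Polynomial.C_pow, ← Polynomial.C_mul]
    refine (Polynomial.natDegree_sub_le_of_le (Polynomial.natDegree_mul_le_of_le
      (natDegree_C_mul_le' _ h3) h1) (natDegree_C_mul_le' _ h2)).trans ?_
    omega

/-- For `p = 3` some error terms are not negligible. -/
theorem errors_of_eq_three [CharP F 3] {a b c d e h1 h2 h3 h4 : F} (ha : a ≠ 0)
    {r s q : Polynomial F}
    (hr : r = Polynomial.C b * Polynomial.X ^ (2 * 3) + Polynomial.C c * Polynomial.X ^ 3 +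
      Polynomial.C d * Polynomial.X ^ 2 + Polynomial.C e * Polynomial.X)
    (hs : s = Polynomial.C h1 * Polynomial.X ^ (2 * 3) + Polynomial.C h2 * Polynomial.X ^ 3 +
      Polynomial.C h3 * Polynomial.X ^ 2 + Polynomial.C h4 * Polynomial.X)
    (hq : 2 * q = r ^ 2 + Polynomial.C a * s) :
    (∃ ε : Polynomial F, (Polynomial.C a * Polynomial.X ^ 3 ^ 2 + r) ^ 2 *
        (Polynomial.C a * Polynomial.X ^ 3 ^ 2 * r + q) = Polynomial.C (a ^ 3) *
        Polynomial.X ^ 3 ^ 3 * r + Polynomial.C (a ^ 2 * b ^ 2) *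
          (Polynomial.X ^ 3 ^ 3 * Polynomial.X ^ 3) + ε ∧ natDegree ε ≤ 3 ^ 3 + 1) ∧
    natDegree (Polynomial.C a ^ 2 * Polynomial.C (b ^ 3) * (Polynomial.X ^ 3 ^ 2) ^ 2 * r ^ 3
      - Polynomial.C a ^ 2 * q ^ 3 + Polynomial.C (b ^ 6 / a ^ 2) * Polynomial.C a *
        Polynomial.C (a ^ 3) * (Polynomial.X ^ 3 ^ 3 * Polynomial.X ^ 3 ^ 2)) ≤ 3 ^ 3 + 1 := by
  have h30 : (3 : Polynomial F) = 0 := by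
    have : ((3 : ℕ) : Polynomial F) = 0 := CharP.cast_eq_zero _ _
    exact_mod_cast this
  have : Fact (Nat.Prime 3) := ⟨Nat.prime_three⟩
  have hrd : natDegree r ≤ 6 := hr ▸ quadrinomial_natDegree_le (by omega : 2 ≤ 3) b c d e
  have hsd : natDegree s ≤ 6 := hs ▸ quadrinomial_natDegree_le (by omega : 2 ≤ 3) h1 h2 h3 h4
  set v := Polynomial.C c * Polynomial.X ^ 3 + Polynomial.C d * Polynomial.X ^ 2 +
    Polynomial.C e * Polynomial.X with hv
  have hvd : natDegree v ≤ 3 := trinomial_natDegree_le (by omega) c d e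
  have hrv : r = Polynomial.C b * Polynomial.X ^ 6 + v := by rw [hr, hv]; ring
  set z := 2 * (Polynomial.C b * (Polynomial.X ^ 6 * v)) + v ^ 2 with hz
  have hzd : natDegree z ≤ 9 := by
    have h5 : natDegree (Polynomial.C b * (Polynomial.X ^ 6 * v)) ≤ 9 :=
      natDegree_C_mul_le' _
          (Polynomial.natDegree_mul_le_of_le (Polynomial.natDegree_X_pow_le _) hvd)
    have h6 : natDegree (v ^ 2) ≤ 9 := (natDegree_pow_le' hvd 2).trans (by omega)
    rw [hz, two_mul]
    exact Polynomial.natDegree_add_le_of_degree_le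
      (Polynomial.natDegree_add_le_of_degree_le h5 h5) h6
  have hr2 : r ^ 2 = Polynomial.C (b ^ 2) * Polynomial.X ^ 12 + z := by
    rw [hrv, hz, Polynomial.C_pow]; ring
  -- In characteristic 3 the scalar 1/2 is -1.
  have hq' : q = -(r ^ 2 + Polynomial.C a * s) := by linear_combination q * h30 - hq
  have hasd : natDegree (Polynomial.C a * s) ≤ 9 := natDegree_C_mul_le' _ (hsd.trans (by omega))
  have hqd : natDegree q ≤ 12 := by
    rw [hq', Polynomial.natDegree_neg]
    exact Polynomial.natDegree_add_le_of_degree_le (natDegree_pow_le' hrd 2)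
      (hasd.trans (by omega))
  have hX (n : ℕ) : natDegree (Polynomial.X ^ n : Polynomial F) ≤ n :=
    Polynomial.natDegree_X_pow_le _
  constructor
  · refine ⟨Polynomial.C (a ^ 2) * (Polynomial.X ^ 18 * (z - Polynomial.C a * s)) +
      Polynomial.C (2 * a) * (Polynomial.X ^ 9 * (r * q)) +
      Polynomial.C a * (Polynomial.X ^ 9 * r ^ 3) + r ^ 2 * q, ?_, ?_⟩
    · simp only [Polynomial.C_mul, Polynomial.C_pow, map_ofNat]
      rw [Polynomial.C_pow] at hr2
      norm_num
      linear_combination (Polynomial.C a ^ 2 * Polynomial.X ^ 18) * hq' +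
        (Polynomial.C a ^ 2 * Polynomial.X ^ 18) * hr2
    · refine Polynomial.natDegree_add_le_of_degree_le (Polynomial.natDegree_add_le_of_degree_le
        (Polynomial.natDegree_add_le_of_degree_le ?_ ?_) ?_) ?_
      · exact natDegree_C_mul_le' _ ((Polynomial.natDegree_mul_le_of_le (hX 18)
          (Polynomial.natDegree_sub_le_of_le hzd hasd)).trans (by norm_num))
      · exact natDegree_C_mul_le' _ ((Polynomial.natDegree_mul_le_of_le (hX 9)
          (Polynomial.natDegree_mul_le_of_le hrd hqd)).trans (by norm_num))
      · exact natDegree_C_mul_le' _ ((Polynomial.natDegree_mul_le_of_le (hX 9)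
          (natDegree_pow_le' hrd 3)).trans (by norm_num))
      · exact (Polynomial.natDegree_mul_le_of_le (natDegree_pow_le' hrd 2) hqd).trans
          (by norm_num)
  · have e1 : Polynomial.C (b ^ 6 / a ^ 2) * Polynomial.C a * Polynomial.C (a ^ 3) =
        Polynomial.C (a ^ 2 * b ^ 6) := by
      rw [← Polynomial.C_mul, ← Polynomial.C_mul]
      congr 1
      field_simp
    have e2 : r ^ 3 = Polynomial.C b ^ 3 * Polynomial.X ^ 18 + v ^ 3 := by
      rw [hrv, add_pow_char]; ring
    have e3 : q ^ 3 = -(Polynomial.C b ^ 6 * Polynomial.X ^ 36 + (z + Polynomial.C a * s) ^ 3) := by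
      rw [hq', hr2, add_assoc, Odd.neg_pow (by decide), add_pow_char, Polynomial.C_pow]; ring
    -- The three top terms, coming from r³, from q³ and from the correction b⁶/a², all equal
    -- a²b⁶Y^36, so their sum is zero in characteristic 3.
    have e4 : Polynomial.C a ^ 2 * Polynomial.C (b ^ 3) * (Polynomial.X ^ 3 ^ 2) ^ 2 * r ^ 3
      - Polynomial.C a ^ 2 * q ^ 3 + Polynomial.C (b ^ 6 / a ^ 2) * Polynomial.C a *
        Polynomial.C (a ^ 3) * (Polynomial.X ^ 3 ^ 3 * Polynomial.X ^ 3 ^ 2) =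
        Polynomial.C (a ^ 2 * b ^ 3) * (Polynomial.X ^ 18 * v ^ 3) +
        Polynomial.C (a ^ 2) * (z + Polynomial.C a * s) ^ 3 := by
      rw [e1, e2, e3]
      simp only [Polynomial.C_mul, Polynomial.C_pow]
      linear_combination Polynomial.C a ^ 2 * Polynomial.C b ^ 6 * Polynomial.X ^ 36 * h30
    rw [e4]
    refine Polynomial.natDegree_add_le_of_degree_le ?_ ?_
    · exact natDegree_C_mul_le' _ ((Polynomial.natDegree_mul_le_of_le (hX 18)
          (natDegree_pow_le' hvd 3)).trans (by norm_num))
    · exact natDegree_C_mul_le' _ ((natDegree_pow_le'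
          (Polynomial.natDegree_add_le_of_degree_le hzd hasd) 3).trans (by norm_num))

end OneVariable

/-! ### Permuted and repeated rows in the minors -/

section Pluecker

variable {F : Type*} [Field F] {p : ℕ} (M : Matrix (Fin 2) (Fin 4) F)

theorem gam_swap (i j k l : ℕ) : gam p M ![i, j, l, k] = -gam p M ![i, j, k, l] := by
  rw [gam_expand, gam_expand, det_four, det_four]; ring

theorem gam_swap' (i j k l : ℕ) : gam p M ![i, k, j, l] = -gam p M ![i, j, k, l] := by
  rw [gam_expand, gam_expand, det_four, det_four]; ring

theorem gam_eq_zero (i j k : ℕ) : gam p M ![i, j, k, k] = 0 := by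
  rw [gam_expand, det_four]; ring

theorem gam_eq_zero' (i j k : ℕ) : gam p M ![i, j, k, j] = 0 := by
  rw [gam_expand, det_four]; ring

theorem gam_eq_zero'' (i j k : ℕ) : gam p M ![i, j, k, i] = 0 := by
  rw [gam_expand, det_four]; ring

theorem gam_pluecker (i j k v₀ v₁ v₂ v₃ v₄ : ℕ) :
    gam p M ![i, j, k, v₀] * gam p M ![v₁, v₂, v₃, v₄]
    - gam p M ![i, j, k, v₁] * gam p M ![v₀, v₂, v₃, v₄]
    + gam p M ![i, j, k, v₂] * gam p M ![v₀, v₁, v₃, v₄]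
    - gam p M ![i, j, k, v₃] * gam p M ![v₀, v₁, v₂, v₄]
    + gam p M ![i, j, k, v₄] * gam p M ![v₀, v₁, v₂, v₃] = 0 := by
  simp only [gam_expand]
  exact pluecker _ _ _ _ _ _ _ _

end Pluecker

/-! ### The invariants f̄₁ and f̄₂ -/

section Generators

variable {F : Type*} [Field F] {p : ℕ} [Fact p.Prime] [CharP F p]
  {M : Matrix (Fin 2) (Fin 4) F}

omit [CharP F p] in
theorem three_le_of_ne_two (hp : p ≠ 2) : 3 ≤ p := by
  have := (Fact.out : p.Prime).two_le
  omega

omit [CharP F p] in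
theorem exists_eq_two_mul_add_three (hp : p ≠ 2) : ∃ m, p = 2 * m + 3 := by
  obtain ⟨k, hk⟩ := (Fact.out : p.Prime).odd_of_ne_two hp
  have := three_le_of_ne_two hp
  exact ⟨k - 1, by omega⟩

omit [CharP F p] in
theorem pow_inequalities (hp : p ≠ 2) : 3 * p ≤ p ^ 2 ∧ 3 * p ^ 2 ≤ p ^ 3 ∧ 3 * p ^ 3 ≤ p ^ 4 := by
  have h3 := three_le_of_ne_two hp
  refine ⟨?_, ?_, ?_⟩
  · rw [sq]; exact Nat.mul_le_mul_right p h3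
  · rw [pow_succ p 2, mul_comm 3]; exact Nat.mul_le_mul_left _ h3
  · rw [pow_succ p 3, mul_comm 3]; exact Nat.mul_le_mul_left _ h3

theorem two_ne_zero_of_ne_two (hp : p ≠ 2) : (2 : F) ≠ 0 := by
  intro h
  have : (p : ℕ) ∣ 2 := (CharP.cast_eq_zero_iff F p 2).mp (by exact_mod_cast h)
  exact hp ((Nat.prime_dvd_prime_iff_eq Fact.out Nat.prime_two).mp this)

/-- An invariant of degree less than `p⁴` is divisible by the power of `x` in its lead monomial. -/
theorem divMonomial_of_leadsWith (hp : p ≠ 2) (h1357 : gam p M ![1, 3, 5, 7] ≠ 0)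
    {f : MvPolynomial (Fin 3) F} (hf : f ∈ invariants p M) {k n l : ℕ} {u : F}
    (hd : f.IsHomogeneous (k + n)) (hdp : k + n < p ^ 4) (hu : u ≠ 0) (hl : 0 < l)
    (h : LeadsWith (evY F f) u n l) :
    ∃ g, f = X 2 ^ k * g ∧ f.divMonomial (Finsupp.single 2 k) = g ∧ g ∈ invariants p M ∧
      g.IsHomogeneous n ∧ g ≠ 0 ∧ grevlex.degree g = Finsupp.single 1 n ∧
      grevlex.leadingCoeff g = u ∧ evY F g = evY F f := by
  obtain ⟨e1, e2⟩ := h.natDegree_eq hl hu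
  have hf0 : f ≠ 0 := by
    rintro rfl
    rw [map_zero, Polynomial.leadingCoeff_zero] at e2
    exact hu e2.symm
  obtain ⟨k', g, h1, h2, h3, h4, -, h6, h7⟩ :=
    exists_eq_X_pow_mul hp h1357 _ f hf hd hdp hf0
  rw [e1] at h1 h4 h6
  rw [e2] at h7
  obtain rfl : k = k' := by omega
  have hX : (X 2 ^ k : MvPolynomial (Fin 3) F) = monomial (Finsupp.single 2 k) 1 :=
    X_pow_eq_monomial
  refine ⟨g, h2, ?_, h3, h4, ?_, h6, h7, ?_⟩
  · rw [h2, hX, divMonomial_monomial_mul]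
  · rintro rfl
    exact hf0 (by rw [h2, mul_zero])
  · rw [h2, map_mul, map_pow, evY_X_two, one_pow, one_mul]

omit [Fact p.Prime] [CharP F p] in
theorem evY_neg_delta : evY F (-delta F) = -Polynomial.X ^ 2 := by
  simp [evY, delta]

omit [Fact p.Prime] [CharP F p] in
theorem evY_neg_delta_pow {n : ℕ} (hn : Odd n) :
    evY F ((-delta F) ^ n) = -Polynomial.X ^ (2 * n) := by
  rw [map_pow, evY_neg_delta, hn.neg_pow, pow_mul]

omit [CharP F p] in
theorem evY_f₁ (hp : p ≠ 2) : evY F (f₁ p M) =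
    Polynomial.C (gam p M ![1, 2, 3, 4]) * Polynomial.X ^ p ^ 2 +
      (Polynomial.C (gam p M ![1, 2, 3, 5]) * Polynomial.X ^ (2 * p) +
      Polynomial.C (gam p M ![1, 2, 4, 5]) * Polynomial.X ^ p +
      Polynomial.C (gam p M ![1, 3, 4, 5]) * Polynomial.X ^ 2 +
      Polynomial.C (gam p M ![2, 3, 4, 5]) * Polynomial.X) := by
  have hodd := (Fact.out : p.Prime).odd_of_ne_two hp
  have h1 : evY F (X 1) = Polynomial.X := by simp [evY]
  have hC (x : F) : evY F (C x) = Polynomial.C x := (evY F).commutes x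
  rw [f₁_eq M hp]
  simp only [map_add, map_sub, map_mul]
  rw [evY_neg_delta_pow hodd]
  simp only [map_pow, evY_neg_delta, evY_X_two, h1, hC, one_pow]
  ring

omit [CharP F p] in
theorem evY_f₆ (hp : p ≠ 2) : evY F (fMinor p M ![1, 2, 3, 4, 6]) =
    -(Polynomial.C (gam p M ![1, 2, 3, 4]) * (Polynomial.X ^ p ^ 2) ^ 2) +
      (Polynomial.C (gam p M ![1, 2, 3, 6]) * Polynomial.X ^ (2 * p) +
      Polynomial.C (gam p M ![1, 2, 4, 6]) * Polynomial.X ^ p +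
      Polynomial.C (gam p M ![1, 3, 4, 6]) * Polynomial.X ^ 2 +
      Polynomial.C (gam p M ![2, 3, 4, 6]) * Polynomial.X) := by
  have hodd := (Fact.out : p.Prime).odd_of_ne_two hp
  have h1 : evY F (X 1) = Polynomial.X := by simp [evY]
  have hC (x : F) : evY F (C x) = Polynomial.C x := (evY F).commutes x
  rw [f₆_eq M hp]
  simp only [map_add, map_sub, map_mul]
  rw [evY_neg_delta_pow hodd, evY_neg_delta_pow hodd.pow]
  simp only [map_pow, evY_neg_delta, evY_X_two, h1, hC, one_pow]
  ring

theorem C_two_mul_C_inv (hp : p ≠ 2) (f : Polynomial F) :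
    2 * (Polynomial.C (2⁻¹ : F) * f) = f := by
  rw [← mul_assoc, ← map_ofNat Polynomial.C, ← Polynomial.C_mul,
    mul_inv_cancel₀ (two_ne_zero_of_ne_two (p := p) hp), Polynomial.C_1, one_mul]

/-- The restriction of the remainder `f₂ - y^(p²) (f₁ - y^(p²))` to the line `z = 0`, `x = 1`. -/
noncomputable def remY (p : ℕ) (M : Matrix (Fin 2) (Fin 4) F) : Polynomial F :=
  Polynomial.C 2⁻¹ * ((Polynomial.C (gam p M ![1, 2, 3, 5]) * Polynomial.X ^ (2 * p) +
      Polynomial.C (gam p M ![1, 2, 4, 5]) * Polynomial.X ^ p +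
      Polynomial.C (gam p M ![1, 3, 4, 5]) * Polynomial.X ^ 2 +
      Polynomial.C (gam p M ![2, 3, 4, 5]) * Polynomial.X) ^ 2 +
    Polynomial.C (gam p M ![1, 2, 3, 4]) *
      (Polynomial.C (gam p M ![1, 2, 3, 6]) * Polynomial.X ^ (2 * p) +
      Polynomial.C (gam p M ![1, 2, 4, 6]) * Polynomial.X ^ p +
      Polynomial.C (gam p M ![1, 3, 4, 6]) * Polynomial.X ^ 2 +
      Polynomial.C (gam p M ![2, 3, 4, 6]) * Polynomial.X))

omit [CharP F p] in
theorem remY_natDegree_le : (remY p M).natDegree ≤ 4 * p := by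
  have h2 := (Fact.out : p.Prime).two_le
  refine natDegree_C_mul_le' _ (Polynomial.natDegree_add_le_of_degree_le ?_
    (natDegree_C_mul_le' _ ((quadrinomial_natDegree_le h2 _ _ _ _).trans (by omega))))
  exact (natDegree_pow_le' (quadrinomial_natDegree_le h2 _ _ _ _) 2).trans (by omega)

theorem f₁_properties (hp : p ≠ 2) (h1234 : gam p M ![1, 2, 3, 4] ≠ 0)
    (h1357 : gam p M ![1, 3, 5, 7] ≠ 0) :
    f₁ p M ∈ invariants p M ∧ (f₁ p M).IsHomogeneous (p ^ 2) ∧ f₁ p M ≠ 0 ∧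
      grevlex.degree (f₁ p M) = Finsupp.single 1 (p ^ 2) ∧
      grevlex.leadingCoeff (f₁ p M) = gam p M ![1, 2, 3, 4] := by
  obtain ⟨i1, i2, i3⟩ := pow_inequalities (p := p) hp
  have h3 := three_le_of_ne_two (p := p) hp
  have hA : f₁ p M ∈ invariants p M := fMinor_mem_invariants M _
  have hh := f₁_isHomogeneous M hp
  have hl : LeadsWith (evY F (f₁ p M)) (gam p M ![1, 2, 3, 4]) (p ^ 2) (p ^ 2 - 2 * p) := by
    rw [evY_f₁ hp]; exact leadsWith_first h3 _ _ _ _ _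
  obtain ⟨g, e1, -, -, -, e2, e3, e4, -⟩ := divMonomial_of_leadsWith hp h1357 hA (k := 0)
    (by rwa [zero_add]) (by omega) h1234 (by omega) hl
  rw [pow_zero, one_mul] at e1
  subst e1
  exact ⟨hA, hh, e2, e3, e4⟩

/-- On the line x = 1, z = 0 the two minors are aY^(p²) + r and -aY^(2p²) + s, so the squares cancel
and f̄₁² + a f̄₁₂₃₄₆ becomes 2aY^(p²) r + r² + a s, of degree p² + 2p. As the total degree is 2p² <
p⁴, the difference p² - 2p is the exponent of the factor x. -/
theorem f₂_properties (hp : p ≠ 2) (h1234 : gam p M ![1, 2, 3, 4] ≠ 0)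
    (h1235 : gam p M ![1, 2, 3, 5] ≠ 0) (h1357 : gam p M ![1, 3, 5, 7] ≠ 0) :
    2 * X 2 ^ (p ^ 2 - 2 * p) * f₂ p M =
      f₁ p M ^ 2 + C (gam p M ![1, 2, 3, 4]) * fMinor p M ![1, 2, 3, 4, 6] ∧
    f₂ p M ∈ invariants p M ∧ (f₂ p M).IsHomogeneous (p ^ 2 + 2 * p) ∧ f₂ p M ≠ 0 ∧
      grevlex.degree (f₂ p M) = Finsupp.single 1 (p ^ 2 + 2 * p) ∧
      grevlex.leadingCoeff (f₂ p M) = gam p M ![1, 2, 3, 4] * gam p M ![1, 2, 3, 5] ∧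
      evY F (f₂ p M) = Polynomial.C (gam p M ![1, 2, 3, 4]) * Polynomial.X ^ p ^ 2 *
      (Polynomial.C (gam p M ![1, 2, 3, 5]) * Polynomial.X ^ (2 * p) +
      Polynomial.C (gam p M ![1, 2, 4, 5]) * Polynomial.X ^ p +
      Polynomial.C (gam p M ![1, 3, 4, 5]) * Polynomial.X ^ 2 +
      Polynomial.C (gam p M ![2, 3, 4, 5]) * Polynomial.X) + remY p M := by
  obtain ⟨i1, i2, i3⟩ := pow_inequalities (p := p) hp
  have h3 := three_le_of_ne_two (p := p) hp
  have h2 : (2 : F) ≠ 0 := two_ne_zero_of_ne_two (p := p) hp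
  have hC2 : C (2⁻¹ : F) * (2 : MvPolynomial (Fin 3) F) = 1 := by
    rw [← map_ofNat C, ← C_mul, inv_mul_cancel₀ h2, C_1]
  set G := f₁ p M ^ 2 + C (gam p M ![1, 2, 3, 4]) * fMinor p M ![1, 2, 3, 4, 6] with hG
  have hGA : G ∈ invariants p M :=
    add_mem (pow_mem (fMinor_mem_invariants M _) 2)
      (mul_mem ((invariants p M).algebraMap_mem _) (fMinor_mem_invariants M _))
  have hGh : G.IsHomogeneous (p ^ 2 - 2 * p + (p ^ 2 + 2 * p)) := by
    rw [show p ^ 2 - 2 * p + (p ^ 2 + 2 * p) = 2 * p ^ 2 by omega]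
    refine IsHomogeneous.add ?_ ((f₆_isHomogeneous M hp).C_mul _)
    rw [mul_comm]; exact (f₁_isHomogeneous M hp).pow 2
  have hev : evY F G = 2 * (Polynomial.C (gam p M ![1, 2, 3, 4]) * Polynomial.X ^ p ^ 2 *
      (Polynomial.C (gam p M ![1, 2, 3, 5]) * Polynomial.X ^ (2 * p) +
      Polynomial.C (gam p M ![1, 2, 4, 5]) * Polynomial.X ^ p +
      Polynomial.C (gam p M ![1, 3, 4, 5]) * Polynomial.X ^ 2 +
      Polynomial.C (gam p M ![2, 3, 4, 5]) * Polynomial.X) + remY p M) := by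
    rw [mul_add 2, remY, C_two_mul_C_inv (p := p) hp, hG, map_add, map_pow, map_mul, evY_f₁ hp,
      evY_f₆ hp, show evY F (C (gam p M ![1, 2, 3, 4])) = Polynomial.C (gam p M ![1, 2, 3, 4]) from
        (evY F).commutes _]
    ring
  have hl : LeadsWith (evY F G) (2 * (gam p M ![1, 2, 3, 4] * gam p M ![1, 2, 3, 5]))
      (p ^ 2 + 2 * p) p := by
    have l1 := leadsWith_second h3 (gam p M ![1, 2, 3, 4]) (gam p M ![1, 2, 3, 5])
      (gam p M ![1, 2, 4, 5]) (gam p M ![1, 3, 4, 5]) (gam p M ![2, 3, 4, 5]) (remY p M)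
      remY_natDegree_le
    have l2 : LeadsWith (2 : Polynomial F) 2 0 p :=
      ⟨0, by rw [map_ofNat]; simp, .inl rfl⟩
    have := l2.mul l1
    rwa [zero_add, ← hev] at this
  obtain ⟨g, e1, e2, e3, e4, e5, e6, e7, e8⟩ := divMonomial_of_leadsWith hp h1357 hGA
    hGh (by omega) (mul_ne_zero h2 (mul_ne_zero h1234 h1235)) (by omega) hl
  have hf : f₂ p M = C 2⁻¹ * g := by rw [f₂, ← hG, e2]
  have hi : (2⁻¹ : F) ≠ 0 := inv_ne_zero h2
  refine ⟨?_, ?_, ?_, ?_, ?_, ?_, ?_⟩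
  · rw [hf, e1]
    linear_combination X 2 ^ (p ^ 2 - 2 * p) * g * hC2
  · rw [hf]; exact mul_mem ((invariants p M).algebraMap_mem _) e3
  · rw [hf]; exact e4.C_mul _
  · rw [hf]; exact mul_ne_zero (C_ne_zero.mpr hi) e5
  · rw [hf, degree_C_mul hi, e6]
  · rw [hf, leadingCoeff_C_mul, e7, inv_mul_cancel_left₀ h2]
  · rw [hf, map_mul, e8, hev, show evY F (C 2⁻¹) = Polynomial.C 2⁻¹ from (evY F).commutes _,
      mul_left_comm, C_two_mul_C_inv (p := p) hp]

omit [Fact p.Prime] [CharP F p] in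
-- In each relation the three fixed rows meet the five others in one or two rows, and the terms with
-- a repeated row drop out. The minors on rows from 3, …, 7 other than γ₃₄₅₆ and its companions
-- never occur: those that do are p-th powers of minors on rows 1, …, 5.
theorem pluecker_identities :
    gam p M ![3, 4, 5, 6] * gam p M ![1, 2, 3, 7] = gam p M ![3, 4, 5, 7] * gam p M ![1, 2, 3, 6]
      + gam p M ![3, 5, 6, 7] * gam p M ![1, 2, 3, 4]
      - gam p M ![3, 4, 6, 7] * gam p M ![1, 2, 3, 5] ∧
    gam p M ![1, 2, 3, 5] * gam p M ![1, 2, 4, 6] - gam p M ![1, 2, 4, 5] * gam p M ![1, 2, 3, 6] =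
      gam p M ![1, 2, 3, 4] * gam p M ![1, 2, 5, 6] ∧
    gam p M ![3, 4, 5, 6] * gam p M ![1, 2, 5, 7] = gam p M ![3, 4, 5, 7] * gam p M ![1, 2, 5, 6]
      + gam p M ![1, 2, 3, 5] * gam p M ![4, 5, 6, 7]
      - gam p M ![1, 2, 4, 5] * gam p M ![3, 5, 6, 7] ∧
    gam p M ![1, 2, 3, 5] * gam p M ![1, 3, 4, 6] - gam p M ![1, 3, 4, 5] * gam p M ![1, 2, 3, 6] =
      gam p M ![1, 2, 3, 4] * gam p M ![1, 3, 5, 6] ∧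
    gam p M ![3, 4, 5, 6] * gam p M ![1, 3, 5, 7] = gam p M ![3, 4, 5, 7] * gam p M ![1, 3, 5, 6]
      - gam p M ![1, 3, 4, 5] * gam p M ![3, 5, 6, 7] := by
  refine ⟨?_, ?_, ?_, ?_, ?_⟩
  · have := gam_pluecker (p := p) M 1 2 3 3 4 5 6 7
    rw [gam_eq_zero] at this
    linear_combination this
  · have := gam_pluecker (p := p) M 1 2 3 1 2 4 5 6
    rw [gam_eq_zero', gam_eq_zero''] at this
    linear_combination -this
  · have := gam_pluecker (p := p) M 1 2 5 3 4 5 6 7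
    rw [gam_eq_zero, gam_swap M 1 2 3 5, gam_swap M 1 2 4 5] at this
    linear_combination this
  · have := gam_pluecker (p := p) M 1 3 2 1 3 4 5 6
    rw [gam_eq_zero', gam_eq_zero'', gam_swap' M 1 2 3, gam_swap' M 1 2 3,
      gam_swap' M 1 2 3] at this
    linear_combination this
  · have := gam_pluecker (p := p) M 1 3 5 3 4 5 6 7
    rw [gam_eq_zero, gam_eq_zero', gam_swap M 1 3 4 5] at this
    linear_combination this

end Generators

/-! ### The invariant f̄₃ -/

section Generators

variable {F : Type*} [Field F] {p : ℕ} [Fact p.Prime] [CharP F p]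
  {M : Matrix (Fin 2) (Fin 4) F}

/-- The terms of degrees p³ + p², p³ + 2p and p³ + p are removed by the choice of α₂, α₃ and α₄. The
Plücker relations then collapse the coefficient of Y^(p³+2) to a multiple of γ₁₃₅₇. -/
theorem evY_f₃Tilde (hp : p ≠ 2) (h1234 : gam p M ![1, 2, 3, 4] ≠ 0)
    (h1235 : gam p M ![1, 2, 3, 5] ≠ 0) (h1357 : gam p M ![1, 3, 5, 7] ≠ 0) :
    LeadsWith (evY F (f₃Tilde p M)) (-(gam p M ![1, 3, 5, 7] *
      (gam p M ![1, 2, 3, 4] ^ p * gam p M ![1, 2, 3, 4]) ^ 2 / gam p M ![1, 2, 3, 5]))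
      (p ^ 3 + 2) 1 := by
  obtain ⟨m, hpm⟩ := exists_eq_two_mul_add_three (p := p) hp
  obtain ⟨pl1, pl2, pl3, pl4, pl5⟩ := pluecker_identities (p := p) (M := M)
  have ga := gam_pow (p := p) M 0 1 2 3
  have gb := gam_pow (p := p) M 0 1 2 4
  have gc := gam_pow (p := p) M 0 1 3 4
  have gd := gam_pow (p := p) M 0 2 3 4
  have ge := gam_pow (p := p) M 1 2 3 4
  norm_num at ga gb gc gd ge
  rw [← ga] at pl1 pl3 pl5
  rw [← gb] at pl1 pl3 pl5
  rw [← gd] at pl1 pl3 pl5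
  rw [← gc] at pl1
  rw [← ge] at pl3
  set a := gam p M ![1, 2, 3, 4] with ha
  set b := gam p M ![1, 2, 3, 5] with hb
  set c := gam p M ![1, 2, 4, 5] with hc
  set d := gam p M ![1, 3, 4, 5] with hd
  set e := gam p M ![2, 3, 4, 5] with he
  -- Taking t and o into account turns α₂, α₃, α₄ into the expressions for p ≥ 5, so that
  -- `coefficient_identities` applies uniformly.
  set t : F := if p = 3 then b ^ 6 / a ^ 2 else 0 with ht
  set o : F := if p = 3 then 1 else 0 with ho
  have hm3 : (p + 3) / 2 = m + 3 := by omega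
  have hm1 : (p - 3) / 2 = m := by omega
  have hm2 : (p + 1) / 2 = m + 2 := by omega
  have k₂ : alpha₂ p M - t = a * c ^ p := by rw [alpha₂, ← ht]; ring
  have k₃ : alpha₃ p M + t = a ^ p * a * gam p M ![1, 2, 3, 7] / b := by
    rw [alpha₃, ← ht]; ring
  have k₄ : alpha₄ p M + o * alpha₃ p M =
      a ^ p * a ^ 3 * gam p M ![1, 2, 5, 7] / b ^ (m + 3) := by
    rw [alpha₄, ho, hm3]
    split_ifs <;> ring
  obtain ⟨i1, i2, i3, i4⟩ := coefficient_identities h1234 h1235 m pl1 pl2 pl3 pl4 pl5 k₂ k₃ k₄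
  have hsum : alpha₂ p M - t + (alpha₃ p M + t) = alpha₂ p M + alpha₃ p M := by ring
  rw [hsum] at i2 i3 i4
  have hq : 2 * remY p M = _ := C_two_mul_C_inv (p := p) hp _
  have hqd := remY_natDegree_le (p := p) (M := M)
  obtain ⟨-, -, -, -, -, -, hf₂⟩ := f₂_properties hp h1234 h1235 h1357
  have hC (x : F) : evY F (C x) = Polynomial.C x := (evY F).commutes x
  have hev : evY F (f₃Tilde p M) = Polynomial.C (b ^ p) * evY F (f₁ p M) ^ (p + 2)
      - Polynomial.C (a ^ 2) * evY F (f₂ p M) ^ p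
      + Polynomial.C (-2 * b ^ p) * evY F (f₁ p M) ^ p * evY F (f₂ p M)
      + Polynomial.C (alpha₂ p M) * evY F (f₁ p M) ^ (p + 1)
      + Polynomial.C (alpha₃ p M) * (evY F (f₁ p M) ^ (p - 1) * evY F (f₂ p M))
      + Polynomial.C (alpha₄ p M) * (evY F (f₁ p M) ^ m * evY F (f₂ p M) ^ (m + 2)) := by
    rw [f₃Tilde, hm1, hm2]
    simp only [map_add, map_sub, map_mul (evY F), map_pow (evY F), evY_X_two, hC, one_pow]
    ring
  rw [hev, evY_f₁ hp, hf₂]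
  have three_le := three_le_of_ne_two (p := p) hp
  by_cases h5 : 5 ≤ p
  · have ht0 : t = 0 := if_neg (by omega)
    have ho0 : o = 0 := if_neg (by omega)
    obtain ⟨⟨ε, h₃, hε₃⟩, hε⟩ := errors_of_five_le h5 (a := a) (b := b) (c := c) (d := d) (e := e)
      rfl hqd
    refine leadsWith_tilde hpm h1234 rfl rfl hq hqd i1 i2 i3 i4 (ε₃ := ε) ?_ hε₃ ?_
    · rw [ho0, Polynomial.C_0, zero_mul, zero_mul, add_zero]; exact h₃
    · rw [ht0, Polynomial.C_0, zero_mul, zero_mul, zero_mul, add_zero]; exact hε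
  · obtain rfl : p = 3 := by omega
    obtain rfl : m = 0 := by omega
    have ht3 : t = b ^ 6 / a ^ 2 := if_pos rfl
    have ho3 : o = 1 := if_pos rfl
    obtain ⟨⟨ε, h₃, hε₃⟩, hε⟩ := errors_of_eq_three h1234 (b := b) (c := c) (d := d) (e := e)
      rfl rfl hq
    refine leadsWith_tilde hpm h1234 rfl rfl hq hqd i1 i2 i3 i4 (ε₃ := ε) ?_ hε₃ ?_
    · have : a ^ 3 / a * b ^ (0 + 2) = a ^ 2 * b ^ 2 := by field_simp
      rw [ho3, this, Polynomial.C_1, one_mul]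
      exact h₃
    · rw [ht3]; exact hε

omit [CharP F p] in
theorem f₃Tilde_isHomogeneous (hp : p ≠ 2) (hf₂ : (f₂ p M).IsHomogeneous (p ^ 2 + 2 * p)) :
    (f₃Tilde p M).IsHomogeneous (p ^ 3 + 2 * p ^ 2) := by
  obtain ⟨m, hpm⟩ := exists_eq_two_mul_add_three (p := p) hp
  obtain ⟨i1, i2, i3⟩ := pow_inequalities (p := p) hp
  have hf₁ := f₁_isHomogeneous M hp
  have hm1 : (p - 3) / 2 = m := by omega
  have hm2 : (p + 1) / 2 = m + 2 := by omega
  have hX (n : ℕ) : (X 2 ^ n : MvPolynomial (Fin 3) F).IsHomogeneous n := isHomogeneous_X_pow _ _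
  have key {f : MvPolynomial (Fin 3) F} {n n' : ℕ} (hf : f.IsHomogeneous n) (h : n = n') :
    f.IsHomogeneous n' := h ▸ hf
  rw [f₃Tilde, hm1, hm2]
  have e3 : p ^ 3 = p ^ 2 * p := by ring
  have e2 : p ^ 2 * (p - 1) + p ^ 2 = p ^ 3 := by
    rw [← Nat.mul_succ, Nat.succ_eq_add_one, Nat.sub_add_cancel (by omega), ← pow_succ]
  have e1 : 2 * p ^ 2 - p + p = 2 * p ^ 2 := by omega
  refine IsHomogeneous.add (IsHomogeneous.add (IsHomogeneous.add (IsHomogeneous.add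
    (IsHomogeneous.sub ?_ ?_) ?_) ?_) ?_) ?_
  · exact key ((hf₁.pow _).C_mul _) (by ring)
  · exact key ((hf₂.pow _).C_mul _) (by ring)
  · exact key ((((hX _).C_mul _).mul (hf₁.pow _)).mul hf₂) (by omega)
  · exact key (((hX _).C_mul _).mul (hf₁.pow _)) (by rw [e3]; ring)
  · exact key ((((hX _).C_mul _).mul (hf₁.pow _)).mul hf₂) (by omega)
  · refine key ((((hX _).C_mul _).mul (hf₁.pow _)).mul (hf₂.pow _)) ?_
    have : p ^ 3 + 2 * p ^ 2 = 2 * p ^ 2 - p + (p + p ^ 3) := by omega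
    rw [this, add_assoc]
    congr 1
    rw [hpm]; ring

/-- The total degree p³ + 2p² of f̃₃ exceeds the degree p³ + 2 of its restriction by 2p² - 2, which
is the exponent of the factor x. The scalar in the definition of f̄₃ normalizes the leading
coefficient to γ₁₃₅₇. -/
theorem f₃_properties (hp : p ≠ 2) (h1234 : gam p M ![1, 2, 3, 4] ≠ 0)
    (h1235 : gam p M ![1, 2, 3, 5] ≠ 0) (h1357 : gam p M ![1, 3, 5, 7] ≠ 0) :
    C (gam p M ![1, 2, 3, 4] ^ (2 * p + 2)) * X 2 ^ (2 * p ^ 2 - 2) * f₃ p M =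
      -(C (gam p M ![1, 2, 3, 5]) * f₃Tilde p M) ∧
    f₃ p M ∈ invariants p M ∧ (f₃ p M).IsHomogeneous (p ^ 3 + 2) ∧ f₃ p M ≠ 0 ∧
      grevlex.degree (f₃ p M) = Finsupp.single 1 (p ^ 3 + 2) ∧
      grevlex.leadingCoeff (f₃ p M) = gam p M ![1, 3, 5, 7] := by
  obtain ⟨i1, i2, i3⟩ := pow_inequalities (p := p) hp
  have h3 := three_le_of_ne_two (p := p) hp
  obtain ⟨-, hA₂, hh₂, -, -, -, -⟩ := f₂_properties hp h1234 h1235 h1357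
  have hl := evY_f₃Tilde hp h1234 h1235 h1357
  have hh := f₃Tilde_isHomogeneous hp hh₂
  have hA : f₃Tilde p M ∈ invariants p M := by
    have hC (x : F) : C x ∈ invariants p M := (invariants p M).algebraMap_mem _
    have hX (n : ℕ) : X 2 ^ n ∈ invariants p M := pow_mem X_two_mem_invariants _
    have hA₁' : f₁ p M ∈ invariants p M := fMinor_mem_invariants M _
    exact add_mem (add_mem (add_mem (add_mem (sub_mem
      (mul_mem (hC _) (pow_mem hA₁' _)) (mul_mem (hC _) (pow_mem hA₂ _)))
      (mul_mem (mul_mem (mul_mem (hC _) (hX _)) (pow_mem hA₁' _)) hA₂))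
      (mul_mem (mul_mem (hC _) (hX _)) (pow_mem hA₁' _)))
      (mul_mem (mul_mem (mul_mem (hC _) (hX _)) (pow_mem hA₁' _)) hA₂))
      (mul_mem (mul_mem (mul_mem (hC _) (hX _)) (pow_mem hA₁' _)) (pow_mem hA₂ _))
  set a := gam p M ![1, 2, 3, 4] with ha
  set b := gam p M ![1, 2, 3, 5] with hb
  obtain ⟨g, e1, e2, e3, e4, e5, e6, e7, -⟩ := divMonomial_of_leadsWith hp h1357 hA
    (k := 2 * p ^ 2 - 2) (n := p ^ 3 + 2)
    (by rwa [show 2 * p ^ 2 - 2 + (p ^ 3 + 2) = p ^ 3 + 2 * p ^ 2 by omega]) (by omega)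
    (neg_ne_zero.mpr (div_ne_zero (mul_ne_zero h1357 (pow_ne_zero _
      (mul_ne_zero (pow_ne_zero _ h1234) h1234))) h1235)) one_pos hl
  have hf : f₃ p M = C (-(b / a ^ (2 * p + 2))) * g := by rw [f₃, e2]
  have hu : -(b / a ^ (2 * p + 2)) ≠ 0 :=
    neg_ne_zero.mpr (div_ne_zero h1235 (pow_ne_zero _ h1234))
  refine ⟨?_, ?_, ?_, ?_, ?_, ?_⟩
  · rw [hf, e1]
    have : C (a ^ (2 * p + 2)) * C (-(b / a ^ (2 * p + 2))) = -(C b : MvPolynomial (Fin 3) F) := by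
      rw [← C_mul, ← C_neg]
      congr 1
      have := pow_ne_zero (2 * p + 2) h1234
      field_simp
    linear_combination X 2 ^ (2 * p ^ 2 - 2) * g * this
  · rw [hf]; exact mul_mem ((invariants p M).algebraMap_mem _) e3
  · rw [hf]; exact e4.C_mul _
  · rw [hf]; exact mul_ne_zero (C_ne_zero.mpr hu) e5
  · rw [hf, degree_C_mul hu, e6]
  · rw [hf, leadingCoeff_C_mul, e7]
    have : (a ^ p * a) ^ 2 = a ^ (2 * p + 2) := by ring
    rw [this]
    have := pow_ne_zero (2 * p + 2) h1234
    field_simp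

end Generators

/-! ### The invariants after inverting `x` -/

section Localization

variable {F : Type*} [Field F] {p : ℕ} [Fact p.Prime] [CharP F p]
  {M : Matrix (Fin 2) (Fin 4) F}

/-- The Moore matrix is invertible, so each additive map g ↦ ∑ g_j v_j on E is a combination of the
first four Frobenius powers of α. This is needed for v the second row of M, and for the p⁴-th powers
of the first. -/
theorem exists_interpolation (h1357 : gam p M ![1, 3, 5, 7] ≠ 0) (v : Fin 4 → F) :
    ∃ c : Fin 4 → F, ∀ g : Multiplicative (Fin 4 → ZMod p),
      ∑ i, c i * shift p M 0 g ^ p ^ (i : ℕ) =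
        ∑ j, ZMod.castHom (dvd_refl p) F (g.toAdd j) * v j := by
  set A : Matrix (Fin 4) (Fin 4) F := Matrix.of fun a b => gammaRow p M (![1, 3, 5, 7] a) b with hA
  have hu : IsUnit A.det := IsUnit.mk0 _ h1357
  have hAe (i j : Fin 4) : A i j = M 0 j ^ p ^ (i : ℕ) := by
    rw [hA]
    fin_cases i <;> simp [gammaRow, Nat.odd_iff]
  refine ⟨Matrix.vecMul v A⁻¹, fun g => ?_⟩
  have hv : Matrix.vecMul (Matrix.vecMul v A⁻¹) A = v := by
    rw [Matrix.vecMul_vecMul, Matrix.nonsing_inv_mul _ hu, Matrix.vecMul_one]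
  have hv' (j : Fin 4) : ∑ i, Matrix.vecMul v A⁻¹ i * A i j = v j := congrFun hv j
  simp only [shift_pow, ← hv', Finset.mul_sum, hAe]
  rw [Finset.sum_comm]
  exact Finset.sum_congr rfl fun i _ => Finset.sum_congr rfl fun j _ => by ring

/-- The element `D = D' + ∑ b i Y ^ (p ^ i)` of the polynomial ring `F[D'][Y]`. -/
noncomputable def coordD (p : ℕ) (b : Fin 4 → F) : Polynomial (Polynomial F) :=
  Polynomial.C Polynomial.X +
    ∑ i, Polynomial.C (Polynomial.C (b i)) * Polynomial.X ^ p ^ (i : ℕ)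

/-- Dehomogenization `x ↦ 1`, `y ↦ Y`, `x z - y² ↦ D`. -/
noncomputable def theta (p : ℕ) (b : Fin 4 → F) :
    MvPolynomial (Fin 3) F →ₐ[F] Polynomial (Polynomial F) :=
  aeval ![coordD p b + Polynomial.X ^ 2, Polynomial.X, 1]

/-- The translation `Y ↦ Y + α` of `F[D'][Y]`. -/
noncomputable def transl (α : F) : Polynomial (Polynomial F) →ₐ[F] Polynomial (Polynomial F) :=
  (Polynomial.aeval (Polynomial.X + Polynomial.C (Polynomial.C α) :
    Polynomial (Polynomial F))).restrictScalars F

theorem transl_X (α : F) : transl α Polynomial.X =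
    Polynomial.X + Polynomial.C (Polynomial.C α) := by
  simp [transl]

theorem transl_C (α : F) (q : Polynomial F) : transl α (Polynomial.C q) = Polynomial.C q := by
  rw [transl, AlgHom.restrictScalars_apply, Polynomial.aeval_C]
  rfl

theorem transl_eq_comp (α : F) (q : Polynomial (Polynomial F)) :
    transl α q = q.comp (Polynomial.X + Polynomial.C (Polynomial.C α)) := rfl

theorem transl_sum_pow (α : F) (b : Fin 4 → F) :
    transl α (∑ i, Polynomial.C (Polynomial.C (b i)) * Polynomial.X ^ p ^ (i : ℕ)) =
      ∑ i, Polynomial.C (Polynomial.C (b i)) * Polynomial.X ^ p ^ (i : ℕ) +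
        Polynomial.C (Polynomial.C (∑ i, b i * α ^ p ^ (i : ℕ))) := by
  simp only [map_sum, map_mul (transl α), map_pow (transl α), transl_C, transl_X,
    ← Finset.sum_add_distrib]
  refine Finset.sum_congr rfl fun i _ => ?_
  rw [add_pow_char_pow, mul_add, Polynomial.C_mul, Polynomial.C_mul, Polynomial.C_pow,
    Polynomial.C_pow]

theorem transl_coordD {b : Fin 4 → F} {α β : F} (hb : ∑ i, b i * α ^ p ^ (i : ℕ) = β) :
    transl α (coordD p b) = coordD p b + Polynomial.C (Polynomial.C β) := by
  rw [coordD, map_add, transl_C, transl_sum_pow, hb, add_assoc]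

/-- On x = 1 the element g translates Y by α and D by β. The hypothesis on b says that ∑ b_i Y^(p^i)
is also translated by β, so D' is fixed and only a translation of Y remains. -/
theorem theta_act {b : Fin 4 → F} {g : Multiplicative (Fin 4 → ZMod p)}
    (hb : ∑ i, b i * shift p M 0 g ^ p ^ (i : ℕ) = shift p M 1 g) (f : MvPolynomial (Fin 3) F) :
    theta p b (act p M g f) = transl (shift p M 0 g) (theta p b f) := by
  have hC (x : F) : theta p b (C x) = Polynomial.C (Polynomial.C x) := (theta p b).commutes x
  have h0 : theta p b (X 0) = coordD p b + Polynomial.X ^ 2 := by simp [theta]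
  have h1 : theta p b (X 1) = Polynomial.X := by simp [theta]
  have h2 : theta p b (X 2) = 1 := by simp [theta]
  refine DFunLike.congr_fun (?_ : (theta p b).comp (act p M g) =
    (transl (shift p M 0 g)).comp (theta p b)) f
  ext1 i
  rw [AlgHom.comp_apply, AlgHom.comp_apply]
  fin_cases i
  · change theta p b (act p M g (X 0)) = transl _ (theta p b (X 0))
    rw [act_X_zero, h0, map_add (transl _), map_pow, transl_coordD hb, transl_X]
    simp only [map_add, map_mul, map_pow, h0, h1, h2, hC, map_ofNat]
    ring
  · change theta p b (act p M g (X 1)) = transl _ (theta p b (X 1))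
    rw [act_X_one, h1, transl_X, map_add, map_mul, h1, h2, hC, mul_one]
  · change theta p b (act p M g (X 2)) = transl _ (theta p b (X 2))
    rw [act_X_two, h2, map_one]

theorem transl_theta {b : Fin 4 → F} {g : Multiplicative (Fin 4 → ZMod p)}
    (hb : ∑ i, b i * shift p M 0 g ^ p ^ (i : ℕ) = shift p M 1 g) {f : MvPolynomial (Fin 3) F}
    (hf : f ∈ invariants p M) : transl (shift p M 0 g) (theta p b f) = theta p b f := by
  rw [← theta_act hb, mem_invariants.mp hf]

/-- Polynomials invariant under all translations by a finite set of constants `α`. -/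
theorem mem_of_transl_eq {ι : Type*} [Fintype ι] {α : ι → F} (hα : Function.Injective α)
    {n : Polynomial (Polynomial F)} (hn : n.Monic) (hnd : n.natDegree = Fintype.card ι)
    (hn0 : 0 < Fintype.card ι)
    (hnα : ∀ i, n.eval (Polynomial.C (α i)) = 0) (hnt : ∀ i, transl (α i) n = n)
    {A : Subalgebra F (Polynomial (Polynomial F))} (hA : n ∈ A)
    (hD : Polynomial.C Polynomial.X ∈ A) (d : ℕ) :
    ∀ q : Polynomial (Polynomial F), q.natDegree ≤ d → (∀ i, transl (α i) q = q) → q ∈ A := by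
  have hC (q : Polynomial F) : Polynomial.C q ∈ A := by
    have : Polynomial.aeval (Polynomial.C Polynomial.X : Polynomial (Polynomial F)) q =
        Polynomial.C q := by
      have := Polynomial.aeval_algHom_apply
        (Polynomial.CAlgHom : Polynomial F →ₐ[F] Polynomial (Polynomial F)) Polynomial.X q
      simpa using this
    rw [← this]
    rw [← Polynomial.coe_aeval_mk_apply (h := hD)]
    exact Subtype.coe_prop _
  -- Division with remainder: q minus its value at Y = 0 vanishes at all α_i by invariance, hence is
  -- divisible by n, and the quotient is invariant since n is.
  have main (q : Polynomial (Polynomial F)) (hq : ∀ i, transl (α i) q = q) :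
      ∃ s, q = Polynomial.C (q.coeff 0) + n * s ∧ ∀ i, transl (α i) s = s := by
    set r := q - Polynomial.C (q.coeff 0) with hr
    have hrt (i : ι) : transl (α i) r = r := by rw [hr, map_sub, hq, transl_C]
    have hr0 (i : ι) : r.eval (Polynomial.C (α i)) = 0 := by
      have : (transl (α i) r).eval 0 = r.eval (Polynomial.C (α i)) := by
        rw [transl_eq_comp, Polynomial.eval_comp]; simp
      rw [← this, hrt, hr]
      simp [Polynomial.coeff_zero_eq_eval_zero]
    have hrd := Polynomial.modByMonic_add_div r n
    have hm : r %ₘ n = 0 := by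
      refine Polynomial.eq_zero_of_natDegree_lt_card_of_eval_eq_zero _
        (f := fun i => Polynomial.C (α i)) (Polynomial.C_injective.comp hα) (fun i => ?_) ?_
      · have := congrArg (Polynomial.eval (Polynomial.C (α i))) hrd
        simpa [hnα, hr0] using this
      · rw [← hnd]
        exact Polynomial.natDegree_modByMonic_lt _ hn (by rintro rfl; simp at hnd; omega)
    rw [hm, zero_add] at hrd
    refine ⟨r /ₘ n, by rw [hrd, hr]; ring, fun i => ?_⟩
    have h2 := hrt i
    rw [← hrd, map_mul, hnt] at h2
    exact mul_left_cancel₀ hn.ne_zero h2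
  induction d with
  | zero =>
    intro q hq _
    rw [Polynomial.eq_C_of_natDegree_le_zero hq]
    exact hC _
  | succ d ih =>
    intro q hq hqt
    obtain ⟨s, hs, hst⟩ := main q hqt
    rw [hs]
    refine add_mem (hC _) (mul_mem hA (ih s ?_ hst))
    by_cases hs0 : s = 0
    · simp [hs0]
    have h1 : (n * s).natDegree ≤ d + 1 := by
      have : n * s = q - Polynomial.C (q.coeff 0) := by linear_combination -hs
      rw [this]
      exact (Polynomial.natDegree_sub_le _ _).trans (by simpa using hq)
    rw [Polynomial.natDegree_mul hn.ne_zero hs0] at h1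
    omega

end Localization

/-! ### Additive polynomials generate the invariants after inverting x -/

section Additive

/-- Raising the additive relation for φ to the power p^k expresses u^(p^(k+2)) by lower Frobenius
powers, as a ≠ 0. It is applied with u = Y to f̄₁ and with u = D to f̄₁₂₃₄₆. -/
theorem pow_mem_of_additive {F S : Type*} [Field F] [CommRing S] [Algebra F S] (p : ℕ)
    [Fact p.Prime] [CharP S p] {V : Submodule F S} {u Y D φ : S} {a b c d e : F} (ha : a ≠ 0)
    (hφ : φ = a • u ^ p ^ 2 - b • D ^ p + c • Y ^ p - d • D + e • Y) (k : ℕ)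
    (hφV : φ ^ p ^ k ∈ V) (hY : Y ^ p ^ k ∈ V) (hD : D ^ p ^ k ∈ V)
    (hY' : Y ^ p ^ (k + 1) ∈ V) (hD' : D ^ p ^ (k + 1) ∈ V) : u ^ p ^ (k + 2) ∈ V := by
  have h : φ ^ p ^ k = a ^ p ^ k • u ^ p ^ (k + 2) - b ^ p ^ k • D ^ p ^ (k + 1)
      + c ^ p ^ k • Y ^ p ^ (k + 1) - d ^ p ^ k • D ^ p ^ k + e ^ p ^ k • Y ^ p ^ k := by
    rw [hφ, add_pow_char_pow, sub_pow_char_pow, add_pow_char_pow, sub_pow_char_pow]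
    simp only [smul_pow, ← pow_mul, ← pow_succ', add_comm k, pow_add]
  rw [← V.smul_mem_iff (pow_ne_zero (p ^ k) ha)]
  have h' : a ^ p ^ k • u ^ p ^ (k + 2) = φ ^ p ^ k + b ^ p ^ k • D ^ p ^ (k + 1)
      - c ^ p ^ k • Y ^ p ^ (k + 1) + d ^ p ^ k • D ^ p ^ k - e ^ p ^ k • Y ^ p ^ k := by
    rw [h]; ring
  rw [h']
  exact sub_mem (add_mem (sub_mem (add_mem hφV (V.smul_mem _ hD')) (V.smul_mem _ hY'))
    (V.smul_mem _ hD)) (V.smul_mem _ hY)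

variable {F : Type*} [Field F] {p : ℕ} [Fact p.Prime] [CharP F p]
  {M : Matrix (Fin 2) (Fin 4) F}

omit [Fact p.Prime] [CharP F p] in
theorem theta_X_zero (b : Fin 4 → F) :
    theta p b (X 0) = coordD p b + Polynomial.X ^ 2 := by simp [theta]

omit [Fact p.Prime] [CharP F p] in
theorem theta_X_one (b : Fin 4 → F) : theta p b (X 1) = Polynomial.X := by simp [theta]

omit [Fact p.Prime] [CharP F p] in
theorem theta_X_two (b : Fin 4 → F) : theta p b (X 2) = 1 := by simp [theta]

omit [Fact p.Prime] [CharP F p] in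
theorem theta_C (b : Fin 4 → F) (x : F) :
    theta p b (C x) = Polynomial.C (Polynomial.C x) := (theta p b).commutes x

omit [Fact p.Prime] [CharP F p] in
theorem theta_neg_delta (b : Fin 4 → F) : theta p b (-delta F) = coordD p b := by
  rw [delta, map_neg, map_sub, map_pow, map_mul, theta_X_zero, theta_X_one, theta_X_two]
  ring

theorem C_C_mul (x : F) (q : Polynomial (Polynomial F)) :
    Polynomial.C (Polynomial.C x) * q = x • q := by
  rw [Algebra.smul_def]; rfl

omit [CharP F p] in
theorem theta_f₁ (hp : p ≠ 2) (b : Fin 4 → F) : theta p b (f₁ p M) =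
    gam p M ![1, 2, 3, 4] • Polynomial.X ^ p ^ 2 - gam p M ![1, 2, 3, 5] • coordD p b ^ p
    + gam p M ![1, 2, 4, 5] • Polynomial.X ^ p - gam p M ![1, 3, 4, 5] • coordD p b
    + gam p M ![2, 3, 4, 5] • Polynomial.X := by
  rw [f₁_eq M hp]
  simp only [map_add, map_sub, map_mul (theta p b), map_pow (theta p b), theta_neg_delta,
    theta_X_one, theta_X_two, theta_C, C_C_mul, one_pow, mul_one]

omit [CharP F p] in
theorem theta_f₆ (hp : p ≠ 2) (b : Fin 4 → F) : theta p b (fMinor p M ![1, 2, 3, 4, 6]) =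
    gam p M ![1, 2, 3, 4] • coordD p b ^ p ^ 2 - gam p M ![1, 2, 3, 6] • coordD p b ^ p
    + gam p M ![1, 2, 4, 6] • Polynomial.X ^ p - gam p M ![1, 3, 4, 6] • coordD p b
    + gam p M ![2, 3, 4, 6] • Polynomial.X := by
  rw [f₆_eq M hp]
  simp only [map_add, map_sub, map_mul (theta p b), map_pow (theta p b), theta_neg_delta,
    theta_X_one, theta_X_two, theta_C, C_C_mul, one_pow, mul_one]

/-- Evaluation at `Y = α`, `D' = 0`. -/
noncomputable def evalAt (α : F) : Polynomial (Polynomial F) →ₐ[F] F :=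
  (Polynomial.aeval (0 : F)).comp
    ((Polynomial.aeval (Polynomial.C α : Polynomial F)).restrictScalars F)

theorem evalAt_X (α : F) : evalAt α Polynomial.X = α := by simp [evalAt]

theorem evalAt_C_X (α : F) : evalAt α (Polynomial.C Polynomial.X) = 0 := by simp [evalAt]

omit [Fact p.Prime] [CharP F p] in
theorem evalAt_sum (α : F) (b : Fin 4 → F) :
    evalAt α (∑ i, Polynomial.C (Polynomial.C (b i)) * Polynomial.X ^ p ^ (i : ℕ)) =
      ∑ i, b i * α ^ p ^ (i : ℕ) := by
  simp only [C_C_mul, map_sum, map_smul, map_pow, evalAt_X, smul_eq_mul]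

omit [Fact p.Prime] [CharP F p] in
theorem evalAt_coordD (α : F) (b : Fin 4 → F) :
    evalAt α (coordD p b) = ∑ i, b i * α ^ p ^ (i : ℕ) := by
  rw [coordD, map_add, evalAt_C_X, evalAt_sum, zero_add]

theorem evalAt_eq_of_transl_eq {α : F} {q : Polynomial (Polynomial F)} (hq : transl α q = q) :
    evalAt α q = evalAt 0 q := by
  have h : evalAt α q = evalAt 0 (transl α q) := by
    simp [evalAt, transl_eq_comp, Polynomial.coe_aeval_eq_eval, Polynomial.eval_comp]
  rw [h, hq]

theorem shift_single (k : Fin 2) (j : Fin 4) :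
    shift p M k (Multiplicative.ofAdd (Pi.single j 1)) = M k j := by
  rw [shift, Finset.sum_eq_single j]
  · simp
  · intro i _ hi
    simp [hi]
  · simp

theorem shift_one (k : Fin 2) : shift p M k 1 = 0 := by simp [shift]

/-- The points Y = α(g), D' = 0 form one orbit, on which elements of A are constant and D takes the
value β(g). If q vanishes on it, so does the part spanned by Y, D, Y^p, D^p, up to a constant that
is zero at the identity. At the generators this is a linear system with determinant γ₁₂₃₄, so that
part is zero. -/
theorem mem_of_evalAt_eq_zero (h1234 : gam p M ![1, 2, 3, 4] ≠ 0) {b : Fin 4 → F}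
    (hb : ∀ g, ∑ i, b i * shift p M 0 g ^ p ^ (i : ℕ) = shift p M 1 g)
    {A : Subalgebra F (Polynomial (Polynomial F))}
    (hA : ∀ q ∈ A, ∀ g, transl (shift p M 0 g) q = q) {q : Polynomial (Polynomial F)}
    (hq : q ∈ Submodule.span F (Set.range ![Polynomial.X, coordD p b, Polynomial.X ^ p,
      coordD p b ^ p]) ⊔ A.toSubmodule) (hq0 : ∀ g, evalAt (shift p M 0 g) q = 0) : q ∈ A := by
  obtain ⟨t, ht, s, hs, rfl⟩ := Submodule.mem_sup.mp hq
  obtain ⟨u, rfl⟩ := (Submodule.mem_span_range_iff_exists_fun F).mp ht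
  have hs' (g) := evalAt_eq_of_transl_eq (hA s hs g)
  have hev (g) : evalAt (shift p M 0 g) (∑ i, u i • (![Polynomial.X, coordD p b, Polynomial.X ^ p,
      coordD p b ^ p] : Fin 4 → Polynomial (Polynomial F)) i) = u 0 * shift p M 0 g +
      u 1 * shift p M 1 g + u 2 * shift p M 0 g ^ p + u 3 * shift p M 1 g ^ p := by
    simp [Fin.sum_univ_four, evalAt_X, evalAt_coordD, hb]
  have hp0 : p ≠ 0 := (Fact.out : p.Prime).ne_zero
  have h0 : evalAt 0 s = 0 := by
    have := hq0 1
    rw [map_add, hev, shift_one, shift_one, zero_pow hp0] at this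
    simpa using this
  have hu : u = 0 := by
    refine Matrix.eq_zero_of_vecMul_eq_zero h1234 ?_
    funext j
    have := hq0 (Multiplicative.ofAdd (Pi.single j 1))
    rw [map_add, hev, hs', h0, add_zero, shift_single, shift_single] at this
    rw [Matrix.vecMul, dotProduct, Fin.sum_univ_four, Pi.zero_apply, ← this]
    simp [gammaRow, Nat.odd_iff]
  simpa [hu] using hs

/-- After inverting `x`, the invariants are generated by `f₁` and the minor `f₁₂₃₄₆`. -/
theorem theta_mem_adjoin (hp : p ≠ 2) (h1234 : gam p M ![1, 2, 3, 4] ≠ 0)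
    (h1357 : gam p M ![1, 3, 5, 7] ≠ 0) {b : Fin 4 → F}
    (hb : ∀ g, ∑ i, b i * shift p M 0 g ^ p ^ (i : ℕ) = shift p M 1 g)
    {f : MvPolynomial (Fin 3) F} (hf : f ∈ invariants p M) :
    theta p b f ∈ Algebra.adjoin F
      {theta p b (f₁ p M), theta p b (fMinor p M ![1, 2, 3, 4, 6])} := by
  set A := Algebra.adjoin F {theta p b (f₁ p M), theta p b (fMinor p M ![1, 2, 3, 4, 6])} with hA
  have hA1 : theta p b (f₁ p M) ∈ A := Algebra.subset_adjoin (by simp)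
  have hA2 : theta p b (fMinor p M ![1, 2, 3, 4, 6]) ∈ A := Algebra.subset_adjoin (by simp)
  have hAt : ∀ q ∈ A, ∀ g, transl (shift p M 0 g) q = q := by
    intro q hq g
    have : A ≤ AlgHom.equalizer (transl (shift p M 0 g)) (AlgHom.id F _) := by
      refine Algebra.adjoin_le ?_
      rintro _ (rfl | rfl)
      · exact transl_theta (hb g) (fMinor_mem_invariants M _)
      · exact transl_theta (hb g) (fMinor_mem_invariants M _)
    exact this hq
  set V := Submodule.span F (Set.range ![Polynomial.X, coordD p b, Polynomial.X ^ p,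
      coordD p b ^ p]) ⊔ A.toSubmodule with hV
  have hVA (q) (hq : q ∈ A) : q ∈ V := Submodule.mem_sup_right hq
  have hVi (i : Fin 4) : (![Polynomial.X, coordD p b, Polynomial.X ^ p,
      coordD p b ^ p] : Fin 4 → _) i ∈ V :=
    Submodule.mem_sup_left (Submodule.subset_span ⟨i, rfl⟩)
  -- Exponent k + 2 is reached from k and k + 1, so the induction carries two consecutive Frobenius
  -- powers.
  have hVp (k : ℕ) : (Polynomial.X ^ p ^ k ∈ V ∧ coordD p b ^ p ^ k ∈ V) ∧
      (Polynomial.X ^ p ^ (k + 1) ∈ V ∧ coordD p b ^ p ^ (k + 1) ∈ V) := by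
    induction k with
    | zero =>
      simp only [pow_zero, pow_one, zero_add]
      exact ⟨⟨hVi 0, hVi 1⟩, hVi 2, hVi 3⟩
    | succ k ih =>
      obtain ⟨⟨i1, i2⟩, i3, i4⟩ := ih
      exact ⟨⟨i3, i4⟩, pow_mem_of_additive p h1234 (theta_f₁ hp b) k (hVA _ (pow_mem hA1 _))
        i1 i2 i3 i4, pow_mem_of_additive p h1234 (theta_f₆ hp b) k (hVA _ (pow_mem hA2 _))
        i1 i2 i3 i4⟩
  have hVs (c : Fin 4 → F) :
      ∑ i, Polynomial.C (Polynomial.C (c i)) * Polynomial.X ^ p ^ (i : ℕ) ∈ V := by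
    refine V.sum_mem fun i _ => ?_
    rw [C_C_mul]
    exact V.smul_mem _ (hVp i).1.1
  -- D' = D - ∑ b_i Y^(p^i) lies in V and vanishes on the orbit of the origin.
  have hD : Polynomial.C Polynomial.X ∈ A := by
    refine mem_of_evalAt_eq_zero h1234 hb hAt ?_ fun g => evalAt_C_X _
    rw [← hV, ← add_sub_cancel_right (Polynomial.C (Polynomial.X : Polynomial F))
      (∑ i, Polynomial.C (Polynomial.C (b i)) * Polynomial.X ^ p ^ (i : ℕ))]
    exact sub_mem (hVi 1) (hVs b)
  -- The identity α^(p⁴) = ∑ c_i α^(p^i) yields the monic additive polynomial Y^(p⁴) - ∑ c_i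
  -- Y^(p^i), whose p⁴ roots are the α(g).
  obtain ⟨c, hc⟩ := exists_interpolation h1357 (fun j => M 0 j ^ p ^ 4)
  replace hc (g) : ∑ i, c i * shift p M 0 g ^ p ^ (i : ℕ) = shift p M 0 g ^ p ^ 4 := by
    rw [hc, shift_pow]
  set s := ∑ i, Polynomial.C (Polynomial.C (c i)) * (Polynomial.X : Polynomial (Polynomial F))
    ^ p ^ (i : ℕ) with hs
  have h1p : 1 < p := (Fact.out : p.Prime).one_lt
  have hsd : s.degree < (p ^ 4 : ℕ) := by
    refine (Polynomial.degree_sum_le _ _).trans_lt ((Finset.sup_lt_iff (WithBot.bot_lt_coe _)).mpr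
      fun i _ => ?_)
    refine (Polynomial.degree_C_mul_X_pow_le _ _).trans_lt ?_
    exact_mod_cast Nat.pow_lt_pow_right h1p i.2
  have hn : (Polynomial.X ^ p ^ 4 - s).Monic := Polynomial.monic_X_pow_sub hsd
  have hnd : (Polynomial.X ^ p ^ 4 - s).natDegree = p ^ 4 := by
    rw [Polynomial.natDegree_sub_eq_left_of_natDegree_lt, Polynomial.natDegree_X_pow]
    rw [Polynomial.natDegree_X_pow]
    rcases eq_or_ne s 0 with h | h
    · rw [h, Polynomial.natDegree_zero]; positivity
    · exact (Polynomial.natDegree_lt_iff_degree_lt h).mpr hsd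
  have hnA : Polynomial.X ^ p ^ 4 - s ∈ A := by
    refine mem_of_evalAt_eq_zero h1234 hb hAt (sub_mem (hVp 4).1.1 (hVs c)) fun g => ?_
    rw [map_sub, map_pow, evalAt_X, hs, evalAt_sum, hc, sub_self]
  have hcard : Fintype.card (Multiplicative (Fin 4 → ZMod p)) = p ^ 4 := by
    simp [ZMod.card]
  refine mem_of_transl_eq (shift_zero_injective h1357) hn (by rw [hnd, hcard])
    (by rw [hcard]; positivity) (fun g => ?_) (fun g => hAt _ hnA g) hnA hD _ _ le_rfl
    fun g => transl_theta (hb g) hf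
  have h := hc g
  rw [hs]
  simp only [Polynomial.eval_sub, Polynomial.eval_pow, Polynomial.eval_X,
    Polynomial.eval_finsetSum, Polynomial.eval_mul, Polynomial.eval_C, ← Polynomial.C_pow,
    ← Polynomial.C_mul, ← map_sum, h, sub_self]

end Additive

/-! ### The norm of `z` -/

section Norm

variable {F : Type*} [Field F] {p : ℕ} [Fact p.Prime] [CharP F p]
  {M : Matrix (Fin 2) (Fin 4) F}

/-- On x = 0, y = 1 the image of z under g is z + 2α(g). So the orbit of z has p⁴ elements and the
norm is a product over the group. -/
theorem act_X_zero_injective (hp : p ≠ 2) (h1357 : gam p M ![1, 3, 5, 7] ≠ 0) :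
    Function.Injective fun g => act p M g (X 0) := by
  intro g h e
  apply shift_zero_injective h1357
  have h2 := congrArg (fun f => (modX F f).coeff 0) e
  simp only [act_X_zero, modX, map_add, map_mul, aeval_X, algHom_C,
    Polynomial.algebraMap_eq] at h2
  simpa [two_ne_zero_of_ne_two (p := p) hp] using h2

theorem normM_eq (hp : p ≠ 2) (h1357 : gam p M ![1, 3, 5, 7] ≠ 0) :
    normM p M (X 0) = ∏ g, act p M g (X 0) := by
  classical
  rw [normM]
  convert Finset.prod_image (s := Finset.univ) (f := fun h : MvPolynomial (Fin 3) F => h)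
    (g := fun g => act p M g (X 0)) ((act_X_zero_injective hp h1357).injOn)

theorem shift_mul (k : Fin 2) (g h : Multiplicative (Fin 4 → ZMod p)) :
    shift p M k (g * h) = shift p M k g + shift p M k h := by
  simp only [shift, toAdd_mul, Pi.add_apply, map_add, add_mul, Finset.sum_add_distrib]

theorem card_group : Fintype.card (Multiplicative (Fin 4 → ZMod p)) = p ^ 4 := by
  simp [ZMod.card]

theorem normM_mem_invariants (hp : p ≠ 2) (h1357 : gam p M ![1, 3, 5, 7] ≠ 0) :
    normM p M (X 0) ∈ invariants p M := by
  rw [mem_invariants, normM_eq hp h1357]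
  intro h
  rw [map_prod]
  have key (g) : act p M h (act p M g (X 0)) = act p M (g * h) (X 0) := by
    rw [act_X_zero, act_X_zero, shift_mul, shift_mul]
    simp only [map_add, map_mul, act_X_zero, act_X_one, act_X_two, algHom_C, algebraMap_eq,
      map_pow, map_ofNat]
    ring
  simp only [key]
  exact Equiv.prod_comp (Equiv.mulRight h) fun g => act p M g (X 0)

theorem normM_isHomogeneous (hp : p ≠ 2) (h1357 : gam p M ![1, 3, 5, 7] ≠ 0) :
    (normM p M (X 0)).IsHomogeneous (p ^ 4) := by
  rw [normM_eq hp h1357, ← card_group (p := p), ← Finset.card_univ, Finset.card_eq_sum_ones]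
  exact IsHomogeneous.prod _ _ _ fun g _ => act_isHomogeneous g (isHomogeneous_X _ _)

theorem coeff_normM (hp : p ≠ 2) (h1357 : gam p M ![1, 3, 5, 7] ≠ 0) :
    coeff (Finsupp.single 0 (p ^ 4)) (normM p M (X 0)) = 1 := by
  rw [← modX_coeff (normM_isHomogeneous hp h1357) (by simp) (by simp), normM_eq hp h1357,
    map_prod]
  have h (g) : modX F (act p M g (X 0)) = Polynomial.X + Polynomial.C (2 * shift p M 0 g) := by
    simp only [act_X_zero, modX, map_add, map_mul, aeval_X, algHom_C, Polynomial.algebraMap_eq]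
    simp
  simp only [h]
  have := Polynomial.coeff_prod_of_natDegree_le Finset.univ
    (fun g => Polynomial.X + Polynomial.C (2 * shift p M 0 g)) 1
    fun g _ => by rw [Polynomial.natDegree_X_add_C]
  rw [Finset.card_univ, card_group, mul_one] at this
  simp only [Finsupp.single_eq_same]
  rw [this]
  simp

theorem normM_degree (hp : p ≠ 2) (h1357 : gam p M ![1, 3, 5, 7] ≠ 0) :
    grevlex.degree (normM p M (X 0)) = Finsupp.single 0 (p ^ 4) := by
  refine grevlex.toSyn.injective (le_antisymm (grevlex.degree_le_iff.mpr fun m hm => ?_)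
    (grevlex.le_degree (mem_support_iff.mpr (by rw [coeff_normM hp h1357]; exact one_ne_zero))))
  have hs := (normM_isHomogeneous hp h1357).sum_eq_of_mem_support hm
  rw [grevlex_le_iff_key]
  simp
  omega

end Norm

/-! ### Leading terms under a weighted substitution -/

section Weights

variable {F : Type*} [Field F]

/-- With weights 1 and 2 for A and B, each monomial of weight w contributes to the leading
coefficient a scalar times the power of the inner variable with exponent n times its exponent in B.
At fixed weight these powers are distinct, so nothing cancels. -/
theorem coeff_aeval_of_weight_le {A B : Polynomial (Polynomial F)} {n : ℕ} {a : F} (hn : 0 < n)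
    (hA : A.natDegree ≤ n) (hAc : A.coeff n = Polynomial.C a) (hB : B.natDegree ≤ 2 * n)
    (hBc : B.coeff (2 * n) = Polynomial.C a * Polynomial.X ^ n) {P : MvPolynomial (Fin 2) F}
    {w : ℕ} (hP : ∀ m ∈ P.support, m 0 + 2 * m 1 ≤ w) (m : Fin 2 →₀ ℕ) (hm : m 0 + 2 * m 1 = w) :
    ((aeval ![A, B] P).coeff (w * n)).coeff (m 1 * n) = coeff m P * a ^ (m 0 + m 1) := by
  have hd (k : Fin 2 →₀ ℕ) : (A ^ k 0 * B ^ k 1).natDegree ≤ (k 0 + 2 * k 1) * n := by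
    refine Polynomial.natDegree_mul_le.trans ?_
    have h1 := Polynomial.natDegree_pow_le_of_le (k 0) hA
    have h2 := Polynomial.natDegree_pow_le_of_le (k 1) hB
    calc _ ≤ k 0 * n + k 1 * (2 * n) := add_le_add h1 h2
      _ = _ := by ring
  have hc (k : Fin 2 →₀ ℕ) : (A ^ k 0 * B ^ k 1).coeff ((k 0 + 2 * k 1) * n) =
      Polynomial.C (a ^ (k 0 + k 1)) * Polynomial.X ^ (k 1 * n) := by
    have h1 := Polynomial.natDegree_pow_le_of_le (k 0) hA
    have h2 := Polynomial.natDegree_pow_le_of_le (k 1) hB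
    have h3 := Polynomial.coeff_mul_add_eq_of_natDegree_le h1 h2
    rw [Polynomial.coeff_pow_of_natDegree_le hA, Polynomial.coeff_pow_of_natDegree_le hB,
      hAc, hBc] at h3
    rw [show (k 0 + 2 * k 1) * n = k 0 * n + k 1 * (2 * n) by ring, h3, mul_pow, pow_add,
      Polynomial.C_mul, Polynomial.C_pow, Polynomial.C_pow]
    ring
  rw [aeval_def, eval₂_eq']
  simp only [Polynomial.finsetSum_coeff, Fin.prod_univ_two, Matrix.cons_val_zero,
    Matrix.cons_val_one]
  have hk (k : Fin 2 →₀ ℕ) : (algebraMap F (Polynomial (Polynomial F)) (coeff k P) *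
      (A ^ k 0 * B ^ k 1)).coeff (w * n) =
      Polynomial.C (coeff k P) * (A ^ k 0 * B ^ k 1).coeff (w * n) := by
    rw [Polynomial.algebraMap_apply, Polynomial.coeff_C_mul]; rfl
  rw [Finset.sum_eq_single m]
  · rw [hk, ← hm, hc, ← mul_assoc, ← Polynomial.C_mul, Polynomial.coeff_C_mul_X_pow, if_pos rfl]
  · intro k hk' hkm
    rw [hk]
    rcases (hP k hk').lt_or_eq with h | h
    · have h0 : (A ^ k 0 * B ^ k 1).coeff (w * n) = 0 :=
        Polynomial.coeff_eq_zero_of_natDegree_lt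
          ((hd k).trans_lt (Nat.mul_lt_mul_of_pos_right h hn))
      rw [h0, mul_zero, Polynomial.coeff_zero]
    · rw [← h, hc, ← mul_assoc, ← Polynomial.C_mul, Polynomial.coeff_C_mul_X_pow, if_neg]
      intro h1
      have h2 : m 1 = k 1 := Nat.eq_of_mul_eq_mul_right hn h1
      apply hkm
      ext i
      fin_cases i
      · change k 0 = m 0; omega
      · exact h2.symm
  · intro hm'
    rw [hk, notMem_support_iff.mp hm', Polynomial.C_0, zero_mul, Polynomial.coeff_zero]

theorem weight_le_of_natDegree_le {A B : Polynomial (Polynomial F)} {n : ℕ} {a : F} (hn : 0 < n)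
    (ha : a ≠ 0) (hA : A.natDegree ≤ n) (hAc : A.coeff n = Polynomial.C a)
    (hB : B.natDegree ≤ 2 * n) (hBc : B.coeff (2 * n) = Polynomial.C a * Polynomial.X ^ n)
    {P : MvPolynomial (Fin 2) F} {w : ℕ} (hw : (aeval ![A, B] P).natDegree ≤ w * n) :
    ∀ m ∈ P.support, m 0 + 2 * m 1 ≤ w := by
  intro m hm
  obtain ⟨k, hk, hmax⟩ := P.support.exists_max_image (fun m => m 0 + 2 * m 1) ⟨m, hm⟩
  refine (hmax m hm).trans ?_
  have h := coeff_aeval_of_weight_le hn hA hAc hB hBc hmax k rfl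
  have h0 : (aeval ![A, B] P).coeff ((k 0 + 2 * k 1) * n) ≠ 0 := by
    intro h0
    rw [h0, Polynomial.coeff_zero] at h
    exact mul_ne_zero (mem_support_iff.mp hk) (pow_ne_zero _ ha) h.symm
  exact Nat.le_of_mul_le_mul_right ((Polynomial.le_natDegree_of_ne_zero h0).trans hw) hn

end Weights

/-! ### The norm of z as a polynomial in f̄₁ and f̄₁₂₃₄₆ -/

section NormExpansion

variable {F : Type*} [Field F] {p : ℕ} [Fact p.Prime] [CharP F p]
  {M : Matrix (Fin 2) (Fin 4) F}

/-- The substitution `x ↦ 1`, `y ↦ t`, `x z - y² ↦ D t²`. -/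
noncomputable def omega (F : Type*) [Field F] :
    MvPolynomial (Fin 3) F →ₐ[F] Polynomial (Polynomial F) :=
  aeval ![Polynomial.C (Polynomial.X + 1) * Polynomial.X ^ 2, Polynomial.X, 1]

/-- The norm is known as a polynomial in the two minors only after `theta`; the factorization of
`omega` through `theta` transports that expansion. -/
theorem exists_omega_eq (p : ℕ) (b : Fin 4 → F) :
    ∃ ψ : Polynomial (Polynomial F) →ₐ[F] Polynomial (Polynomial F),
      ∀ f, omega F f = ψ (theta p b f) := by
  set d : Polynomial (Polynomial F) := Polynomial.C Polynomial.X * Polynomial.X ^ 2 -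
    ∑ i, Polynomial.C (Polynomial.C (b i)) * Polynomial.X ^ p ^ (i : ℕ) with hd
  refine ⟨Polynomial.eval₂AlgHom (Polynomial.aeval d) Polynomial.X fun _ => Commute.all _ _,
    fun f => ?_⟩
  set ψ := Polynomial.eval₂AlgHom (Polynomial.aeval (R := F) d) (Polynomial.X)
    (fun _ => Commute.all _ _) with hψ
  have hX : ψ Polynomial.X = Polynomial.X := by simp [hψ]
  have hCX : ψ (Polynomial.C Polynomial.X) = d := by simp [hψ]
  have hD : ψ (coordD p b) = Polynomial.C Polynomial.X * Polynomial.X ^ 2 := by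
    simp only [coordD, C_C_mul, map_add, map_sum, map_smul, map_pow, hX, hCX]
    simp only [hd, C_C_mul]
    ring
  refine DFunLike.congr_fun (?_ : omega F = ψ.comp (theta p b)) f
  ext1 i
  rw [AlgHom.comp_apply]
  fin_cases i
  · change omega F (X 0) = ψ (theta p b (X 0))
    rw [theta_X_zero, map_add, hD, map_pow, hX]
    simp [omega]
    ring
  · change omega F (X 1) = ψ (theta p b (X 1))
    rw [theta_X_one, hX]
    simp [omega]
  · change omega F (X 2) = ψ (theta p b (X 2))
    rw [theta_X_two, map_one]
    simp [omega]

theorem omega_neg_delta : omega F (-delta F) =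
    Polynomial.C Polynomial.X * Polynomial.X ^ 2 := by
  simp [omega, delta]
  ring

theorem omega_X_one : omega F (X 1) = Polynomial.X := by simp [omega]

theorem omega_X_two : omega F (X 2) = 1 := by simp [omega]

theorem omega_C (x : F) : omega F (C x) = Polynomial.C (Polynomial.C x) := (omega F).commutes x

theorem natDegree_remainder_le {n : ℕ} (hn : 1 ≤ n) (b c d e : F) :
    (-(Polynomial.C (Polynomial.C b) *
      (Polynomial.C Polynomial.X * Polynomial.X ^ 2 : Polynomial (Polynomial F)) ^ n)
    + Polynomial.C (Polynomial.C c) * Polynomial.X ^ n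
    - Polynomial.C (Polynomial.C d) * (Polynomial.C Polynomial.X * Polynomial.X ^ 2)
    + Polynomial.C (Polynomial.C e) * Polynomial.X).natDegree ≤ 2 * n := by
  have h1 : (Polynomial.C Polynomial.X * Polynomial.X ^ 2 : Polynomial (Polynomial F)).natDegree
      ≤ 2 := Polynomial.natDegree_C_mul_X_pow_le _ _
  have h2 := Polynomial.natDegree_pow_le_of_le n h1
  refine Polynomial.natDegree_add_le_of_degree_le ((Polynomial.natDegree_sub_le_of_le (m := 2 * n)
    (n := 2 * n) (Polynomial.natDegree_add_le_of_degree_le ?_ ?_) ?_).trans (max_self _).le) ?_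
  · rw [Polynomial.natDegree_neg]
    exact (Polynomial.natDegree_C_mul_le _ _).trans (h2.trans (by omega))
  · exact (Polynomial.natDegree_C_mul_X_pow_le _ _).trans (by omega)
  · exact (Polynomial.natDegree_C_mul_le _ _).trans (h1.trans (by omega))
  · exact (Polynomial.natDegree_C_mul_le _ _).trans (by rw [Polynomial.natDegree_X]; omega)

theorem coeff_of_eq_add {R : Type*} [CommRing R] {f q r : Polynomial R} {n m : ℕ} {u : R}
    (hf : f = q + r) (hq : q = Polynomial.C u * Polynomial.X ^ n) (hr : r.natDegree ≤ m)
    (hm : m < n) : f.natDegree ≤ n ∧ f.coeff n = u := by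
  subst hf hq
  refine ⟨Polynomial.natDegree_add_le_of_degree_le (Polynomial.natDegree_C_mul_X_pow_le _ _)
    (by omega), ?_⟩
  rw [Polynomial.coeff_add, Polynomial.coeff_C_mul_X_pow, if_pos rfl,
    Polynomial.coeff_eq_zero_of_natDegree_lt (hr.trans_lt hm), add_zero]

omit [CharP F p] in
theorem omega_f₁ (hp : p ≠ 2) : (omega F (f₁ p M)).natDegree ≤ p ^ 2 ∧
    (omega F (f₁ p M)).coeff (p ^ 2) = Polynomial.C (gam p M ![1, 2, 3, 4]) := by
  obtain ⟨i1, i2, i3⟩ := pow_inequalities (p := p) hp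
  have h3 := three_le_of_ne_two (p := p) hp
  refine coeff_of_eq_add ?_ rfl (natDegree_remainder_le (n := p) (by omega)
    (gam p M ![1, 2, 3, 5]) (gam p M ![1, 2, 4, 5]) (gam p M ![1, 3, 4, 5])
    (gam p M ![2, 3, 4, 5])) (by omega)
  rw [f₁_eq M hp]
  simp only [map_add, map_sub, map_mul (omega F), map_pow (omega F), omega_neg_delta,
    omega_X_one, omega_X_two, omega_C, one_pow, mul_one]
  ring

omit [CharP F p] in
theorem omega_f₆ (hp : p ≠ 2) : (omega F (fMinor p M ![1, 2, 3, 4, 6])).natDegree ≤ 2 * p ^ 2 ∧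
    (omega F (fMinor p M ![1, 2, 3, 4, 6])).coeff (2 * p ^ 2) =
      Polynomial.C (gam p M ![1, 2, 3, 4]) * Polynomial.X ^ p ^ 2 := by
  obtain ⟨i1, i2, i3⟩ := pow_inequalities (p := p) hp
  have h3 := three_le_of_ne_two (p := p) hp
  refine coeff_of_eq_add ?_ rfl (natDegree_remainder_le (n := p) (by omega)
    (gam p M ![1, 2, 3, 6]) (gam p M ![1, 2, 4, 6]) (gam p M ![1, 3, 4, 6])
    (gam p M ![2, 3, 4, 6])) (by omega)
  rw [f₆_eq M hp]
  simp only [map_add, map_sub, map_mul (omega F), map_pow (omega F), omega_neg_delta,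
    omega_X_one, omega_X_two, omega_C, one_pow, mul_one, Polynomial.C_mul, Polynomial.C_pow,
    mul_pow, ← pow_mul]
  ring

/-- Each of the p⁴ factors has the coefficient D + 1 at t², and (D + 1)^(p⁴) = D^(p⁴) + 1. -/
theorem omega_normM (hp : p ≠ 2) (h1357 : gam p M ![1, 3, 5, 7] ≠ 0) :
    (omega F (normM p M (X 0))).natDegree ≤ p ^ 4 * 2 ∧
    (omega F (normM p M (X 0))).coeff (p ^ 4 * 2) = Polynomial.X ^ p ^ 4 + 1 := by
  rw [normM_eq hp h1357, map_prod]
  have h (g) : (omega F (act p M g (X 0))).natDegree ≤ 2 ∧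
      (omega F (act p M g (X 0))).coeff 2 = Polynomial.X + 1 := by
    refine coeff_of_eq_add (r := Polynomial.C (Polynomial.C (2 * shift p M 0 g)) * Polynomial.X +
      Polynomial.C (Polynomial.C (shift p M 0 g ^ 2 + shift p M 1 g))) (m := 1) ?_ rfl
      Polynomial.natDegree_linear_le one_lt_two
    have h0 : omega F (X 0) = Polynomial.C (Polynomial.X + 1) * Polynomial.X ^ 2 := by
      simp [omega]
    rw [act_X_zero, map_add (omega F), map_add (omega F), map_mul (omega F), map_mul (omega F),
      omega_C, omega_C, omega_X_one, omega_X_two, h0, mul_one, add_assoc]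
  constructor
  · refine (Polynomial.natDegree_prod_le _ _).trans ((Finset.sum_le_card_nsmul _ _ 2
      fun g _ => (h g).1).trans ?_)
    rw [Finset.card_univ, card_group, smul_eq_mul]
  · have := Polynomial.coeff_prod_of_natDegree_le Finset.univ
      (fun g => omega F (act p M g (X 0))) 2 fun g _ => (h g).1
    rw [Finset.card_univ, card_group] at this
    rw [this, Finset.prod_congr rfl fun g _ => (h g).2, Finset.prod_const, Finset.card_univ,
      card_group, add_pow_char_pow, one_pow]

/-- The homomorphism `F[U][V] → S` with `U ↦ φ₁`, `V ↦ φ₂`. -/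
noncomputable def polyHom {S : Type*} [CommRing S] [Algebra F S] (φ₁ φ₂ : S) :
    Polynomial (Polynomial F) →ₐ[F] S :=
  Polynomial.aevalTower (Polynomial.aeval φ₁) φ₂

/-- Under `omega` the minors U, V and the norm have t-degree at most p², 2p² and 2p⁴, which bounds
the weight of the expansion by 2p². Hence V occurs at most to the power p², and V^(p²) occurs
without U. Its coefficient is nonzero because D^(p⁴) appears in the leading coefficient of the norm.
-/
theorem exists_norm_expansion (hp : p ≠ 2) (h1234 : gam p M ![1, 2, 3, 4] ≠ 0)
    (h1357 : gam p M ![1, 3, 5, 7] ≠ 0) {b : Fin 4 → F}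
    (hb : ∀ g, ∑ i, b i * shift p M 0 g ^ p ^ (i : ℕ) = shift p M 1 g) :
    ∃ P : Polynomial (Polynomial F), P.natDegree ≤ p ^ 2 ∧
      (∃ c : F, c ≠ 0 ∧ P.coeff (p ^ 2) = Polynomial.C c) ∧
      polyHom (theta p b (f₁ p M)) (theta p b (fMinor p M ![1, 2, 3, 4, 6])) P =
        theta p b (normM p M (X 0)) := by
  have hp2 : 0 < p ^ 2 := by have := (Fact.out : p.Prime).pos; positivity
  have hmem := theta_mem_adjoin hp h1234 h1357 hb (normM_mem_invariants hp h1357)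
  have hset : ({theta p b (f₁ p M), theta p b (fMinor p M ![1, 2, 3, 4, 6])} : Set _) =
      Set.range ![theta p b (f₁ p M), theta p b (fMinor p M ![1, 2, 3, 4, 6])] := by
    simp [Set.pair_comm]
  rw [hset, Algebra.adjoin_range_eq_range_aeval] at hmem
  obtain ⟨P, hP⟩ := hmem
  change aeval _ P = _ at hP
  obtain ⟨ψ, hψ⟩ := exists_omega_eq p b
  have hω : aeval ![omega F (f₁ p M), omega F (fMinor p M ![1, 2, 3, 4, 6])] P =
      omega F (normM p M (X 0)) := by
    rw [hψ, hψ, hψ, ← hP, MvPolynomial.comp_aeval_apply]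
    congr 2
    funext i
    fin_cases i <;> rfl
  obtain ⟨a1, a2⟩ := omega_f₁ (M := M) hp
  obtain ⟨b1, b2⟩ := omega_f₆ (M := M) hp
  obtain ⟨c1, c2⟩ := omega_normM hp h1357
  have hw : p ^ 4 * 2 = 2 * p ^ 2 * p ^ 2 := by ring
  rw [hw] at c1 c2
  rw [← hω] at c1 c2
  have hle := weight_le_of_natDegree_le hp2 h1234 a1 a2 b1 b2 c1
  have hc := coeff_aeval_of_weight_le hp2 a1 a2 b1 b2 hle (Finsupp.single 1 (p ^ 2)) (by simp)
  rw [c2] at hc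
  have hc0 : coeff (Finsupp.single 1 (p ^ 2)) P ≠ 0 := by
    intro h0
    rw [h0, zero_mul, Finsupp.single_eq_same, show p ^ 2 * p ^ 2 = p ^ 4 by ring] at hc
    simp [Polynomial.coeff_one, (Fact.out : p.Prime).ne_zero] at hc
  have hexp : aeval ![Polynomial.C (Polynomial.X : Polynomial F), Polynomial.X] P =
      ∑ m ∈ P.support, Polynomial.C (Polynomial.C (coeff m P) * Polynomial.X ^ m 0) *
        (Polynomial.X : Polynomial (Polynomial F)) ^ m 1 := by
    rw [aeval_def, eval₂_eq']
    refine Finset.sum_congr rfl fun m _ => ?_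
    rw [Fin.prod_univ_two, Polynomial.C_mul, Polynomial.C_pow, mul_assoc]
    rfl
  refine ⟨aeval ![Polynomial.C Polynomial.X, Polynomial.X] P, ?_, ⟨_, hc0, ?_⟩, ?_⟩
  · rw [hexp]
    refine Polynomial.natDegree_sum_le_of_forall_le _ _ fun m hm => ?_
    exact (Polynomial.natDegree_C_mul_X_pow_le _ _).trans (by have := hle m hm; omega)
  · rw [hexp, Polynomial.finsetSum_coeff, Finset.sum_eq_single (Finsupp.single 1 (p ^ 2))]
    · simp
    · intro m hm hne
      rw [Polynomial.coeff_C_mul_X_pow, if_neg]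
      intro h1
      apply hne
      have := hle m hm
      ext i
      fin_cases i
      · simp; omega
      · simp [h1]
    · intro h0
      exact absurd (notMem_support_iff.mp h0) hc0
  · rw [← hP, MvPolynomial.comp_aeval_apply]
    congr 2
    funext i
    fin_cases i <;> simp [polyHom]

end NormExpansion

/-! ### Expansion in terms of the generators -/

section Span

variable {F : Type*} [Field F]

/-- Polynomials over `F[U]` expand in terms of products of polynomials of degrees `1`, `p`, `p²`
with unit leading coefficients. -/
theorem mem_of_unit_leading {p : ℕ} (hp : 0 < p) {W : Submodule F (Polynomial (Polynomial F))}
    {g₁ g₂ g₃ : Polynomial (Polynomial F)} {c₁ c₂ c₃ : F} (hc₁ : c₁ ≠ 0) (hc₂ : c₂ ≠ 0)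
    (hc₃ : c₃ ≠ 0) (hd₁ : g₁.natDegree ≤ 1) (hd₂ : g₂.natDegree ≤ p)
    (hd₃ : g₃.natDegree ≤ p ^ 2) (hl₁ : g₁.coeff 1 = Polynomial.C c₁)
    (hl₂ : g₂.coeff p = Polynomial.C c₂) (hl₃ : g₃.coeff (p ^ 2) = Polynomial.C c₃)
    (hW : ∀ (κ : Polynomial F) (j k l : ℕ), j < p → k < p →
      Polynomial.C κ * (g₁ ^ j * g₂ ^ k * g₃ ^ l) ∈ W) (n : ℕ) :
    ∀ q : Polynomial (Polynomial F), q.degree < n → q ∈ W := by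
  induction n with
  | zero =>
    intro q hq
    have : q = 0 := by
      rw [← Polynomial.degree_eq_bot]
      simpa using hq
    rw [this]
    exact W.zero_mem
  | succ n ih =>
    intro q hq
    -- Base p digits: n = j + k p + l p² with j, k < p and l unrestricted. The product of the
    -- corresponding powers has degree n and a unit leading coefficient, so it can clear the
    -- coefficient of q at n.
    set j := n % p with hj
    set k := n / p % p with hk
    set l := n / p / p with hl
    have hn : j * 1 + k * p + l * p ^ 2 = n := by
      have h1 := Nat.mod_add_div n p
      have h2 := Nat.mod_add_div (n / p) p
      rw [← hj] at h1
      rw [← hk, ← hl] at h2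
      rw [← h2] at h1
      rw [← h1]; ring
    set G := g₁ ^ j * g₂ ^ k * g₃ ^ l with hG
    have d1 := Polynomial.natDegree_pow_le_of_le j hd₁
    have d2 := Polynomial.natDegree_pow_le_of_le k hd₂
    have d3 := Polynomial.natDegree_pow_le_of_le l hd₃
    have d12 : (g₁ ^ j * g₂ ^ k).natDegree ≤ j * 1 + k * p :=
      Polynomial.natDegree_mul_le.trans (add_le_add d1 d2)
    have hGd : G.natDegree ≤ n := hn ▸ Polynomial.natDegree_mul_le.trans (add_le_add d12 d3)
    have hGc : G.coeff n = Polynomial.C (c₁ ^ j * c₂ ^ k * c₃ ^ l) := by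
      rw [← hn, hG, Polynomial.coeff_mul_add_eq_of_natDegree_le d12 d3,
        Polynomial.coeff_mul_add_eq_of_natDegree_le d1 d2, Polynomial.coeff_pow_of_natDegree_le hd₁,
        Polynomial.coeff_pow_of_natDegree_le hd₂, Polynomial.coeff_pow_of_natDegree_le hd₃,
        hl₁, hl₂, hl₃]
      simp only [Polynomial.C_mul, Polynomial.C_pow]
    set u := c₁ ^ j * c₂ ^ k * c₃ ^ l with hu
    have hu0 : u ≠ 0 := mul_ne_zero (mul_ne_zero (pow_ne_zero _ hc₁) (pow_ne_zero _ hc₂))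
      (pow_ne_zero _ hc₃)
    set κ := q.coeff n * Polynomial.C u⁻¹ with hκ
    rw [← sub_add_cancel q (Polynomial.C κ * G)]
    refine add_mem (ih _ ?_) (hW κ j k l (Nat.mod_lt _ hp) (Nat.mod_lt _ hp))
    rw [Polynomial.degree_lt_iff_coeff_zero]
    intro m hm
    rw [Polynomial.coeff_sub, Polynomial.coeff_C_mul]
    rcases hm.eq_or_lt with rfl | hm
    · rw [hGc, hκ, mul_assoc, ← Polynomial.C_mul, inv_mul_cancel₀ hu0, Polynomial.C_1, mul_one,
        sub_self]
    · rw [Polynomial.coeff_eq_zero_of_natDegree_lt (hGd.trans_lt hm), mul_zero, sub_zero]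
      exact (Polynomial.degree_lt_iff_coeff_zero _ _).mp hq m hm

theorem polyHom_X {S : Type*} [CommRing S] [Algebra F S] (φ₁ φ₂ : S) :
    polyHom (F := F) φ₁ φ₂ Polynomial.X = φ₂ := by simp [polyHom]

theorem polyHom_C_X {S : Type*} [CommRing S] [Algebra F S] (φ₁ φ₂ : S) :
    polyHom (F := F) φ₁ φ₂ (Polynomial.C Polynomial.X) = φ₁ := by simp [polyHom]

end Span

/-! ### Standard products span the dehomogenized invariants -/

section Invariants

variable {F : Type*} [Field F] {p : ℕ} [Fact p.Prime] [CharP F p]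
  {M : Matrix (Fin 2) (Fin 4) F}

/-- The expansion of `f̃₃` in terms of the first two generators, after inverting `x`. -/
noncomputable def f₃Poly (p : ℕ) (M : Matrix (Fin 2) (Fin 4) F) {S : Type*} [CommRing S]
    [Algebra F S] (u v : S) : S :=
  gam p M ![1, 2, 3, 5] ^ p • u ^ (p + 2) - gam p M ![1, 2, 3, 4] ^ 2 • v ^ p
  + (-2 * gam p M ![1, 2, 3, 5] ^ p) • (u ^ p * v) + alpha₂ p M • u ^ (p + 1)
  + alpha₃ p M • (u ^ (p - 1) * v) + alpha₄ p M • (u ^ ((p - 3) / 2) * v ^ ((p + 1) / 2))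

omit [Fact p.Prime] [CharP F p] in
theorem map_f₃Poly {S T : Type*} [CommRing S] [Algebra F S] [CommRing T] [Algebra F T]
    (ψ : S →ₐ[F] T) (u v : S) : ψ (f₃Poly p M u v) = f₃Poly p M (ψ u) (ψ v) := by
  simp only [f₃Poly, map_add, map_sub, map_smul, map_mul ψ, map_pow ψ]

omit [Fact p.Prime] [CharP F p] in
theorem theta_f₃Tilde (b : Fin 4 → F) : theta p b (f₃Tilde p M) =
    f₃Poly p M (theta p b (f₁ p M)) (theta p b (f₂ p M)) := by
  simp only [f₃Tilde, f₃Poly, map_add, map_sub, map_mul (theta p b), map_pow (theta p b),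
    theta_X_two, theta_C, C_C_mul, one_pow, mul_one, smul_mul_assoc]

omit [CharP F p] in
-- Only the term with g^p reaches degree p; the other exponents of g are at most (p + 1)/2 ≤ p - 1.
theorem f₃Poly_natDegree (hp : p ≠ 2) {g : Polynomial (Polynomial F)} {c : F}
    (hd : g.natDegree ≤ 1) (hc : g.coeff 1 = Polynomial.C c) :
    (f₃Poly p M (Polynomial.C Polynomial.X) g).natDegree ≤ p ∧
      (f₃Poly p M (Polynomial.C Polynomial.X) g).coeff p =
        Polynomial.C (-(gam p M ![1, 2, 3, 4] ^ 2 * c ^ p)) := by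
  have h3 := three_le_of_ne_two (p := p) hp
  have hX (n : ℕ) :
      ((Polynomial.C Polynomial.X : Polynomial (Polynomial F)) ^ n).natDegree ≤ 0 := by
    rw [← Polynomial.C_pow, Polynomial.natDegree_C]
  have hXg (n m : ℕ) (hm : m ≤ p - 1) :
      ((Polynomial.C Polynomial.X : Polynomial (Polynomial F)) ^ n * g ^ m).natDegree ≤ p - 1 := by
    refine Polynomial.natDegree_mul_le.trans ((add_le_add (hX n)
      (Polynomial.natDegree_pow_le_of_le m hd)).trans ?_)
    omega
  have hXg1 (n : ℕ) := hXg n 1 (by omega)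
  simp only [pow_one] at hXg1
  have hgd := Polynomial.natDegree_pow_le_of_le p hd
  rw [mul_one] at hgd
  have hgc : (g ^ p).coeff p = Polynomial.C (c ^ p) := by
    have := Polynomial.coeff_pow_of_natDegree_le (m := p) hd
    rwa [mul_one, hc, ← Polynomial.C_pow] at this
  set r := gam p M ![1, 2, 3, 5] ^ p • (Polynomial.C Polynomial.X : Polynomial (Polynomial F)) ^
      (p + 2) + (-2 * gam p M ![1, 2, 3, 5] ^ p) • ((Polynomial.C Polynomial.X) ^ p * g)
    + alpha₂ p M • (Polynomial.C Polynomial.X) ^ (p + 1)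
    + alpha₃ p M • ((Polynomial.C Polynomial.X) ^ (p - 1) * g)
    + alpha₄ p M • ((Polynomial.C Polynomial.X) ^ ((p - 3) / 2) * g ^ ((p + 1) / 2)) with hr
  have hrd : r.natDegree ≤ p - 1 := by
    have hs (x : F) {q : Polynomial (Polynomial F)} (hq : q.natDegree ≤ p - 1) :
        (x • q).natDegree ≤ p - 1 := (Polynomial.natDegree_smul_le _ _).trans hq
    refine Polynomial.natDegree_add_le_of_degree_le (Polynomial.natDegree_add_le_of_degree_le
      (Polynomial.natDegree_add_le_of_degree_le (Polynomial.natDegree_add_le_of_degree_le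
      ?_ ?_) ?_) ?_) ?_
    · exact hs _ ((hX _).trans (Nat.zero_le _))
    · exact hs _ (hXg1 _)
    · exact hs _ ((hX _).trans (Nat.zero_le _))
    · exact hs _ (hXg1 _)
    · exact hs _ (hXg _ _ (by omega))
  have he : f₃Poly p M (Polynomial.C Polynomial.X) g =
      -(gam p M ![1, 2, 3, 4] ^ 2 • g ^ p) + r := by
    rw [f₃Poly, hr]; ring
  rw [he]
  constructor
  · refine Polynomial.natDegree_add_le_of_degree_le ?_ (hrd.trans (by omega))
    rw [Polynomial.natDegree_neg]
    exact (Polynomial.natDegree_smul_le _ _).trans hgd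
  · rw [Polynomial.coeff_add, Polynomial.coeff_neg, Polynomial.coeff_smul, hgc,
      Polynomial.coeff_eq_zero_of_natDegree_lt (hrd.trans_lt (by omega)), add_zero,
      Polynomial.smul_C, ← Polynomial.C_neg, smul_eq_mul]

/-- In F[U][V] the elements f̄₂, f̄₃ and N_M(z) have V-degrees 1, p, p² with nonzero constants as
leading coefficients, so `mem_of_unit_leading` applies; powers of U account for f̄₁. -/
theorem theta_mem_span (hp : p ≠ 2) (h1234 : gam p M ![1, 2, 3, 4] ≠ 0)
    (h1235 : gam p M ![1, 2, 3, 5] ≠ 0) (h1357 : gam p M ![1, 3, 5, 7] ≠ 0) {b : Fin 4 → F}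
    (hb : ∀ g, ∑ i, b i * shift p M 0 g ^ p ^ (i : ℕ) = shift p M 1 g)
    {f : MvPolynomial (Fin 3) F} (hf : f ∈ invariants p M) :
    theta p b f ∈ Submodule.span F (Set.range
      fun K : {K : Fin 5 →₀ ℕ // K 0 = 0 ∧ K 2 < p ∧ K 3 < p} =>
        theta p b (powProd (gens p M) K)) := by
  set W := Submodule.span F (Set.range
      fun K : {K : Fin 5 →₀ ℕ // K 0 = 0 ∧ K 2 < p ∧ K 3 < p} =>
        theta p b (powProd (gens p M) K)) with hW
  set φ₁ := theta p b (f₁ p M) with hφ₁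
  set φ₂ := theta p b (fMinor p M ![1, 2, 3, 4, 6]) with hφ₂
  set a := gam p M ![1, 2, 3, 4] with ha
  set c := gam p M ![1, 2, 3, 5] with hc
  have h2 := two_ne_zero_of_ne_two (F := F) hp
  obtain ⟨P, hPd, ⟨c₃, hc₃, hPc⟩, hP⟩ := exists_norm_expansion hp h1234 h1357 hb
  have e₂ := congrArg (theta p b) (f₂_properties hp h1234 h1235 h1357).1
  have e₃ := congrArg (theta p b) (f₃_properties hp h1234 h1235 h1357).1
  rw [map_mul, map_mul, map_pow, theta_X_two, one_pow, mul_one, map_ofNat, map_add, map_pow,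
    map_mul, theta_C, C_C_mul, ← hφ₁, ← hφ₂, ← ha] at e₂
  rw [map_mul (theta p b), map_mul (theta p b), map_pow (theta p b), theta_X_two, one_pow,
    mul_one, map_neg, map_mul (theta p b), theta_C,
    theta_C, C_C_mul, C_C_mul, theta_f₃Tilde, ← hφ₁, ← ha, ← hc] at e₃
  set Ψ := polyHom (F := F) φ₁ φ₂ with hΨ
  have hΨX : Ψ Polynomial.X = φ₂ := polyHom_X _ _
  have hΨU : Ψ (Polynomial.C Polynomial.X) = φ₁ := polyHom_C_X _ _
  -- This is (U² + aV)/2, the definition of f̄₂ with x = 1.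
  set g₁ : Polynomial (Polynomial F) :=
    Polynomial.C (Polynomial.C (2⁻¹ * a)) * Polynomial.X +
      Polynomial.C (Polynomial.C 2⁻¹ * Polynomial.X ^ 2) with hg₁
  have hΨ₁ : Ψ g₁ = theta p b (f₂ p M) := by
    have hg₁' : g₁ = (2⁻¹ : F) • ((Polynomial.C Polynomial.X) ^ 2 + a • Polynomial.X) := by
      simp only [hg₁, ← C_C_mul, Polynomial.C_mul, Polynomial.C_pow]
      ring
    rw [hg₁', map_smul, map_add, map_smul, map_pow, hΨX, hΨU, ← e₂, two_mul, ← two_smul F,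
      smul_smul, inv_mul_cancel₀ h2, one_smul]
  have hd₁ : g₁.natDegree ≤ 1 := Polynomial.natDegree_linear_le
  have hl₁ : g₁.coeff 1 = Polynomial.C (2⁻¹ * a) := by
    rw [hg₁, Polynomial.coeff_add, Polynomial.coeff_C_mul, Polynomial.coeff_X_one, mul_one,
      Polynomial.coeff_C, if_neg one_ne_zero, add_zero]
  set u := -(c / a ^ (2 * p + 2)) with hu
  set g₂ : Polynomial (Polynomial F) := u • f₃Poly p M (Polynomial.C Polynomial.X) g₁ with hg₂
  have hΨ₂ : Ψ g₂ = theta p b (f₃ p M) := by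
    rw [hg₂, map_smul, map_f₃Poly, hΨU, hΨ₁]
    have h0 := pow_ne_zero (2 * p + 2) h1234
    have : u • f₃Poly p M φ₁ (theta p b (f₂ p M)) =
        (a ^ (2 * p + 2))⁻¹ • -(c • f₃Poly p M φ₁ (theta p b (f₂ p M))) := by
      rw [hu, ← smul_neg, neg_smul, smul_neg, smul_neg, smul_smul, div_eq_inv_mul]
    rw [this, ← e₃, inv_smul_smul₀ h0]
  obtain ⟨d₂, l₂⟩ := f₃Poly_natDegree (M := M) hp hd₁ hl₁
  have hd₂ : g₂.natDegree ≤ p := (Polynomial.natDegree_smul_le _ _).trans d₂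
  have hl₂ : g₂.coeff p = Polynomial.C (u * -(a ^ 2 * (2⁻¹ * a) ^ p)) := by
    rw [hg₂, Polynomial.coeff_smul, l₂, Polynomial.smul_C, smul_eq_mul]
  have hu0 : u ≠ 0 := neg_ne_zero.mpr (div_ne_zero h1235 (pow_ne_zero _ h1234))
  have hκ0 : 2⁻¹ * a ≠ 0 := mul_ne_zero (inv_ne_zero h2) h1234
  have main : ∀ q : Polynomial (Polynomial F), Ψ q ∈ W := by
    intro q
    refine mem_of_unit_leading (W := W.comap Ψ.toLinearMap) (Fact.out : p.Prime).pos hκ0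
      (mul_ne_zero hu0 (neg_ne_zero.mpr (mul_ne_zero (pow_ne_zero _ h1234) (pow_ne_zero _ hκ0))))
      hc₃ hd₁ hd₂ hPd hl₁ hl₂ hPc ?_ (q.natDegree + 1) q ?_
    · intro κ j k l hj hk
      induction κ using Polynomial.induction_on' with
      | add κ κ' h h' => rw [Polynomial.C_add, add_mul]; exact add_mem h h'
      | monomial i x =>
        rw [← Polynomial.C_mul_X_pow_eq_monomial, Polynomial.C_mul, mul_assoc, C_C_mul]
        refine Submodule.smul_mem _ _ ?_
        rw [Submodule.mem_comap, AlgHom.toLinearMap_apply]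
        refine Submodule.subset_span ⟨⟨Finsupp.single 1 i + Finsupp.single 2 j +
          Finsupp.single 3 k + Finsupp.single 4 l, by simp, by simpa, by simpa⟩, ?_⟩
        simp only [powProd_add, powProd_single, map_mul, map_pow, hΨU, hΨ₁,
          hΨ₂, hP]
        simp only [gens, Matrix.cons_val]
        ring
    · exact (Polynomial.degree_le_natDegree).trans_lt (by exact_mod_cast Nat.lt_succ_self _)
  have hmem := theta_mem_adjoin hp h1234 h1357 hb hf
  have hle : Algebra.adjoin F {φ₁, φ₂} ≤ Ψ.range := by
    refine Algebra.adjoin_le ?_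
    rintro _ (rfl | rfl)
    · exact ⟨_, hΨU⟩
    · exact ⟨_, hΨX⟩
  obtain ⟨q, hq⟩ := hle hmem
  rw [← hq]
  exact main q

end Invariants

/-! ### Lead monomials of invariants -/

section LeadMonomials

variable {F : Type*} [Field F]

theorem eq_zero_of_dehomogenization {f : MvPolynomial (Fin 3) F} {d : ℕ} (hf : f.IsHomogeneous d)
    (h : aeval ![X 0, X 1, (1 : MvPolynomial (Fin 3) F)] f = 0) : f = 0 := by
  have hm (m : Fin 3 →₀ ℕ) (c : F) : aeval ![X 0, X 1, (1 : MvPolynomial (Fin 3) F)]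
      (monomial m c) = monomial (Finsupp.single 0 (m 0) + Finsupp.single 1 (m 1)) c := by
    rw [aeval_monomial, Finsupp.prod_fintype _ _ (fun _ => pow_zero _), Fin.prod_univ_three,
      monomial_eq, Finsupp.prod_fintype _ _ (fun _ => pow_zero _), Fin.prod_univ_three]
    simp
  ext m
  rw [coeff_zero]
  by_contra hne
  have hms : m ∈ f.support := mem_support_iff.mpr hne
  have h' := congrArg (coeff (Finsupp.single 0 (m 0) + Finsupp.single 1 (m 1))) h
  rw [f.as_sum, map_sum, coeff_sum, Finset.sum_eq_single m, hm, coeff_monomial, if_pos rfl,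
    coeff_zero] at h'
  · exact hne h'
  · intro k hk hkm
    rw [hm, coeff_monomial, if_neg]
    intro e
    apply hkm
    have e0 := DFunLike.congr_fun e 0
    have e1 := DFunLike.congr_fun e 1
    simp at e0 e1
    have s1 := hf.sum_eq_of_mem_support hms
    have s2 := hf.sum_eq_of_mem_support hk
    ext i
    fin_cases i
    · exact e0
    · exact e1
    · change k 2 = m 2; omega
  · intro h0; exact absurd hms h0

/-- Undoing the change of coordinates turns `theta` into the plain dehomogenization x ↦ 1, which is
injective on homogeneous polynomials of a given degree. -/
theorem eq_zero_of_theta_eq_zero (p : ℕ) (b : Fin 4 → F) {f : MvPolynomial (Fin 3) F} {d : ℕ}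
    (hf : f.IsHomogeneous d) (h : theta p b f = 0) : f = 0 := by
  set e : MvPolynomial (Fin 3) F := X 0 - X 1 ^ 2 - ∑ i, b i • X 1 ^ p ^ (i : ℕ) with he
  set ψ : Polynomial (Polynomial F) →ₐ[F] MvPolynomial (Fin 3) F := polyHom e (X 1) with hψ
  have hX : ψ Polynomial.X = X 1 := polyHom_X _ _
  have hD : ψ (coordD p b) = X 0 - X 1 ^ 2 := by
    simp only [coordD, C_C_mul, map_add, map_sum, map_smul, map_pow, hX]
    rw [polyHom_C_X, he]
    ring
  refine eq_zero_of_dehomogenization hf ?_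
  have hc : aeval ![X 0, X 1, (1 : MvPolynomial (Fin 3) F)] = ψ.comp (theta p b) := by
    ext1 i
    rw [AlgHom.comp_apply, aeval_X]
    fin_cases i
    · change X 0 = ψ (theta p b (X 0))
      rw [theta_X_zero, map_add, hD, map_pow, hX, sub_add_cancel]
    · change X 1 = ψ (theta p b (X 1))
      rw [theta_X_one, hX]
    · change 1 = ψ (theta p b (X 2))
      rw [theta_X_two, map_one]
  rw [hc, AlgHom.comp_apply, h, map_zero]

theorem degree_homogeneousComponent {f : MvPolynomial (Fin 3) F} (hf : f ≠ 0) :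
    ∃ d, homogeneousComponent d f ≠ 0 ∧
      grevlex.degree (homogeneousComponent d f) = grevlex.degree f := by
  have h1 : grevlex.degree f ∈ f.support := grevlex.degree_mem_support hf
  have h2 : grevlex.degree f ∈ (homogeneousComponent (grevlex.degree f).degree f).support := by
    rw [mem_support_iff, coeff_homogeneousComponent, if_pos rfl]
    exact mem_support_iff.mp h1
  refine ⟨(grevlex.degree f).degree, fun h => by simp [h] at h2, grevlex.toSyn.injective
    (le_antisymm (grevlex.degree_le_iff.mpr fun m hm => grevlex.le_degree ?_)
      (grevlex.le_degree h2))⟩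
  rw [mem_support_iff, coeff_homogeneousComponent] at hm
  rw [mem_support_iff]
  intro h0
  simp [h0] at hm

variable {p : ℕ} [Fact p.Prime] [CharP F p] {M : Matrix (Fin 2) (Fin 4) F}

theorem hasGensDegrees (hp : p ≠ 2) (h1234 : gam p M ![1, 2, 3, 4] ≠ 0)
    (h1235 : gam p M ![1, 2, 3, 5] ≠ 0) (h1357 : gam p M ![1, 3, 5, 7] ≠ 0) :
    HasGensDegrees p (gens p M) := by
  obtain ⟨-, a1, a2, a3, -⟩ := f₁_properties hp h1234 h1357
  obtain ⟨-, -, b1, b2, b3, -⟩ := f₂_properties hp h1234 h1235 h1357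
  obtain ⟨-, -, c1, c2, c3, -⟩ := f₃_properties hp h1234 h1235 h1357
  have hN0 : normM p M (X 0) ≠ 0 := by
    intro h
    have := coeff_normM hp h1357
    simp [h] at this
  refine ⟨fun j => ?_, fun j => ?_, fun j => ?_⟩ <;> fin_cases j
  exacts [isHomogeneous_X _ _, a1, b1, c1, normM_isHomogeneous hp h1357,
    grevlex.degree_X, a3, b3, c3, normM_degree hp h1357, X_ne_zero _, a2, b2, c2, hN0]

theorem gens_mem (hp : p ≠ 2) (h1234 : gam p M ![1, 2, 3, 4] ≠ 0)
    (h1235 : gam p M ![1, 2, 3, 5] ≠ 0) (h1357 : gam p M ![1, 3, 5, 7] ≠ 0) (j : Fin 5) :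
    gens p M j ∈ invariants p M := by
  fin_cases j
  exacts [X_two_mem_invariants, (f₁_properties hp h1234 h1357).1,
    (f₂_properties hp h1234 h1235 h1357).2.1, (f₃_properties hp h1234 h1235 h1357).2.1,
    normM_mem_invariants hp h1357]

/-- The expansion after x = 1 is homogenized to express x^n f through standard products. These have
distinct lead monomials, so one of them has the lead monomial of x^n f. -/
theorem exists_degree_eq_of_isHomogeneous (hp : p ≠ 2) (h1234 : gam p M ![1, 2, 3, 4] ≠ 0)
    (h1235 : gam p M ![1, 2, 3, 5] ≠ 0) (h1357 : gam p M ![1, 3, 5, 7] ≠ 0)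
    {f : MvPolynomial (Fin 3) F} (hf : f ∈ invariants p M) (hf0 : f ≠ 0) {d : ℕ}
    (hd : f.IsHomogeneous d) :
    ∃ K, grevlex.degree f = grevlex.degree (powProd (gens p M) K) := by
  have H := hasGensDegrees hp h1234 h1235 h1357
  obtain ⟨b, hb⟩ := exists_interpolation h1357 (M 1)
  obtain ⟨c, hc⟩ := Finsupp.mem_span_range_iff_exists_finsupp.mp
    (theta_mem_span hp h1234 h1235 h1357 hb hf)
  set w : (Fin 5 →₀ ℕ) → ℕ := fun K =>
    K.sum fun j n => ![1, p ^ 2, p ^ 2 + 2 * p, p ^ 3 + 2, p ^ 4] j * n with hw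
  set n := c.support.sup (fun K => w K.1) with hn
  -- Padding by x brings all products to the total degree n + d of x^n f; the choice of n keeps the
  -- subtraction from truncating.
  set e : {K : Fin 5 →₀ ℕ // K 0 = 0 ∧ K 2 < p ∧ K 3 < p} → (Fin 5 →₀ ℕ) :=
    fun K => K.1 + Finsupp.single 0 (n + d - w K) with he
  have hpe (K) : powProd (gens p M) (e K) = powProd (gens p M) K * X 2 ^ (n + d - w K) := by
    rw [he, powProd_add, powProd_single]
    rfl
  have hg0 (K) : powProd (gens p M) (e K) ≠ 0 := powProd_ne_zero H.ne_zero _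
  have hinj : Function.Injective fun K => grevlex.degree (powProd (gens p M) (e K)) := by
    intro K L h
    have hst (K) : (e K) 2 < p ∧ (e K) 3 < p := by
      simpa [he] using K.2.2
    have h1 := H.degree_standard_injective Fact.out hp
      (a₁ := ⟨e K, hst K⟩) (a₂ := ⟨e L, hst L⟩) h
    have h2 : e K = e L := congrArg Subtype.val h1
    refine Subtype.ext (Finsupp.ext fun i => ?_)
    have h3 := DFunLike.congr_fun h2 i
    by_cases hi : i = 0
    · rw [hi, K.2.1, L.2.1]
    · simpa [he, Finsupp.single_apply, Ne.symm hi] using h3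
  have hsum : X 2 ^ n * f = c.sum fun K a => a • powProd (gens p M) (e K) := by
    rw [← sub_eq_zero]
    refine eq_zero_of_theta_eq_zero p b (d := n + d) (((isHomogeneous_X_pow _ _).mul hd).sub
      (IsHomogeneous.sum _ _ _ fun K hK => ?_)) ?_
    · have hle : w K ≤ n := Finset.le_sup
        (f := fun K : {K : Fin 5 →₀ ℕ // K 0 = 0 ∧ K 2 < p ∧ K 3 < p} => w K.1) hK
      have h1 := (powProd_isHomogeneous (h := gens p M) H.hom (K : Fin 5 →₀ ℕ)).mul
        (isHomogeneous_X_pow (R := F) (2 : Fin 3) (n + d - w K))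
      rw [← hpe] at h1
      have h2 : w K + (n + d - w K) = n + d := by omega
      change (c K • powProd (gens p M) (e K)).IsHomogeneous (n + d)
      rw [smul_eq_C_mul]
      exact (h2 ▸ h1).C_mul _
    · rw [map_sub, map_mul, map_pow, theta_X_two, one_pow, one_mul, ← hc, Finsupp.sum,
        Finsupp.sum, map_sum, sub_eq_zero]
      refine Finset.sum_congr rfl fun K _ => ?_
      rw [map_smul, hpe, map_mul, map_pow, theta_X_two, one_pow, mul_one]
  have hc0 : c ≠ 0 := by
    rintro rfl
    rw [Finsupp.sum_zero_index] at hsum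
    exact mul_ne_zero (pow_ne_zero _ (X_ne_zero _)) hf0 hsum
  obtain ⟨⟨K, -, hK⟩, -⟩ := degree_linearCombination grevlex _ hg0 hinj c hc0
  rw [← hsum, grevlex.degree_mul (pow_ne_zero _ (X_ne_zero _)) hf0, grevlex.degree_pow,
    grevlex.degree_X, H.degree_powProd] at hK
  have k0 := DFunLike.congr_fun hK 0
  have k1 := DFunLike.congr_fun hK 1
  have k2 := DFunLike.congr_fun hK 2
  simp at k0 k1 k2
  -- Since x is itself a generator and the other lead monomials do not involve it, cancelling x^n
  -- changes only the exponent of x.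
  refine ⟨(e K).update 0 (grevlex.degree f 2), ?_⟩
  rw [H.degree_powProd]
  ext i
  fin_cases i
  · simpa [Function.update_apply] using k0
  · simpa [Function.update_apply] using k1
  · simp

theorem exists_degree_eq (hp : p ≠ 2) (h1234 : gam p M ![1, 2, 3, 4] ≠ 0)
    (h1235 : gam p M ![1, 2, 3, 5] ≠ 0) (h1357 : gam p M ![1, 3, 5, 7] ≠ 0)
    (f : MvPolynomial (Fin 3) F) (hf : f ∈ invariants p M) (hf0 : f ≠ 0) :
    ∃ K, grevlex.degree f = grevlex.degree (powProd (gens p M) K) := by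
  obtain ⟨d, h0, hd⟩ := degree_homogeneousComponent hf0
  obtain ⟨K, hK⟩ := exists_degree_eq_of_isHomogeneous hp h1234 h1235 h1357
    (homogeneousComponent_mem_invariants hf d) h0 (homogeneousComponent_isHomogeneous d f)
  exact ⟨K, hd ▸ hK⟩

end LeadMonomials

/-! ### SAGBI bases and presentations -/

section Sagbi

variable {F : Type*} [Field F]

theorem leadMonomial_powProd {n : ℕ} {h : Fin n → MvPolynomial (Fin 3) F} (h0 : ∀ j, h j ≠ 0)
    (K : Fin n →₀ ℕ) : leadMonomial (powProd h K) = ∏ j, leadMonomial (h j) ^ K j := by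
  rw [leadMonomial, powProd, Finsupp.prod_fintype _ _ (fun _ => pow_zero _),
    grevlex.degree_prod fun j _ => pow_ne_zero _ (h0 j), monomial_sum_one]
  refine Finset.prod_congr rfl fun j _ => ?_
  rw [grevlex.degree_pow, monomial_pow, one_pow]

theorem leadTerm_eq_smul (f : MvPolynomial (Fin 3) F) :
    leadTerm f = grevlex.leadingCoeff f • leadMonomial f := by
  rw [leadMonomial, smul_monomial, smul_eq_mul, mul_one]
  rfl

/-- A finite family whose products realize all lead monomials of `A` is a SAGBI basis. -/
theorem isSagbiBasis_range {n : ℕ} {h : Fin n → MvPolynomial (Fin 3) F}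
    {A : Subalgebra F (MvPolynomial (Fin 3) F)} (hA : ∀ j, h j ∈ A) (h0 : ∀ j, h j ≠ 0)
    (hLM : ∀ f ∈ A, f ≠ 0 → ∃ K, grevlex.degree f = grevlex.degree (powProd h K)) :
    IsSagbiBasis A (Set.range h) := by
  refine ⟨Set.range_subset_iff.mpr hA, le_antisymm (Algebra.adjoin_le ?_) (Algebra.adjoin_le ?_)⟩
  · rintro _ ⟨_, ⟨j, rfl⟩, rfl⟩
    have hl := grevlex.leadingCoeff_ne_zero_iff.mpr (h0 j)
    have hm : leadTerm (h j) ∈ Algebra.adjoin F (leadTerm '' (A : Set _)) :=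
      Algebra.subset_adjoin ⟨_, hA j, rfl⟩
    rw [leadTerm_eq_smul] at hm
    rw [← inv_smul_smul₀ hl (leadMonomial (h j))]
    exact Subalgebra.smul_mem _ hm _
  · rintro _ ⟨f, hf, rfl⟩
    by_cases hf0 : f = 0
    · rw [hf0, leadTerm, MonomialOrder.leadingTerm_zero]
      exact Subalgebra.zero_mem _
    obtain ⟨K, hK⟩ := hLM f hf hf0
    rw [leadTerm_eq_smul, leadMonomial, hK]
    refine Subalgebra.smul_mem _ ?_ _
    have := leadMonomial_powProd h0 K
    rw [leadMonomial] at this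
    rw [this]
    refine Subalgebra.prod_mem _ fun j _ => pow_mem (Algebra.subset_adjoin ?_) _
    exact Set.mem_image_of_mem _ (Set.mem_range_self j)

theorem adjoin_range_eq {n : ℕ} {h : Fin n → MvPolynomial (Fin 3) F}
    {A : Subalgebra F (MvPolynomial (Fin 3) F)} (hA : ∀ j, h j ∈ A) (h0 : ∀ j, h j ≠ 0)
    (hLM : ∀ f ∈ A, f ≠ 0 → ∃ K, grevlex.degree f = grevlex.degree (powProd h K)) :
    Algebra.adjoin F (Set.range h) = A := by
  refine le_antisymm (Algebra.adjoin_le (Set.range_subset_iff.mpr hA)) fun f hf => ?_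
  rw [Algebra.adjoin_range_eq_range_aeval]
  obtain ⟨P, hP⟩ := exists_subducts_zero hA h0 hLM f hf
  exact ⟨P, by simpa using hP.aeval_eq⟩

theorem isCompleteIntersection_of_ker {n : ℕ} {h : Fin n → MvPolynomial (Fin 3) F}
    {A : Subalgebra F (MvPolynomial (Fin 3) F)} (hA : Algebra.adjoin F (Set.range h) = A)
    {R₁ R₂ : MvPolynomial (Fin n) F}
    (hker : RingHom.ker (aeval (R := F) h) = Ideal.span {R₁, R₂})
    (hreg : RingTheory.Sequence.IsRegular (MvPolynomial (Fin n) F) [R₁, R₂]) :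
    IsCompleteIntersection F A := by
  rw [Algebra.adjoin_range_eq_range_aeval] at hA
  refine ⟨n, (aeval h).codRestrict A fun P => hA ▸ ⟨P, rfl⟩, [R₁, R₂], ?_, hreg, ?_⟩
  · rintro ⟨f, hf⟩
    obtain ⟨P, hP⟩ := (SetLike.ext_iff.mp hA f).mpr hf
    exact ⟨P, Subtype.ext hP⟩
  · rw [Ideal.ofList_cons, Ideal.ofList_singleton, ← Ideal.span_insert, ← hker]
    ext P
    rw [RingHom.mem_ker, RingHom.mem_ker, ← Subtype.val_inj]
    rfl

end Sagbi

/-! ### The first tête-à-tête -/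

section TeteATete

theorem grevlex_lt_of_lt {u v u' v' : ℕ} (hu : u' < u) (h : u + v = u' + v') :
    (Finsupp.single 2 u + Finsupp.single 1 v : Fin 3 →₀ ℕ) ≺[grevlex]
      Finsupp.single 2 u' + Finsupp.single 1 v' := by
  rw [grevlex_lt_iff_key]
  simp
  omega

variable {F : Type*} [Field F] {p : ℕ} [Fact p.Prime] [CharP F p]
  {M : Matrix (Fin 2) (Fin 4) F}

/-- Divided by γ₁₂₃₅^p, the definition of f̃₃ is itself the subduction: each summand is the lead
term of what remains once the preceding ones are removed. -/
theorem exists_tatSubducts_gens₂ (hp : p ≠ 2) (h1234 : gam p M ![1, 2, 3, 4] ≠ 0)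
    (h1235 : gam p M ![1, 2, 3, 5] ≠ 0) (h1357 : gam p M ![1, 3, 5, 7] ≠ 0) :
    ∃ (d : F) (Q : MvPolynomial (Fin 3) F), d ≠ 0 ∧
      TatSubducts (gens₂ p M) (Finsupp.single 1 (p + 2)) (Finsupp.single 2 p) Q
        (C d * X 2 ^ (2 * p ^ 2 - 2) * f₃ p M) := by
  obtain ⟨m, hpm⟩ := exists_eq_two_mul_add_three (p := p) hp
  obtain ⟨i1, i2, i3⟩ := pow_inequalities (p := p) hp
  have h3 := three_le_of_ne_two (p := p) hp
  have hm1 : (p - 3) / 2 = m := by omega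
  have hm2 : (p + 1) / 2 = m + 2 := by omega
  obtain ⟨-, -, a2, a3, a4⟩ := f₁_properties hp h1234 h1357
  obtain ⟨-, -, -, b2, b3, b4, -⟩ := f₂_properties hp h1234 h1235 h1357
  obtain ⟨c1, -, -, c2, c3, -⟩ := f₃_properties hp h1234 h1235 h1357
  set a := gam p M ![1, 2, 3, 4] with ha
  set b := gam p M ![1, 2, 3, 5] with hb
  have h0 (j : Fin 3) : gens₂ p M j ≠ 0 := by
    fin_cases j
    exacts [X_ne_zero _, a2, b2]
  have hpow (i j k : ℕ) : powProd (gens₂ p M) (Finsupp.single 0 i + Finsupp.single 1 j +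
      Finsupp.single 2 k) = X 2 ^ i * f₁ p M ^ j * f₂ p M ^ k := by
    rw [powProd_add, powProd_add, powProd_single, powProd_single, powProd_single]
    rfl
  have hdeg (i j k : ℕ) : grevlex.degree (powProd (gens₂ p M) (Finsupp.single 0 i +
      Finsupp.single 1 j + Finsupp.single 2 k)) =
      Finsupp.single 2 i + Finsupp.single 1 (p ^ 2 * j + (p ^ 2 + 2 * p) * k) := by
    rw [hpow, grevlex.degree_mul (mul_ne_zero (pow_ne_zero _ (X_ne_zero _)) (pow_ne_zero _ a2))
      (pow_ne_zero _ b2), grevlex.degree_mul (pow_ne_zero _ (X_ne_zero _)) (pow_ne_zero _ a2),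
      grevlex.degree_pow, grevlex.degree_pow, grevlex.degree_pow, grevlex.degree_X, a3, b3]
    ext i
    fin_cases i <;> simp
    ring
  have hbp : b ^ p ≠ 0 := pow_ne_zero _ h1235
  -- The scalar for which d x^(2p²-2) f̄₃ = f̃₃ / b^p.
  set d : F := -(a ^ (2 * p + 2) / b ^ (p + 1)) with hd
  have hd0 : d ≠ 0 := neg_ne_zero.mpr (div_ne_zero (pow_ne_zero _ h1234) (pow_ne_zero _ h1235))
  set r := C d * X 2 ^ (2 * p ^ 2 - 2) * f₃ p M with hr
  have hrt : r = C (b ^ p)⁻¹ * f₃Tilde p M := by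
    have e : d * b ^ (p + 1) = -a ^ (2 * p + 2) := by
      rw [hd]
      have := pow_ne_zero (p + 1) h1235
      field_simp
    have e1 : C (b ^ (p + 1)) * r = C (b ^ (p + 1)) * (C (b ^ p)⁻¹ * f₃Tilde p M) := by
      have e2 : C (b ^ (p + 1)) * C (b ^ p)⁻¹ = (C b : MvPolynomial (Fin 3) F) := by
        rw [← C_mul]
        congr 1
        rw [pow_succ]
        field_simp
      have e3 : C d * C (b ^ (p + 1)) = -(C (a ^ (2 * p + 2)) : MvPolynomial (Fin 3) F) := by
        rw [← C_mul, e, C_neg]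
      rw [hr]
      linear_combination X 2 ^ (2 * p ^ 2 - 2) * f₃ p M * e3 - f₃Tilde p M * e2 - c1
    exact mul_left_cancel₀ (C_ne_zero.mpr (pow_ne_zero _ h1235)) e1
  have hrdeg : grevlex.degree r = Finsupp.single 2 (2 * p ^ 2 - 2) +
      Finsupp.single 1 (p ^ 3 + 2) := by
    rw [hr, mul_assoc, degree_C_mul hd0, grevlex.degree_mul (pow_ne_zero _ (X_ne_zero _)) c2, c3,
      grevlex.degree_pow, grevlex.degree_X]
    simp
  have e3 : p ^ 2 * p = p ^ 3 := by ring
  have e2 : p ^ 2 * (p - 1) + p ^ 2 = p ^ 3 := by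
    rw [← Nat.mul_succ, Nat.succ_eq_add_one, Nat.sub_add_cancel (by omega), ← pow_succ]
  have e4 : p ^ 2 * m + (p ^ 2 + 2 * p) * (m + 2) = p ^ 3 + p := by rw [hpm]; ring
  -- The exponents of x decrease from 2p² - 2 in the remainder through 2p² - p, 2p² - 2p, p² to p² -
  -- 2p. Among monomials x^u y^v of one degree, fewer factors x means larger.
  obtain ⟨⟨P₄, hP₄⟩, l₄⟩ := (Subducts.refl (h := gens₂ p M) r).cons h0
    (Finsupp.single 0 (2 * p ^ 2 - p) + Finsupp.single 1 m + Finsupp.single 2 (m + 2))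
    (-(alpha₄ p M / b ^ p)) (by
      rw [hrdeg, hdeg, e4]
      exact grevlex_lt_of_lt (by omega) (by omega))
  obtain ⟨⟨P₃, hP₃⟩, l₃⟩ := hP₄.cons h0
    (Finsupp.single 0 (2 * p ^ 2 - 2 * p) + Finsupp.single 1 (p - 1) + Finsupp.single 2 1)
    (-(alpha₃ p M / b ^ p)) (by
      refine l₄.trans_lt ?_
      rw [hdeg, hdeg, e4]
      exact grevlex_lt_of_lt (by omega) (by omega))
  obtain ⟨⟨P₂, hP₂⟩, l₂⟩ := hP₃.cons h0
    (Finsupp.single 0 (p ^ 2) + Finsupp.single 1 (p + 1) + Finsupp.single 2 0)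
    (-(alpha₂ p M / b ^ p)) (by
      refine l₃.trans_lt ?_
      rw [hdeg, hdeg]
      exact grevlex_lt_of_lt (by omega) (by rw [mul_add, e3]; omega))
  obtain ⟨⟨P₁, hP₁⟩, -⟩ := hP₂.cons h0
    (Finsupp.single 0 (p ^ 2 - 2 * p) + Finsupp.single 1 p + Finsupp.single 2 1)
    2 (by
      refine l₂.trans_lt ?_
      rw [hdeg, hdeg]
      exact grevlex_lt_of_lt (by omega) (by rw [mul_add, e3]; omega))
  refine ⟨d, _, hd0, a ^ 2 / b ^ p, P₁, ?_, ?_, rfl⟩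
  · have hc : a ^ 2 / b ^ p ≠ 0 := div_ne_zero (pow_ne_zero _ h1234) hbp
    rw [leadTerm_eq_iff, degree_C_mul hc, leadingCoeff_C_mul, powProd_single, powProd_single]
    change grevlex.degree (f₁ p M ^ (p + 2)) = grevlex.degree (f₂ p M ^ p) ∧
      grevlex.leadingCoeff (f₁ p M ^ (p + 2)) =
        a ^ 2 / b ^ p * grevlex.leadingCoeff (f₂ p M ^ p)
    rw [grevlex.degree_pow, grevlex.degree_pow, grevlex.leadingCoeff_pow,
      grevlex.leadingCoeff_pow, a3, a4, b3, b4]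
    constructor
    · rw [Finsupp.smul_single, Finsupp.smul_single]
      congr 1
      simp only [smul_eq_mul]
      ring
    · rw [mul_pow, pow_add]
      field_simp
  · convert hP₁ using 1
    rw [hpow, hpow, hpow, hpow, hrt, f₃Tilde, hm1, hm2, powProd_single, powProd_single]
    change f₁ p M ^ (p + 2) - C (a ^ 2 / b ^ p) * f₂ p M ^ p = _
    have hinv : C (b ^ p)⁻¹ * C (b ^ p) = (1 : MvPolynomial (Fin 3) F) := by
      rw [← C_mul, inv_mul_cancel₀ hbp, C_1]
    rw [show (C (-2 * b ^ p) : MvPolynomial (Fin 3) F) = -2 * C (b ^ p) by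
      rw [C_mul, C_neg, map_ofNat]]
    simp only [div_eq_mul_inv, C_mul, C_neg, map_ofNat]
    rw [pow_zero, pow_one]
    linear_combination (-f₁ p M ^ (p + 2) + 2 * X 2 ^ (p ^ 2 - 2 * p) * f₁ p M ^ p * f₂ p M) * hinv

end TeteATete

end RankFour

theorem mainTheorem2 {F : Type*} [Field F] (p : ℕ) [Fact p.Prime] [CharP F p] (hp : p ≠ 2)
    (M : Matrix (Fin 2) (Fin 4) F)
    (h1234 : gam p M ![1, 2, 3, 4] ≠ 0) (h1235 : gam p M ![1, 2, 3, 5] ≠ 0)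
    (h1357 : gam p M ![1, 3, 5, 7] ≠ 0) :
    -- the divisions in the definitions of `f̄₂` and `f̄₃` are exact
    2 * X 2 ^ (p ^ 2 - 2 * p) * f₂ p M =
      f₁ p M ^ 2 + C (gam p M ![1, 2, 3, 4]) * fMinor p M ![1, 2, 3, 4, 6] ∧
    C (gam p M ![1, 2, 3, 4] ^ (2 * p + 2)) * X 2 ^ (2 * p ^ 2 - 2) * f₃ p M =
      -(C (gam p M ![1, 2, 3, 5]) * f₃Tilde p M) ∧
    -- up to a scalar, `x^(2p²-2) f̄₃` is a subduction of `(f̄₁^(p+2), f̄₂^p)` using `{x, f̄₁, f̄₂}`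
    (∃ (d : F) (Q : MvPolynomial (Fin 3) F), d ≠ 0 ∧
      TatSubducts (gens₂ p M) (Finsupp.single 1 (p + 2)) (Finsupp.single 2 p) Q
        (C d * X 2 ^ (2 * p ^ 2 - 2) * f₃ p M)) ∧
    leadTerm (f₃ p M) = C (gam p M ![1, 3, 5, 7]) * X 1 ^ (p ^ 3 + 2) ∧
    -- `{x, f̄₁, f̄₂, f̄₃, N_M(z)}` is a SAGBI basis, and hence a generating set
    IsSagbiBasis (invariants p M) (Set.range (gens p M)) ∧
    Algebra.adjoin F (Set.range (gens p M)) = invariants p M ∧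
    -- the ring of invariants is a complete intersection
    IsCompleteIntersection F (invariants p M) ∧
    -- `(f̄₂^p, f̄₁^(p+2))` and `(f̄₃^p, f̄₂ f̄₁^(p²-1))` subduct to zero
    (∃ R₁, TatSubducts (gens p M) (Finsupp.single 2 p) (Finsupp.single 1 (p + 2)) R₁ 0) ∧
    (∃ R₂, TatSubducts (gens p M) (Finsupp.single 3 p)
      (Finsupp.single 2 1 + Finsupp.single 1 (p ^ 2 - 1)) R₂ 0) ∧
    -- the resulting relations generate the ideal of relations and form a regular sequence
    ∀ R₁ R₂ : MvPolynomial (Fin 5) F,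
      TatSubducts (gens p M) (Finsupp.single 2 p) (Finsupp.single 1 (p + 2)) R₁ 0 →
      TatSubducts (gens p M) (Finsupp.single 3 p)
        (Finsupp.single 2 1 + Finsupp.single 1 (p ^ 2 - 1)) R₂ 0 →
      RingHom.ker (aeval (R := F) (gens p M)) = Ideal.span {R₁, R₂} ∧
      RingTheory.Sequence.IsRegular (MvPolynomial (Fin 5) F) [R₁, R₂] := by
  have H := hasGensDegrees hp h1234 h1235 h1357
  have hA := gens_mem hp h1234 h1235 h1357
  have hLM := exists_degree_eq hp h1234 h1235 h1357
  have hprime : p.Prime := Fact.out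
  obtain ⟨hf₃, -, -, -, hd₃, hl₃⟩ := f₃_properties hp h1234 h1235 h1357
  have hadj := adjoin_range_eq hA H.ne_zero hLM
  obtain ⟨R₁, t₁⟩ := exists_tatSubducts_zero hA H.ne_zero hLM _ _ H.degree_tat₁
  obtain ⟨R₂, t₂⟩ := exists_tatSubducts_zero hA H.ne_zero hLM _ _ (H.degree_tat₂ hprime.pos)
  -- Subductions involve choices, so this is proved for any pair of resulting relations and not only
  -- for the pair just constructed.
  have hrel (R₁ R₂ : MvPolynomial (Fin 5) F)
      (t₁ : TatSubducts (gens p M) (Finsupp.single 2 p) (Finsupp.single 1 (p + 2)) R₁ 0)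
      (t₂ : TatSubducts (gens p M) (Finsupp.single 3 p)
        (Finsupp.single 2 1 + Finsupp.single 1 (p ^ 2 - 1)) R₂ 0) :
      RingHom.ker (aeval (R := F) (gens p M)) = Ideal.span {R₁, R₂} ∧
      RingTheory.Sequence.IsRegular (MvPolynomial (Fin 5) F) [R₁, R₂] :=
    ⟨H.ker_aeval hprime hp t₁ t₂, H.isRegular hprime hp t₁ t₂⟩
  obtain ⟨hker, hreg⟩ := hrel R₁ R₂ t₁ t₂
  refine ⟨(f₂_properties hp h1234 h1235 h1357).1, hf₃,
    exists_tatSubducts_gens₂ hp h1234 h1235 h1357, ?_, isSagbiBasis_range hA H.ne_zero hLM, hadj,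
    isCompleteIntersection_of_ker hadj hker hreg, ⟨R₁, t₁⟩, ⟨R₂, t₂⟩, hrel⟩
  rw [leadTerm_eq_smul, leadMonomial, hd₃, hl₃, smul_monomial, smul_eq_mul, mul_one,
    C_mul_X_pow_eq_monomial]
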